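/- **Setting.** Let $\mathcal K$ be the set of open double cones of 4-dimensional Minkowski space, and write $a\perp b$ for spacelike separation. Let $\mathcal H$ be an infinite-dimensional separable complex Hilbert space and $\mathcal K\ni a\mapsto\mathfrak A(a)$ a net of von Neumann algebras on $\mathcal H$ satisfying isotony ($a\subseteq b\Rightarrow\mathfrak A(a)\subseteq\mathfrak A(b)$), locality ($a\perp b\Rightarrow\mathfrak A(a)\subseteq\mathfrak A(b)'$), irreducibility ($\mathfrak A'=\mathbb C1$, where $\mathfrak A$ is the $C^*$-algebra generated by all $\mathfrak A(a)$) and Haag duality ($\mathfrak A(a^\perp)'=\mathfrak A(a)$, where $\mathfrak A(a^\perp)$ is the $C^*$-algebra generated by all $\mathfrak A(c)$ with $c\perp a$). A (not necessarily unital) $*$-morphism $\rho:\mathfrak A\to\mathfrak B(\mathcal H)\otimes\mathbb M_n$ is *localized in $o\in\mathcal K$* if $\rho(A)=(A\otimes 1_n)\rho(1)$ for all $A\in\mathfrak A(a)$, $a\perp o$. An *intertwiner* $T\in(\rho,\sigma)$ is an operator with $T\rho(1)=T=\sigma(1)T$ and $T\rho(A)=\sigma(A)T$ for all $A\in\mathfrak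 A$. The morphism $\rho$ is *transportable* if for every $o$ there are $\tau$ localized in $o$ and a unitary $U\in(\rho,\tau)$, i.e. $U^*U=\rho(1)$, $UU^*=\tau(1)$. Let $\mathcal B(\mathfrak A)$ be the category whose objects are the localized (in some $o$) transportable morphisms $\rho:\mathfrak A\to\mathfrak A\otimes\mathbb M_{n_\rho}$ and whose arrows are the intertwiners with values in $\mathfrak A$; here $1_\rho=\rho(1)$. It is a tensor category with $(\rho\sigma)(A)_{(i_1,i_2),(j_1,j_2)}=\rho(\sigma(A)_{i_2,j_2})_{i_1,j_1}$, $(T\times S)_{(i_1,i_2),(j_1,j_2)}=\sum_kT_{i_1,k}\,\rho_1(S_{i_2,j_2})_{k,j_1}$ for $T\in(\rho_1,\rho_2)$, $S\in(\sigma_1,\sigma_2)$, and unit $\iota(A)=A$. It has the symmetry $\varepsilon(\rho,\sigma)=(V^*\times U^*)\,\theta\,(U\times V)$, where $U\in(\rho,\rho_1)$, $V\in(\sigma,\sigma_1)$ are any unitaries with $\rho_1,\sigma_1$ localized in spacelike separated double cones and $\theta$ is the flip of tensor factors. An isometry $V\in(\rho,\sigma)$ satisfies $V^*V=1_\rho$;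 $\rho$ is *irreducible* if $\rho\neq0$ and $(\rho,\rho)=\mathbb C1_\rho$; $\rho$ is a *finite direct sum* of $\rho_1,\dots,\rho_k$ if there are isometries $W_i\in(\rho_i,\rho)$ with $\sum_iW_iW_i^*=1_\rho$ (the zero object is the empty direct sum). * *Extension.* For $a\in\mathcal K$ and $A\in\mathfrak A(a)'$ put ${}_a\rho(A)=U^*(A\otimes1)U$, where $U$ is any unitary intertwiner from $\rho$ to a morphism localized in $a$. The object $\rho$ is *faithful* if it is injective on $\mathfrak A$, and *doubly faithful* if every ${}_a\rho$ is injective on $\mathfrak A(a)'$. * *Homogeneity.* A *presheaf-left inverse* of $\rho$ localized in $o$ is a family of normalized (${}_a\varphi(\rho(1))=1$) completely positive linear maps ${}_a\varphi:\rho(1)(\mathfrak A(a)'\otimes\mathbb M_{n_\rho})\rho(1)\to\mathfrak A(a)'$, $a\perp o$, such that ${}_a\varphi$ extends ${}_b\varphi$ when $a\subseteq b$ ($a,b\perp o$), and ${}_a\varphi(B\,{}_a\rho(A))={}_a\varphi(B)A$ for $A\in\mathfrak A(a)'$. The object $\rho$ is *homogeneous* if, for every $a\in\mathcal K$, each object localized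 in $a$ and unitarily equivalent to $\rho$ has a presheaf-left inverse with respect to $a$. * *Statistics.* $\gamma$ is *simple* if $\varepsilon(\gamma,\gamma)=\pm1_{\gamma^2}$. For an irreducible $\rho$, a *triple* $(d,\gamma,V)$ consists of an integer $d\ge1$, a faithful simple object $\gamma$ and an isometry $V\in(\gamma,\rho^d)$ such that $VV^*$ is the antisymmetrizer or the symmetrizer of the representation of the permutation group $\mathbb P(d)$ on $\rho^d$ defined by $\varepsilon$. An object has *finite statistics* if it is a finite direct sum of irreducibles that have a triple. $\mathcal B(\mathfrak A)_{\mathrm{fh}}$ is the full subcategory of the finite direct sums of irreducibles that have a triple and for whose triples $\gamma$ is doubly faithful. * *Conjugates.* $\rho$ *has conjugates* if there are an object $\bar\rho$ and arrows $R\in(\iota,\bar\rho\rho)$, $\bar R\in(\iota,\rho\bar\rho)$ with $$(\bar R^*\times1_\rho)\cdot(1_\rho\times R)=1_\rho,\qquad (R^*\times1_{\bar\rho})\cdot(1_{\bar\rho}\times\bar R)=1_{\bar\rho}.$$ **Theorem 4.1.** Every object $\rho$ of $\mathcal B(\mathfrak A)$ that has conjugates belongs to $\mathcal B(\mathfrak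 A)_{\mathrm{fh}}$. In particular it has finite statistics, and it is a finite direct sum of homogeneous irreducible objects. If moreover $\rho\ne0$, then $\rho$ is homogeneous, and whenever $\rho,\bar\rho$ are localized in $o$ and $R,\bar R$ solve the conjugate equations, $R^*R$ is a positive scalar and $${}_a\varphi(B)=(R^*R)^{-1}\,R^*\,{}_a\bar\rho(B)\,R,\qquad B\in\rho(1)(\mathfrak A(a)'\otimes\mathbb M_{n_\rho})\rho(1),\ a\perp o$$ (with ${}_a\bar\rho$ applied to the entries of $B$), is a presheaf-left inverse of $\rho$ with respect to $o$. -/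

import Mathlib

open scoped Matrix ComplexOrder InnerProductSpace

set_option linter.unusedSectionVars false

namespace Sectors

/-! ### Geometry of four-dimensional Minkowski space -/

/-- Minkowski space: a time coordinate and three Euclidean space coordinates (with `c = 1`). -/
abbrev Minkowski : Type := ℝ × EuclideanSpace ℝ (Fin 3)

/-- The open forward light cone. -/
def forwardCone : Set Minkowski := {x | ‖x.2‖ < x.1}

/-- Two events are spacelike separated if `(x₀ - y₀)² < |x - y|²`. -/
def Spacelike (x y : Minkowski) : Prop := |x.1 - y.1| < ‖x.2 - y.2‖

/-- An open double cone, given by its past and its future tip. -/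
structure DoubleCone where
  past : Minkowski
  future : Minkowski
  past_lt_future : future - past ∈ forwardCone

/-- The points of an open double cone. -/
def DoubleCone.region (o : DoubleCone) : Set Minkowski :=
  {x | x - o.past ∈ forwardCone ∧ o.future - x ∈ forwardCone}

/-- The spacelike complement of a region. -/
def spacelikeCompl (S : Set Minkowski) : Set Minkowski := {x | ∀ y ∈ S, Spacelike x y}

/-- `a ⊥ b`: all points of `a` are spacelike to all points of `b`. -/
def DoubleCone.Perp (a b : DoubleCone) : Prop := ∀ x ∈ a.region, ∀ y ∈ b.region, Spacelike x y

/-- Inclusion `a ⊆ b` of double cones. -/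
def DoubleCone.Sub (a b : DoubleCone) : Prop := a.region ⊆ b.region

lemma forwardCone_add {x y : Minkowski} (hx : x ∈ forwardCone) (hy : y ∈ forwardCone) :
    x + y ∈ forwardCone := by
  simp only [forwardCone, Set.mem_ofPred_eq] at *
  calc ‖(x + y).2‖ ≤ ‖x.2‖ + ‖y.2‖ := norm_add_le _ _
    _ < x.1 + y.1 := add_lt_add hx hy

lemma DoubleCone.Perp.symm {a b : DoubleCone} (h : a.Perp b) : b.Perp a := by
  intro x hx y hy
  have := h y hy x hx
  unfold Spacelike at *
  rwa [abs_sub_comm, norm_sub_rev]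

lemma DoubleCone.Perp.mono {a b c : DoubleCone} (h : b.Perp c) (hab : a.Sub b) : a.Perp c :=
  fun x hx y hy => h x (hab hx) y hy

lemma DoubleCone.perp_of_subset {a b : DoubleCone} (h : b.region ⊆ spacelikeCompl a.region) :
    b.Perp a := fun _ hx y hy => h hx y hy

/-- Any two double cones lie in a common one. -/
lemma DoubleCone.exists_sup (a b : DoubleCone) : ∃ c : DoubleCone, a.Sub c ∧ b.Sub c := by
  set s : ℝ := 1 + |a.past.1| + |b.past.1| + |a.future.1| + |b.future.1| + ‖a.past.2‖ + ‖b.past.2‖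
    + ‖a.future.2‖ + ‖b.future.2‖ with hs
  have h1 := abs_le.1 (le_refl |a.past.1|)
  have h2 := abs_le.1 (le_refl |b.past.1|)
  have h3 := abs_le.1 (le_refl |a.future.1|)
  have h4 := abs_le.1 (le_refl |b.future.1|)
  have n1 := norm_nonneg a.past.2
  have n2 := norm_nonneg b.past.2
  have n3 := norm_nonneg a.future.2
  have n4 := norm_nonneg b.future.2
  have b1 := abs_nonneg a.past.1
  have b2 := abs_nonneg b.past.1
  have b3 := abs_nonneg a.future.1
  have b4 := abs_nonneg b.future.1
  have key : ∀ d : DoubleCone, d.past - ((-s, 0) : Minkowski) ∈ forwardCone →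
      ((s, 0) : Minkowski) - d.future ∈ forwardCone → d.region ⊆
      {x | x - ((-s, 0) : Minkowski) ∈ forwardCone ∧ ((s, 0) : Minkowski) - x ∈ forwardCone} := by
    intro d hd1 hd2 x hx
    refine ⟨?_, ?_⟩
    · have := forwardCone_add hx.1 hd1
      rwa [sub_add_sub_cancel] at this
    · have := forwardCone_add hd2 hx.2
      rwa [sub_add_sub_cancel] at this
  refine ⟨⟨(-s, 0), (s, 0), ?_⟩, key a ?_ ?_, key b ?_ ?_⟩ <;>
    simp [forwardCone] <;> linarith

/-- There are two spacelike separated double cones. -/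
lemma DoubleCone.exists_perp : ∃ a b : DoubleCone, a.Perp b := by
  set e : EuclideanSpace ℝ (Fin 3) := EuclideanSpace.single 0 10 with he
  have hn : ‖e‖ = 10 := by simp [he]
  refine ⟨⟨(-1, 0), (1, 0), ?_⟩, ⟨(-1, e), (1, e), ?_⟩, ?_⟩
  · simp [forwardCone]
  · simp [forwardCone]
  · intro x hx y hy
    simp only [DoubleCone.region, forwardCone, Set.mem_ofPred_eq, Prod.fst_sub, Prod.snd_sub,
      sub_zero, zero_sub, norm_neg] at hx hy
    unfold Spacelike
    have t1 : ‖e‖ ≤ ‖y.2 - e‖ + ‖x.2‖ + ‖x.2 - y.2‖ := by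
      calc ‖e‖ = ‖-(y.2 - e) + x.2 + -(x.2 - y.2)‖ := by congr 1; abel
        _ ≤ ‖-(y.2 - e)‖ + ‖x.2‖ + ‖-(x.2 - y.2)‖ := norm_add₃_le
        _ = _ := by rw [norm_neg, norm_neg]
    rw [norm_sub_rev e y.2] at hy
    rw [abs_lt]
    constructor <;> linarith [hx.1, hx.2, hy.1, hy.2]

/-! ### The net of local observables in the reference representation -/

variable {H : Type*} [NormedAddCommGroup H] [InnerProductSpace ℂ H] [CompleteSpace H]

/-- The C*-algebra generated by the local algebras of the double cones inside a region. -/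
noncomputable def regionAlg (alg : DoubleCone → VonNeumannAlgebra H) (S : Set Minkowski) :
    StarSubalgebra ℂ (H →L[ℂ] H) :=
  (StarAlgebra.adjoin ℂ
    (⋃ c ∈ {c : DoubleCone | c.region ⊆ S}, (alg c : Set (H →L[ℂ] H)))).topologicalClosure

variable (H) in
/-- A net of von Neumann algebras over the double cones, acting irreducibly on the Hilbert space
of the reference representation, with isotony, locality and Haag duality. -/
structure LocalNet where
  alg : DoubleCone → VonNeumannAlgebra H
  isotony : ∀ a b : DoubleCone, a.Sub b → (alg a : Set (H →L[ℂ] H)) ⊆ alg b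
  locality : ∀ a b : DoubleCone, a.Perp b → (alg a : Set (H →L[ℂ] H)) ⊆ (alg b).commutant
  irreducible : ∀ T : H →L[ℂ] H,
    T ∈ Set.centralizer (regionAlg alg Set.univ : Set (H →L[ℂ] H)) → ∃ c : ℂ, T = c • 1
  haag_duality : ∀ a : DoubleCone,
    Set.centralizer (regionAlg alg (spacelikeCompl a.region) : Set (H →L[ℂ] H)) = alg a

/-- The quasilocal algebra: the C*-algebra generated by all local algebras. -/
noncomputable def LocalNet.quasi (A : LocalNet H) : StarSubalgebra ℂ (H →L[ℂ] H) :=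
  regionAlg A.alg Set.univ

lemma LocalNet.alg_subset_quasi (A : LocalNet H) (a : DoubleCone) {x : H →L[ℂ] H}
    (hx : x ∈ A.alg a) : x ∈ A.quasi := by
  apply StarSubalgebra.le_topologicalClosure
  apply StarAlgebra.subset_adjoin
  simp only [Set.mem_iUnion]
  exact ⟨a, Set.subset_univ _, hx⟩

/-- To commute with `T` and `T*` on all local algebras of double cones spacelike to `a` is enough
for `T` to belong to the algebra of `a`. -/
lemma LocalNet.mem_alg_of_commute (A : LocalNet H) (a : DoubleCone) (T : H →L[ℂ] H)
    (h : ∀ b : DoubleCone, b.Perp a → ∀ x ∈ A.alg b, x * T = T * x) : T ∈ A.alg a := by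
  rw [← SetLike.mem_coe, ← A.haag_duality a]
  have hcl : IsClosed {x : H →L[ℂ] H | x * T = T * x} :=
    isClosed_eq (by fun_prop) (by fun_prop)
  intro x hx
  refine closure_minimal (t := {x : H →L[ℂ] H | x * T = T * x}) ?_ hcl hx
  intro y hy
  have : y * T = T * y ∧ star y * T = T * star y := by
    refine StarAlgebra.adjoin_induction
      (p := fun y _ => y * T = T * y ∧ star y * T = T * star y) ?_ ?_ ?_ ?_ ?_ hy
    · intro z hz
      simp only [Set.mem_iUnion] at hz
      obtain ⟨b, hb, hz⟩ := hz
      have hp := DoubleCone.perp_of_subset hb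
      exact ⟨h b hp z hz, h b hp _ (star_mem hz)⟩
    · intro r
      refine ⟨Algebra.commutes r T, ?_⟩
      rw [← algebraMap_star_comm]
      exact Algebra.commutes _ T
    · intro x y _ _ hx hy
      refine ⟨by rw [add_mul, mul_add, hx.1, hy.1], ?_⟩
      rw [star_add, add_mul, mul_add, hx.2, hy.2]
    · intro x y _ _ hx hy
      refine ⟨by rw [mul_assoc, hy.1, ← mul_assoc, hx.1, mul_assoc], ?_⟩
      rw [star_mul, mul_assoc, hx.2, ← mul_assoc, hy.2, mul_assoc]
    · intro x _ hx
      exact ⟨hx.2, by rw [star_star]; exact hx.1⟩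
  exact this.1

/-! ### Localized transportable morphisms

Operators `H ⊗ ℂ^I → H ⊗ ℂ^J` are matrices over `B(H)`; the index type of multiplicity `n` is
`Fin n`, and tensor products of objects are indexed by products of index types. -/

/-- Morphisms of the quasilocal algebra into `B(H) ⊗ M_I` (not assumed unital). -/
abbrev Morphism (A : LocalNet H) (I : Type) [Fintype I] : Type _ :=
  A.quasi →⋆ₙₐ[ℂ] Matrix I I (H →L[ℂ] H)

/-- `X ⊗ 1`. -/
def ampl (I : Type) [DecidableEq I] (X : H →L[ℂ] H) : Matrix I I (H →L[ℂ] H) :=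
  Matrix.diagonal fun _ => X

/-- `ρ` is localized in `o`: `ρ(X) = (X ⊗ 1) ρ(1)` for `X` in any `𝔄(a)` with `a ⊥ o`. -/
def Morphism.LocalizedIn {A : LocalNet H} {I : Type} [Fintype I] [DecidableEq I]
    (ρ : Morphism A I) (o : DoubleCone) : Prop :=
  ∀ a : DoubleCone, a.Perp o → ∀ X : A.quasi, (X : H →L[ℂ] H) ∈ A.alg a →
    ρ X = ampl I (X : H →L[ℂ] H) * ρ 1

/-- `T` is an intertwiner from `ρ` to `σ`. -/
structure Morphism.IsIntertwiner {A : LocalNet H} {I J : Type} [Fintype I] [Fintype J]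
    (ρ : Morphism A I) (σ : Morphism A J) (T : Matrix J I (H →L[ℂ] H)) : Prop where
  mul_one : T * ρ 1 = T
  one_mul : σ 1 * T = T
  intertwine : ∀ X : A.quasi, T * ρ X = σ X * T

/-- `U` is a unitary intertwiner from `ρ` to `σ`. -/
structure Morphism.IsUnitary {A : LocalNet H} {I J : Type} [Fintype I] [Fintype J]
    (ρ : Morphism A I) (σ : Morphism A J) (U : Matrix J I (H →L[ℂ] H)) : Prop where
  isIntertwiner : ρ.IsIntertwiner σ U
  star_mul_self : Uᴴ * U = ρ 1
  mul_star_self : U * Uᴴ = σ 1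

/-- `ρ` can be transported by a unitary intertwiner to any double cone. -/
def Morphism.Transportable {A : LocalNet H} {I : Type} [Fintype I] [DecidableEq I]
    (ρ : Morphism A I) : Prop :=
  ∀ o : DoubleCone, ∃ (m : ℕ) (τ : Morphism A (Fin m)) (U : Matrix (Fin m) I (H →L[ℂ] H)),
    τ.LocalizedIn o ∧ ρ.IsUnitary τ U

/-! ### The tensor category of bimodules of the quasilocal algebra -/

/-- Bimodules of the quasilocal algebra `𝔄`: morphisms into `𝔄 ⊗ M_I`. -/
abbrev Bimodule (A : LocalNet H) (I : Type) [Fintype I] : Type _ :=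
  A.quasi →⋆ₙₐ[ℂ] Matrix I I A.quasi

section Bimodule

variable {A : LocalNet H} {I J K L : Type} [Fintype I] [Fintype J] [Fintype K] [Fintype L]

/-- A matrix over `𝔄` regarded as a matrix over `B(H)`. -/
def toOp (T : Matrix J I A.quasi) : Matrix J I (H →L[ℂ] H) :=
  T.map fun x => (x : H →L[ℂ] H)

lemma toOp_mul (S : Matrix K J A.quasi) (T : Matrix J I A.quasi) :
    toOp (S * T) = toOp S * toOp T := by
  ext1 i j
  simp [toOp, Matrix.mul_apply]

lemma toOp_conjTranspose (T : Matrix J I A.quasi) : toOp Tᴴ = (toOp T)ᴴ := by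
  ext1 i j
  simp [toOp]

lemma toOp_injective : Function.Injective (toOp (A := A) (I := I) (J := J)) := by
  intro S T h
  ext1 i j
  exact Subtype.ext (congrFun (congrFun h i) j)

/-- A bimodule regarded as a morphism into `B(H) ⊗ M_I`. -/
noncomputable def Bimodule.toMorphism (ρ : Bimodule A I) : Morphism A I where
  toFun X := toOp (ρ X)
  map_smul' c X := by ext1 i j; simp [toOp]
  map_zero' := by ext1 i j; simp [toOp]
  map_add' X Y := by ext1 i j; simp [toOp]
  map_mul' X Y := by rw [map_mul, toOp_mul]
  map_star' X := by rw [map_star, Matrix.star_eq_conjTranspose, toOp_conjTranspose]; rfl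

/-- The arrows of the category of bimodules: intertwiners with values in `𝔄`. -/
structure Bimodule.IsArrow (ρ : Bimodule A I) (σ : Bimodule A J) (T : Matrix J I A.quasi) :
    Prop where
  mul_one : T * ρ 1 = T
  one_mul : σ 1 * T = T
  intertwine : ∀ X : A.quasi, T * ρ X = σ X * T

/-- Isometries in the category of bimodules; the identity arrow of `ρ` is `ρ 1`. -/
structure Bimodule.IsIsometry (ρ : Bimodule A I) (σ : Bimodule A J) (V : Matrix J I A.quasi) :
    Prop where
  isArrow : ρ.IsArrow σ V
  star_mul_self : Vᴴ * V = ρ 1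

/-- Unitaries in the category of bimodules. -/
structure Bimodule.IsUnitaryArrow (ρ : Bimodule A I) (σ : Bimodule A J)
    (U : Matrix J I A.quasi) : Prop where
  isIsometry : ρ.IsIsometry σ U
  mul_star_self : U * Uᴴ = σ 1

/-- Transport of a bimodule along a bijection of index types. -/
noncomputable def Bimodule.reindex (ρ : Bimodule A I) (e : I ≃ J) : Bimodule A J where
  toFun X := Matrix.reindex e e (ρ X)
  map_smul' c X := by ext1 i j; simp
  map_zero' := by ext1 i j; simp
  map_add' X Y := by ext1 i j; simp
  map_mul' X Y := by simp [Matrix.submatrix_mul_equiv]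
  map_star' X := by ext1 i j; rw [map_star]; simp [Matrix.star_apply]

/-- The tensor unit, `ι(X) = X`. -/
noncomputable def Bimodule.unit (A : LocalNet H) : Bimodule A Unit where
  toFun X := Matrix.of fun _ _ => X
  map_smul' c X := by ext1 i j; simp
  map_zero' := by ext1 i j; simp
  map_add' X Y := by ext1 i j; simp
  map_mul' X Y := by ext1 i j; simp [Matrix.mul_apply]
  map_star' X := by ext1 i j; simp [Matrix.star_apply]

/-- The tensor product `ρσ` of bimodules,
`(ρσ)(X)_{(i₁,i₂),(j₁,j₂)} = ρ(σ(X)_{i₂,j₂})_{i₁,j₁}`. -/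
noncomputable def Bimodule.tensor (ρ : Bimodule A I) (σ : Bimodule A J) : Bimodule A (I × J) where
  toFun X := Matrix.of fun i j => ρ (σ X i.2 j.2) i.1 j.1
  map_smul' c X := by ext1 i j; simp
  map_zero' := by ext1 i j; simp
  map_add' X Y := by ext1 i j; simp
  map_mul' X Y := by
    ext1 i j
    simp only [map_mul, Matrix.of_apply, Matrix.mul_apply, map_sum, Matrix.sum_apply,
      Fintype.sum_prod_type]
    exact Finset.sum_comm
  map_star' X := by
    ext1 i j
    simp only [map_star, Matrix.of_apply, Matrix.star_apply]

/-- The tensor product of arrows `T ∈ (ρ₁, ρ₂)` and `S ∈ (σ₁, σ₂)`,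
`(T × S)_{(i₁,i₂),(j₁,j₂)} = ∑ k, T_{i₁,k} ρ₁(S_{i₂,j₂})_{k,j₁}`. -/
noncomputable def tensorArrow (ρ₁ : Bimodule A I) (T : Matrix J I A.quasi) (S : Matrix L K A.quasi) :
    Matrix (J × L) (I × K) A.quasi :=
  Matrix.of fun i j => ∑ k, T i.1 k * ρ₁ (S i.2 j.2) k j.1

/-- The permutation matrix `θ` exchanging two tensor factors. -/
noncomputable def flip (A : LocalNet H) (I J : Type) [DecidableEq I] [DecidableEq J] :
    Matrix (J × I) (I × J) A.quasi :=
  Matrix.of fun p q => if p.1 = q.2 ∧ p.2 = q.1 then 1 else 0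

/-- The tensor power `ρ^d`, with multi-indices `Fin d → I`, so that `ρ^(d+1) = ρ ρ^d`. -/
noncomputable def Bimodule.pow (ρ : Bimodule A I) : (d : ℕ) → Bimodule A (Fin d → I)
  | 0 => (Bimodule.unit A).reindex (Equiv.ofUnique Unit (Fin 0 → I))
  | d + 1 => (ρ.tensor (Bimodule.pow ρ d)).reindex (Fin.consEquiv fun _ => I)

end Bimodule

/-! ### The category of localized transportable bimodules -/

/-- Objects of multiplicity `n` of the full subcategory of localized transportable bimodules. -/
structure Obj (A : LocalNet H) (n : ℕ) where
  bim : Bimodule A (Fin n)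
  localized : ∃ o : DoubleCone, bim.toMorphism.LocalizedIn o
  transportable : bim.toMorphism.Transportable

section Obj

variable {A : LocalNet H}

lemma ampl_mul_apply {I J : Type} [Fintype I] [DecidableEq I] (x : H →L[ℂ] H)
    (T : Matrix I J (H →L[ℂ] H)) (i : I) (j : J) : (ampl I x * T) i j = x * T i j := by
  simp [ampl]

lemma mul_ampl_apply {I J : Type} [Fintype J] [DecidableEq J] (x : H →L[ℂ] H)
    (T : Matrix I J (H →L[ℂ] H)) (i : I) (j : J) : (T * ampl J x) i j = T i j * x := by
  simp [ampl]

lemma Morphism.LocalizedIn.apply_eq {I : Type} [Fintype I] [DecidableEq I] {ρ : Morphism A I}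
    {o : DoubleCone} (h : ρ.LocalizedIn o) {a : DoubleCone} (ha : a.Perp o) (X : A.quasi)
    (hX : (X : H →L[ℂ] H) ∈ A.alg a) : ρ X = ρ 1 * ampl I (X : H →L[ℂ] H) := by
  have h1 := h a ha (star X) (star_mem hX)
  have h2 := congrArg star h1
  rw [← map_star, star_star, star_mul, ← map_star, star_one] at h2
  rw [h2]
  congr 1
  ext1 i j
  rw [Matrix.star_apply, ampl, ampl, Matrix.diagonal_apply, Matrix.diagonal_apply]
  by_cases hij : i = j
  · subst hij; simp
  · simp [hij, Ne.symm hij]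

/-- Intertwiners between localized morphisms have values in the local algebras. -/
lemma Morphism.IsIntertwiner.apply_mem {I J : Type} [Fintype I] [DecidableEq I] [Fintype J]
    [DecidableEq J] {ρ : Morphism A I} {σ : Morphism A J} {T : Matrix J I (H →L[ℂ] H)}
    (h : ρ.IsIntertwiner σ T) {o a c : DoubleCone} (hρ : ρ.LocalizedIn o) (hσ : σ.LocalizedIn a)
    (ho : o.Sub c) (ha : a.Sub c) (j : J) (i : I) : T j i ∈ A.alg c := by
  refine A.mem_alg_of_commute c _ fun b hb x hx => ?_
  let X : A.quasi := ⟨x, A.alg_subset_quasi b hx⟩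
  have e : ampl J x * T = T * ampl I x := by
    have h1 := h.intertwine X
    rw [hρ.apply_eq (hb.symm.mono ho).symm X hx, hσ b (hb.symm.mono ha).symm X hx,
      ← Matrix.mul_assoc, h.mul_one, Matrix.mul_assoc, h.one_mul] at h1
    exact h1.symm
  have := congrFun (congrFun e j) i
  rwa [ampl_mul_apply, mul_ampl_apply] at this

/-- The bimodule `U ρ(·) U*`, for `U` with `U* U = ρ(1)`. -/
noncomputable def Bimodule.conj {I J : Type} [Fintype I] [Fintype J] (ρ : Bimodule A I)
    (U : Matrix J I A.quasi) (hU : Uᴴ * U = ρ 1) : Bimodule A J where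
  toFun X := U * ρ X * Uᴴ
  map_smul' c X := by rw [map_smul, Matrix.mul_smul, Matrix.smul_mul]; rfl
  map_zero' := by rw [map_zero, Matrix.mul_zero, Matrix.zero_mul]
  map_add' X Y := by rw [map_add, Matrix.mul_add, Matrix.add_mul]
  map_mul' X Y := by
    have h : ρ (X * Y) = ρ X * (Uᴴ * U) * ρ Y := by
      rw [hU, ← map_mul, ← map_mul, mul_one]
    rw [h]
    simp only [Matrix.mul_assoc]
  map_star' X := by
    rw [map_star]
    simp only [Matrix.star_eq_conjTranspose, Matrix.conjTranspose_mul,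
      Matrix.conjTranspose_conjTranspose, Matrix.mul_assoc]

/-- The object is localized in `o`. -/
def Obj.LocalizedIn {n : ℕ} (ρ : Obj A n) (o : DoubleCone) : Prop :=
  ρ.bim.toMorphism.LocalizedIn o

/-- Objects can be transported to any double cone by a unitary arrow of the category. -/
lemma Obj.exists_transport {n : ℕ} (ρ : Obj A n) (o : DoubleCone) :
    ∃ (m : ℕ) (τ : Obj A m) (U : Matrix (Fin m) (Fin n) A.quasi),
      τ.LocalizedIn o ∧ ρ.bim.IsUnitaryArrow τ.bim U := by
  obtain ⟨m, τ, U, hτ, hU⟩ := ρ.transportable o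
  obtain ⟨o', ho'⟩ := ρ.localized
  obtain ⟨c, hc1, hc2⟩ := DoubleCone.exists_sup o' o
  let V : Matrix (Fin m) (Fin n) A.quasi := Matrix.of fun j i =>
    ⟨U j i, A.alg_subset_quasi c (hU.isIntertwiner.apply_mem ho' hτ hc1 hc2 j i)⟩
  have hV : toOp V = U := rfl
  have hVV : Vᴴ * V = ρ.bim 1 := by
    apply toOp_injective
    rw [toOp_mul, toOp_conjTranspose, hV]
    exact hU.star_mul_self
  have hτ' : (ρ.bim.conj V hVV).toMorphism = τ := by
    ext1 X
    change toOp (V * ρ.bim X * Vᴴ) = τ X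
    rw [toOp_mul, toOp_mul, toOp_conjTranspose, hV]
    have h1 := hU.isIntertwiner.intertwine X
    change U * toOp (ρ.bim X) = τ X * U at h1
    rw [h1, Matrix.mul_assoc, hU.mul_star_self, ← map_mul, mul_one]
  have hone : (ρ.bim.conj V hVV) 1 = V * Vᴴ := by
    apply toOp_injective
    rw [toOp_mul, toOp_conjTranspose, hV, hU.mul_star_self, ← hτ']
    rfl
  refine ⟨m, ⟨ρ.bim.conj V hVV, ⟨o, hτ' ▸ hτ⟩, ?_⟩, V, ?_, ⟨⟨?_, hVV⟩, hone.symm⟩⟩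
  · rw [hτ']
    intro a
    obtain ⟨k, τ', W, hτ'', hW⟩ := ρ.transportable a
    have w1 := hW.isIntertwiner
    have u1 := hU.isIntertwiner
    have hρU : ρ.bim.toMorphism 1 * Uᴴ = Uᴴ := by
      have := congrArg Matrix.conjTranspose u1.mul_one
      rwa [Matrix.conjTranspose_mul, ← Matrix.star_eq_conjTranspose (ρ.bim.toMorphism 1),
        ← map_star, star_one] at this
    have hUτ : Uᴴ * τ 1 = Uᴴ := by
      have := congrArg Matrix.conjTranspose u1.one_mul
      rwa [Matrix.conjTranspose_mul, ← Matrix.star_eq_conjTranspose (τ 1),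
        ← map_star, star_one] at this
    refine ⟨k, τ', W * Uᴴ, hτ'', ⟨⟨?_, ?_, fun X => ?_⟩, ?_, ?_⟩⟩
    · rw [Matrix.mul_assoc, hUτ]
    · rw [← Matrix.mul_assoc, w1.one_mul]
    · have hs := congrArg Matrix.conjTranspose (u1.intertwine (star X))
      rw [Matrix.conjTranspose_mul, Matrix.conjTranspose_mul, map_star, map_star,
        Matrix.star_eq_conjTranspose, Matrix.star_eq_conjTranspose,
        Matrix.conjTranspose_conjTranspose, Matrix.conjTranspose_conjTranspose] at hs
      rw [Matrix.mul_assoc, ← hs, ← Matrix.mul_assoc, w1.intertwine, Matrix.mul_assoc]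
    · rw [Matrix.conjTranspose_mul, Matrix.conjTranspose_conjTranspose, Matrix.mul_assoc,
        ← Matrix.mul_assoc Wᴴ, hW.star_mul_self, hρU, hU.mul_star_self]
    · rw [Matrix.conjTranspose_mul, Matrix.conjTranspose_conjTranspose, Matrix.mul_assoc,
        ← Matrix.mul_assoc Uᴴ, hU.star_mul_self, ← Matrix.mul_assoc, w1.mul_one,
        hW.mul_star_self]
  · change (ρ.bim.conj V hVV).toMorphism.LocalizedIn o
    rw [hτ']; exact hτ
  · refine ⟨?_, ?_, fun X => ?_⟩
    · exact toOp_injective ((toOp_mul _ _).trans hU.isIntertwiner.mul_one)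
    · apply toOp_injective
      change toOp (ρ.bim.conj V hVV 1 * V) = toOp V
      rw [toOp_mul, hone, toOp_mul, toOp_conjTranspose, hV, hU.mul_star_self]
      exact hU.isIntertwiner.one_mul
    · change V * ρ.bim X = V * ρ.bim X * Vᴴ * V
      rw [Matrix.mul_assoc _ Vᴴ V, hVV, Matrix.mul_assoc, ← map_mul, mul_one]

/-! ### Equivalence, irreducibility, direct sums, conjugates -/

/-- Unitary equivalence of objects. -/
def Obj.Equivalent {n m : ℕ} (ρ : Obj A n) (σ : Obj A m) : Prop :=
  ∃ U : Matrix (Fin m) (Fin n) A.quasi, ρ.bim.IsUnitaryArrow σ.bim U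

/-- The object is nonzero, that is, its identity arrow is nonzero. -/
def Obj.Nonzero {n : ℕ} (ρ : Obj A n) : Prop := ρ.bim 1 ≠ 0

/-- `ρ` is a (nonzero) object with `(ρ, ρ) = ℂ 1_ρ`. -/
def Obj.Irreducible {n : ℕ} (ρ : Obj A n) : Prop :=
  ρ.Nonzero ∧ ∀ T : Matrix (Fin n) (Fin n) A.quasi, ρ.bim.IsArrow ρ.bim T →
    ∃ c : ℂ, T = c • ρ.bim 1

/-- `ρ` is a finite direct sum of objects with the property `P`
(the empty direct sum is the zero object). -/
def Obj.IsDirectSumOf {n : ℕ} (P : ∀ m : ℕ, Obj A m → Prop) (ρ : Obj A n) : Prop :=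
  ∃ (k : ℕ) (m : Fin k → ℕ) (σ : ∀ i, Obj A (m i))
    (W : ∀ i, Matrix (Fin n) (Fin (m i)) A.quasi),
    (∀ i, P (m i) (σ i)) ∧ (∀ i, (σ i).bim.IsIsometry ρ.bim (W i)) ∧
      ∑ i, W i * (W i)ᴴ = ρ.bim 1

/-- The expression `(T × 1_σ) · (1_σ × S)` for `T ∈ (στ, ι)` and `S ∈ (ι, τσ)`, where the
multi-indices of `(στ)σ` and `σ(τσ)`, of `σι` and `σ`, and of `ισ` and `σ` are identified. -/
noncomputable def zigzag {I J : Type} [Fintype I] [Fintype J]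
    (σ : Bimodule A I) (τ : Bimodule A J) (T : Matrix Unit (I × J) A.quasi)
    (S : Matrix (J × I) Unit A.quasi) : Matrix I I A.quasi :=
  Matrix.reindex (Equiv.punitProd I) (Equiv.prodAssoc I J I)
      (tensorArrow (σ.tensor τ) T (σ 1)) *
    Matrix.reindex (Equiv.refl (I × (J × I))) (Equiv.prodPUnit I) (tensorArrow σ (σ 1) S)

/-- `R ∈ (ι, ρ̄ρ)` and `R' ∈ (ι, ρρ̄)` solve the conjugate equations
`(R'* × 1_ρ)(1_ρ × R) = 1_ρ` and `(R* × 1_ρ̄)(1_ρ̄ × R') = 1_ρ̄`. -/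
structure SolvesConjugateEquations {n m : ℕ} (ρ : Obj A n) (ρbar : Obj A m)
    (R : Matrix (Fin m × Fin n) Unit A.quasi) (R' : Matrix (Fin n × Fin m) Unit A.quasi) :
    Prop where
  isArrow_left : (Bimodule.unit A).IsArrow (ρbar.bim.tensor ρ.bim) R
  isArrow_right : (Bimodule.unit A).IsArrow (ρ.bim.tensor ρbar.bim) R'
  zigzag_left : zigzag ρ.bim ρbar.bim R'ᴴ R = ρ.bim 1
  zigzag_right : zigzag ρbar.bim ρ.bim Rᴴ R' = ρbar.bim 1

/-- The object has conjugates. -/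
def Obj.HasConjugate {n : ℕ} (ρ : Obj A n) : Prop :=
  ∃ (m : ℕ) (ρbar : Obj A m) (R : Matrix (Fin m × Fin n) Unit A.quasi)
    (R' : Matrix (Fin n × Fin m) Unit A.quasi), SolvesConjugateEquations ρ ρbar R R'

/-! ### The symmetry and the statistics -/

/-- `E = (V* × U*) θ (U × V)` for some unitaries `U ∈ (ρ, ρ₁)` and `V ∈ (σ, σ₁)` onto objects
localized in spacelike separated double cones. -/
def IsExchange {n m : ℕ} (ρ : Obj A n) (σ : Obj A m)
    (E : Matrix (Fin m × Fin n) (Fin n × Fin m) A.quasi) : Prop :=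
  ∃ (o a : DoubleCone) (n₁ m₁ : ℕ) (ρ₁ : Obj A n₁) (σ₁ : Obj A m₁)
    (U : Matrix (Fin n₁) (Fin n) A.quasi) (V : Matrix (Fin m₁) (Fin m) A.quasi),
    o.Perp a ∧ ρ₁.LocalizedIn o ∧ σ₁.LocalizedIn a ∧
      ρ.bim.IsUnitaryArrow ρ₁.bim U ∧ σ.bim.IsUnitaryArrow σ₁.bim V ∧
      E = tensorArrow σ₁.bim Vᴴ Uᴴ * flip A (Fin n₁) (Fin m₁) * tensorArrow ρ.bim U V

lemma exists_isExchange {n m : ℕ} (ρ : Obj A n) (σ : Obj A m) : ∃ E, IsExchange ρ σ E := by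
  obtain ⟨o, a, hoa⟩ := DoubleCone.exists_perp
  obtain ⟨n₁, ρ₁, U, hρ₁, hU⟩ := ρ.exists_transport o
  obtain ⟨m₁, σ₁, V, hσ₁, hV⟩ := σ.exists_transport a
  exact ⟨_, o, a, n₁, m₁, ρ₁, σ₁, U, V, hoa, hρ₁, hσ₁, hU, hV, rfl⟩

/-- The symmetry `ε(ρ, σ) ∈ (ρσ, σρ)`; its value does not depend on the choices of the spacelike
separated double cones, the transported objects and the unitaries. -/
noncomputable def symmetry {n m : ℕ} (ρ : Obj A n) (σ : Obj A m) :
    Matrix (Fin m × Fin n) (Fin n × Fin m) A.quasi :=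
  (exists_isExchange ρ σ).choose

/-- `γ` is simple: `ε(γ, γ) = χ 1_{γ²}` with `χ ∈ {1, -1}`. -/
def Obj.Simple {n : ℕ} (γ : Obj A n) : Prop :=
  symmetry γ γ = (γ.bim.tensor γ.bim) 1 ∨ symmetry γ γ = -(γ.bim.tensor γ.bim) 1

/-- `ρ` is a faithful morphism of the quasilocal algebra. -/
def Obj.Faithful {n : ℕ} (ρ : Obj A n) : Prop := ∀ X : A.quasi, ρ.bim X = 0 → X = 0

/-- `1_{ρ^k} × ε(ρ, ρ) × 1_{ρ^(d-k-2)}`, the operator on `ρ^d` exchanging the factors number `k`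
and `k + 1` (counted from `0`); it is only used for `k + 1 < d` and set to zero otherwise. -/
noncomputable def adjacentExchange {n : ℕ} (ρ : Obj A n) :
    (d k : ℕ) → Matrix (Fin d → Fin n) (Fin d → Fin n) A.quasi
  | d + 2, 0 =>
    let e : (Fin n × Fin n) × (Fin d → Fin n) ≃ (Fin (d + 2) → Fin n) :=
      (Equiv.prodAssoc _ _ _).trans
        ((Equiv.prodCongr (Equiv.refl _) (Fin.consEquiv fun _ => Fin n)).trans
          (Fin.consEquiv fun _ => Fin n))
    Matrix.reindex e e
      (tensorArrow (ρ.bim.tensor ρ.bim) (symmetry ρ ρ) ((ρ.bim.pow d) 1))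
  | d + 1, k + 1 =>
    Matrix.reindex (Fin.consEquiv fun _ => Fin n) (Fin.consEquiv fun _ => Fin n)
      (tensorArrow ρ.bim (ρ.bim 1) (adjacentExchange ρ d k))
  | _, _ => 0

/-- `u` is the representation `ε_ρ^d` of the permutation group on `ρ^d`, determined by its values
on the adjacent transpositions. -/
structure IsPermutationRep {n : ℕ} (ρ : Obj A n) (d : ℕ)
    (u : Equiv.Perm (Fin d) → Matrix (Fin d → Fin n) (Fin d → Fin n) A.quasi) : Prop where
  map_one : u 1 = (ρ.bim.pow d) 1
  map_mul : ∀ p q, u (p * q) = u p * u q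
  map_swap : ∀ (k : ℕ) (hk : k + 1 < d),
    u (Equiv.swap ⟨k, Nat.lt_of_succ_lt hk⟩ ⟨k + 1, hk⟩) = adjacentExchange ρ d k

/-- `(d, γ, V)` is a triple for `ρ`: `d ≥ 1`, the object `γ` is faithful and simple, and
`V ∈ (γ, ρ^d)` is an isometry such that `V V*` is the antisymmetrizer or the symmetrizer
of `ε_ρ^d`. -/
structure IsStatisticsTriple {n m : ℕ} (ρ : Obj A n) (d : ℕ) (γ : Obj A m)
    (V : Matrix (Fin d → Fin n) (Fin m) A.quasi) : Prop where
  one_le : 1 ≤ d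
  simple : γ.Simple
  faithful : γ.Faithful
  isIsometry : γ.bim.IsIsometry (ρ.bim.pow d) V
  range_eq : ∃ u, IsPermutationRep ρ d u ∧
    (V * Vᴴ = (d.factorial : ℂ)⁻¹ • ∑ p, ((Equiv.Perm.sign p : ℤ) : ℂ) • u p ∨
      V * Vᴴ = (d.factorial : ℂ)⁻¹ • ∑ p, u p)

/-- Irreducible objects with finite statistics. -/
def Obj.IrreducibleFinite {n : ℕ} (ρ : Obj A n) : Prop :=
  ρ.Irreducible ∧ ∃ (d m : ℕ) (γ : Obj A m) (V : Matrix (Fin d → Fin n) (Fin m) A.quasi),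
    IsStatisticsTriple ρ d γ V

/-- Objects with finite statistics. -/
def Obj.FiniteStatistics {n : ℕ} (ρ : Obj A n) : Prop :=
  ρ.IsDirectSumOf fun _ σ => σ.IrreducibleFinite

/-! ### The extension to the presheaf of commutants, homogeneity -/

/-- A chosen unitary intertwiner from `ρ` to a morphism localized in `a`. -/
noncomputable def Obj.transporter {n : ℕ} (ρ : Obj A n) (a : DoubleCone) :
    Matrix (Fin (ρ.transportable a).choose) (Fin n) (H →L[ℂ] H) :=
  (ρ.transportable a).choose_spec.choose_spec.choose

/-- The component on `𝔄(a)'` of the canonical extension of `ρ` to the presheaf `a ↦ 𝔄(a)'`: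
`X ↦ U* (X ⊗ 1) U` for any unitary intertwiner `U` from `ρ` to a morphism localized in `a`.
On `𝔄(a)'` it does not depend on the choice of `U`. -/
noncomputable def Obj.ext {n : ℕ} (ρ : Obj A n) (a : DoubleCone) (X : H →L[ℂ] H) :
    Matrix (Fin n) (Fin n) (H →L[ℂ] H) :=
  (ρ.transporter a)ᴴ * ampl (Fin (ρ.transportable a).choose) X * ρ.transporter a

/-- `ρ` is doubly faithful: its extension is faithful on every `𝔄(a)'`. -/
def Obj.DoublyFaithful {n : ℕ} (ρ : Obj A n) : Prop :=
  ∀ a : DoubleCone, ∀ X ∈ (A.alg a).commutant, ρ.ext a X = 0 → X = 0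

/-- The reduced algebra `(𝔄(a)' ⊗ M_n)_{ρ(1)} = ρ(1) (𝔄(a)' ⊗ M_n) ρ(1)`; it is used for `a`
spacelike to the localization of `ρ`, and `ρ(1)` then belongs to `𝔄(a)' ⊗ M_n`. -/
def Obj.reduced {n : ℕ} (ρ : Obj A n) (a : DoubleCone) :
    Submodule ℂ (Matrix (Fin n) (Fin n) (H →L[ℂ] H)) where
  carrier := {B | (∀ i j, B i j ∈ (A.alg a).commutant) ∧
    toOp (ρ.bim 1) * B = B ∧ B * toOp (ρ.bim 1) = B}
  zero_mem' := ⟨fun _ _ => zero_mem _, Matrix.mul_zero _, Matrix.zero_mul _⟩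
  add_mem' := by
    rintro B C ⟨h1, h2, h3⟩ ⟨k1, k2, k3⟩
    exact ⟨fun i j => add_mem (h1 i j) (k1 i j), by rw [Matrix.mul_add, h2, k2],
      by rw [Matrix.add_mul, h3, k3]⟩
  smul_mem' := by
    rintro c B ⟨h1, h2, h3⟩
    exact ⟨fun i j => (A.alg a).commutant.toStarSubalgebra.smul_mem (h1 i j) c,
      by rw [Matrix.mul_smul, h2], by rw [Matrix.smul_mul, h3]⟩

/-- A presheaf-left inverse of `ρ` as an object localized in `o`: normalized completely positive
maps `φ a` from `(𝔄(a)' ⊗ M_n)_{ρ(1)}` to `𝔄(a)'` for all `a ⊥ o`, compatible with restriction,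
with `φ a (B ρ_a(X)) = φ a (B) X`. The components with `a` not spacelike to `o` are irrelevant. -/
structure IsPresheafLeftInverse {n : ℕ} (ρ : Obj A n) (o : DoubleCone)
    (φ : ∀ a : DoubleCone, ρ.reduced a →ₗ[ℂ] (H →L[ℂ] H)) : Prop where
  localizedIn : ρ.LocalizedIn o
  mem : ∀ a : DoubleCone, a.Perp o → ∀ B, φ a B ∈ (A.alg a).commutant
  normalized : ∀ a : DoubleCone, a.Perp o →
    ∃ h : toOp (ρ.bim 1) ∈ ρ.reduced a, φ a ⟨_, h⟩ = 1
  completelyPositive : ∀ a : DoubleCone, a.Perp o →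
    ∀ (k : ℕ) (B : Fin k → ρ.reduced a) (ξ : Fin k → H),
      ∃ h : ∀ i j, (B i).1ᴴ * (B j).1 ∈ ρ.reduced a,
        0 ≤ ∑ i, ∑ j, ⟪ξ i, φ a ⟨_, h i j⟩ (ξ j)⟫_ℂ
  restrict : ∀ a b : DoubleCone, a.Perp o → b.Perp o → a.Sub b → ∀ B : ρ.reduced b,
    ∃ h : B.1 ∈ ρ.reduced a, φ a ⟨_, h⟩ = φ b B
  apply_mul : ∀ a : DoubleCone, a.Perp o → ∀ B : ρ.reduced a, ∀ X ∈ (A.alg a).commutant,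
    ∃ h : B.1 * ρ.ext a X ∈ ρ.reduced a, φ a ⟨_, h⟩ = φ a B * X

/-- `ρ` is homogeneous: every object equivalent to `ρ` has a presheaf-left inverse with respect
to every double cone in which it is localized. -/
def Obj.Homogeneous {n : ℕ} (ρ : Obj A n) : Prop :=
  ∀ (m : ℕ) (σ : Obj A m), ρ.Equivalent σ → ∀ a : DoubleCone, σ.LocalizedIn a →
    ∃ φ, IsPresheafLeftInverse σ a φ

/-- The class `Δ_fh`: finite direct sums of irreducible objects with finite statistics, such that
the simple object of the associated triple is doubly faithful. -/
def Obj.InFh {n : ℕ} (ρ : Obj A n) : Prop :=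
  ρ.IsDirectSumOf fun k σ => σ.IrreducibleFinite ∧
    ∀ (d m : ℕ) (γ : Obj A m) (V : Matrix (Fin d → Fin k) (Fin m) A.quasi),
      IsStatisticsTriple σ d γ V → γ.DoublyFaithful

/-- The operator `R* ρ̄_a(B) R` on `H`, for a matrix `B` over `𝔄(a)'`, with `ρ̄_a` applied to the
entries of `B`. -/
noncomputable def sandwich {n m : ℕ} (ρbar : Obj A m) (R : Matrix (Fin m × Fin n) Unit A.quasi)
    (a : DoubleCone) (B : Matrix (Fin n) (Fin n) (H →L[ℂ] H)) : H →L[ℂ] H :=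
  ((toOp R)ᴴ * (Matrix.of fun p q : Fin m × Fin n => ρbar.ext a (B p.2 q.2) p.1 q.1) *
    toOp R) () ()

end Obj

end Sectors

namespace Sectors

/-! ### Geometry of double cones -/

/-! A solution R of the conjugate equations turns ρ̄ into a left inverse Φ(T) = R* ρ̄(T) R. Because
R intertwines ι and ρ̄ρ, Φ is positive, satisfies Φ(T ρ(X)) = Φ(T) X, sends arrows between ρκ and
ρκ' to arrows between κ and κ', and takes scalar values on (ρ, ρ), since the centre of 𝔄 is trivial.
The partner R̄ makes Φ quantitatively faithful: completing a square with one conjugate equation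
gives the Pimsner–Popa inequality T*T ≤ (R̄*R̄) (1_ρ × Φ(T*T)) (`IsConjugatePair.pimsner_popa`).
Throughout, an operator in (ι, τσ) is handled through its entries S (`IsPair`). `IsConjugatePair`
retains one of the two equations; in this asymmetric form the notion passes to subobjects of σ
without cutting down τ.

Decomposition: the inequality bounds the number of endomorphisms that are orthonormal for Φ(T*T'),
so (ρ, ρ) is finite-dimensional and 1_ρ is a finite sum of minimal projections
(`isDirectSumOf_irreducible`).

Statistics of an irreducible summand: put Φ(1) = r and Φ(ε(ρ, ρ)) = l. For the symmetrizers (c = 1)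
or antisymmetrizers (c = -1) E_n on ρ^n, coset decomposition gives Φ(E_{n+1}) = (r + c n l)/(n+1)
E_n. The Pimsner–Popa inequality excludes l = 0. With c opposite in sign to l the factors decrease
to -∞; positivity then forces one of them to vanish, so r = d|l| with an integer d
(`PermTower.LeftInv.exists_dimension`). After rescaling to r = d, l = -c, the iterated left inverse
has the value 1 on E_d. The subobject γ of ρ^d carved out by E_d therefore has a normalized faithful
left inverse whose value on ε(γ, γ) is χ = (-c)^d, with χ² = 1; the left inverse of (ε - χ)*(ε - χ)
vanishes, so ε(γ, γ) = χ.

The symmetry: what is used about ε comes from the connectedness of the spacelike complement of a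
double cone (`DoubleCone.conn_of_perp`). It makes an object act trivially on arrows between objects
localized spacelike to it (`Bimodule.IsObj.fixes_arrow`). From this follow the commutation of
spacelike objects, ε(ρ, σ)* = ε(σ, ρ), the tensor formula and the Yang–Baxter equation.

Commutants: transported to a, the operator S gets its entries into 𝔄(a) by Haag duality. Hence
τ_a(σ_a(X)) S = S X holds for all X in 𝔄(a)' (`Bimodule.IsPair.sum_extBy`), and Φ extends to a
presheaf-left inverse, which is homogeneity. The same identity shows that σ_a(X) = 0 implies S*S X =
0. Applied to the faithful left inverse that γ inherits from ρ^d, it gives double faithfulness for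
every triple. -/

lemma forwardCone_smul {x : Minkowski} (hx : x ∈ forwardCone) {t : ℝ} (ht : 0 < t) :
    t • x ∈ forwardCone := by
  simp only [forwardCone, Set.mem_ofPred_eq, Prod.smul_fst, Prod.smul_snd, norm_smul,
    Real.norm_eq_abs, abs_of_pos ht, smul_eq_mul] at *
  exact mul_lt_mul_of_pos_left hx ht

lemma isOpen_forwardCone : IsOpen forwardCone :=
  isOpen_lt (by fun_prop) (by fun_prop)

/-- The sum of a vector of the closed forward cone and one of the open forward cone. -/
lemma forwardCone_add_closed {x y : Minkowski} (hx : ‖x.2‖ ≤ x.1) (hy : y ∈ forwardCone) :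
    x + y ∈ forwardCone := by
  simp only [forwardCone, Set.mem_ofPred_eq] at *
  calc ‖(x + y).2‖ ≤ ‖x.2‖ + ‖y.2‖ := norm_add_le _ _
    _ < x.1 + y.1 := add_lt_add_of_le_of_lt hx hy

namespace DoubleCone

lemma isOpen_region (o : DoubleCone) : IsOpen o.region :=
  IsOpen.inter
    (isOpen_forwardCone.preimage (f := fun x => x - o.past) (by fun_prop))
    (isOpen_forwardCone.preimage (f := fun x => o.future - x) (by fun_prop))

/-- Points on the axis of a double cone. -/
lemma axis_mem (o : DoubleCone) {t : ℝ} (h0 : 0 < t) (h1 : t < 1) :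
    o.past + t • (o.future - o.past) ∈ o.region := by
  constructor
  · rw [add_sub_cancel_left]; exact forwardCone_smul o.past_lt_future h0
  · have : o.future - (o.past + t • (o.future - o.past)) = (1 - t) • (o.future - o.past) := by
      module
    rw [this]; exact forwardCone_smul o.past_lt_future (by linarith)

lemma region_nonempty (o : DoubleCone) : o.region.Nonempty :=
  ⟨_, o.axis_mem (t := 1 / 2) (by norm_num) (by norm_num)⟩

/-- The double cone over a ball at constant time. -/
def overBall (x : Minkowski) (r : ℝ) (hr : 0 < r) : DoubleCone where
  past := x - (r, 0)
  future := x + (r, 0)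
  past_lt_future := by
    have : x + ((r, 0) : Minkowski) - (x - (r, 0)) = (r + r, 0) := by ext <;> simp
    rw [this]; simp [forwardCone, hr]

lemma mem_overBall {x y : Minkowski} {r : ℝ} {hr : 0 < r} :
    y ∈ (overBall x r hr).region ↔ ‖y.2 - x.2‖ + |y.1 - x.1| < r := by
  simp only [overBall, region, forwardCone, Set.mem_ofPred_eq, Prod.fst_sub, Prod.snd_sub,
    Prod.fst_add, Prod.snd_add, sub_zero, add_zero, norm_sub_rev x.2 y.2]
  constructor
  · rintro ⟨h1, h2⟩
    rcases abs_cases (y.1 - x.1) with h | h <;> linarith [h.1]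
  · intro h
    constructor <;> linarith [le_abs_self (y.1 - x.1), neg_abs_le (y.1 - x.1)]

lemma overBall_subset_of_dist {x y : Minkowski} {r s : ℝ} {hr : 0 < r} {hs : 0 < s}
    (h : ‖x.2 - y.2‖ + |x.1 - y.1| + r ≤ s) : (overBall x r hr).Sub (overBall y s hs) := by
  intro z hz
  rw [mem_overBall] at *
  have h1 : ‖z.2 - y.2‖ ≤ ‖z.2 - x.2‖ + ‖x.2 - y.2‖ := norm_sub_le_norm_sub_add_norm_sub ..
  have h2 : |z.1 - y.1| ≤ |z.1 - x.1| + |x.1 - y.1| := abs_sub_le ..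
  linarith

/-- Every neighbourhood of a point contains a double cone over a ball around it. -/
lemma exists_overBall_subset {S : Set Minkowski} (hS : IsOpen S) {x : Minkowski} (hx : x ∈ S) :
    ∃ (r : ℝ) (hr : 0 < r), (overBall x r hr).region ⊆ S := by
  obtain ⟨r, hr, h⟩ := Metric.isOpen_iff.1 hS x hx
  refine ⟨r, hr, fun y hy => h ?_⟩
  rw [mem_overBall] at hy
  rw [Metric.mem_ball, dist_eq_norm, Prod.norm_def, max_lt_iff]
  constructor
  · rw [Prod.fst_sub, Real.norm_eq_abs]; linarith [norm_nonneg (y.2 - x.2)]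
  · rw [Prod.snd_sub]; linarith [abs_nonneg (y.1 - x.1)]

/-- Two double cones with a common point contain a common double cone. -/
lemma exists_sub_inter {a b : DoubleCone} {x : Minkowski} (ha : x ∈ a.region) (hb : x ∈ b.region) :
    ∃ c : DoubleCone, c.Sub a ∧ c.Sub b := by
  obtain ⟨r, hr, h⟩ := exists_overBall_subset (a.isOpen_region.inter b.isOpen_region) ⟨ha, hb⟩
  exact ⟨_, fun y hy => (h hy).1, fun y hy => (h hy).2⟩

lemma overBall_perp {x y : Minkowski} {r s : ℝ} {hr : 0 < r} {hs : 0 < s}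
    (h : r + s + |x.1 - y.1| ≤ ‖x.2 - y.2‖) : (overBall x r hr).Perp (overBall y s hs) := by
  intro z hz w hw
  rw [mem_overBall] at *
  unfold Spacelike
  have h1 : ‖x.2 - y.2‖ ≤ ‖z.2 - x.2‖ + ‖z.2 - w.2‖ + ‖w.2 - y.2‖ := by
    calc ‖x.2 - y.2‖ = ‖-(z.2 - x.2) + (z.2 - w.2) + (w.2 - y.2)‖ := by congr 1; abel
      _ ≤ ‖-(z.2 - x.2)‖ + ‖z.2 - w.2‖ + ‖w.2 - y.2‖ := norm_add₃_le
      _ = _ := by rw [norm_neg]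
  have h2 : |z.1 - w.1| ≤ |z.1 - x.1| + |x.1 - y.1| + |w.1 - y.1| := by
    calc |z.1 - w.1| = |(z.1 - x.1) + (x.1 - y.1) + -(w.1 - y.1)| := by congr 1; ring
      _ ≤ |z.1 - x.1| + |x.1 - y.1| + |-(w.1 - y.1)| := abs_add_three _ _ _
      _ = _ := by rw [abs_neg]
  linarith

lemma Sub.refl (a : DoubleCone) : a.Sub a := subset_rfl

lemma Sub.trans {a b c : DoubleCone} (h : a.Sub b) (h' : b.Sub c) : a.Sub c :=
  Set.Subset.trans h h'

/-- Every double cone contains two spacelike separated ones. -/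
lemma exists_perp_sub (c : DoubleCone) : ∃ a b : DoubleCone, a.Sub c ∧ b.Sub c ∧ a.Perp b := by
  obtain ⟨x, hx⟩ := c.region_nonempty
  obtain ⟨r, hr, h⟩ := exists_overBall_subset c.isOpen_region hx
  set e : EuclideanSpace ℝ (Fin 3) := EuclideanSpace.single 0 (r / 2)
  have he : ‖e‖ = r / 2 := by simp [e, abs_of_pos hr]
  refine ⟨overBall x (r / 4) (by linarith), overBall (x + (0, e)) (r / 4) (by linarith),
    Sub.trans (overBall_subset_of_dist (hs := hr) ?_) h,
    Sub.trans (overBall_subset_of_dist (hs := hr) ?_) h, overBall_perp ?_⟩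
  · simp; linarith
  · simp [he]; linarith
  · simp [he]; linarith

/-- A criterion for spacelike separation in terms of the tips. -/
lemma perp_of_tips {o a : DoubleCone} (h1 : o.future - a.past ∉ forwardCone)
    (h2 : a.future - o.past ∉ forwardCone) : o.Perp a := by
  intro x hx y hy
  unfold Spacelike
  by_contra! h
  -- A causal vector joining x and y, added to the timelike vectors from these points to the
  -- opposite tips of their cones, would put a difference of tips into the forward cone.
  rcases le_total 0 (x.1 - y.1) with h0 | h0
  · rw [abs_of_nonneg h0] at h
    apply h1
    have := forwardCone_add_closed (x := x - y) h (forwardCone_add hx.2 hy.1)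
    convert this using 1; abel
  · rw [abs_of_nonpos h0] at h
    apply h2
    have := forwardCone_add_closed (x := y - x)
      (by rw [Prod.snd_sub, Prod.fst_sub, norm_sub_rev]; linarith) (forwardCone_add hy.2 hx.1)
    convert this using 1; abel

/-- The forward cone is open: a point strictly later than the past tip of a is also later than
points of a close to that tip. -/
lemma Perp.not_mem_past {o a : DoubleCone} (h : o.Perp a) {x : Minkowski} (hx : x ∈ o.region) :
    x - a.past ∉ forwardCone := by
  intro hx'
  have hc : Continuous fun t : ℝ => x - (a.past + t • (a.future - a.past)) := by fun_prop
  have hU := (isOpen_forwardCone.preimage hc).mem_nhds (x := 0) (by simpa using hx')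
  obtain ⟨ε, hε, hb⟩ := Metric.mem_nhds_iff.1 hU
  set t := min (ε / 2) (1 / 2)
  have ht : 0 < t := by positivity
  have h1 := a.axis_mem ht ((min_le_right _ _).trans_lt (by norm_num))
  have h2 := hb (a := t) (by
    rw [Metric.mem_ball, dist_zero_right, Real.norm_eq_abs, abs_of_pos ht]
    exact (min_le_left _ _).trans_lt (by linarith))
  have h3 := h x hx _ h1
  simp only [Set.mem_preimage, forwardCone, Set.mem_ofPred_eq] at h2
  unfold Spacelike at h3
  exact absurd (h3.trans h2) (not_lt.2 (le_abs_self _))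

lemma Perp.not_mem_future {o a : DoubleCone} (h : o.Perp a) {x : Minkowski} (hx : x ∈ o.region) :
    a.future - x ∉ forwardCone := by
  intro hx'
  have hc : Continuous fun t : ℝ => (a.past + (1 - t) • (a.future - a.past)) - x := by fun_prop
  have hU := (isOpen_forwardCone.preimage hc).mem_nhds (x := 0) (by simpa using hx')
  obtain ⟨ε, hε, hb⟩ := Metric.mem_nhds_iff.1 hU
  set t := min (ε / 2) (1 / 2)
  have ht : 0 < t := by positivity
  have h1 := a.axis_mem (t := 1 - t)
    (by linarith [min_le_right (ε / 2) (1 / 2 : ℝ)]) (by linarith)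
  have h2 := hb (a := t) (by
    rw [Metric.mem_ball, dist_zero_right, Real.norm_eq_abs, abs_of_pos ht]
    exact (min_le_left _ _).trans_lt (by linarith))
  have h3 := h.symm _ h1 x hx
  simp only [Set.mem_preimage, forwardCone, Set.mem_ofPred_eq] at h2
  unfold Spacelike at h3
  exact absurd (h3.trans h2) (not_lt.2 (le_abs_self _))

/-! ### The spacelike complement of a double cone is connected -/

/-- Two double cones in the spacelike complement of `a` that are contained in a third one. -/
def Step (a o o' : DoubleCone) : Prop := ∃ c : DoubleCone, c.Perp a ∧ o.Sub c ∧ o'.Sub c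

/-- Connectedness in the spacelike complement of `a`. -/
abbrev Conn (a : DoubleCone) : DoubleCone → DoubleCone → Prop := Relation.ReflTransGen (Step a)

lemma Conn.symm {a o o' : DoubleCone} (h : Conn a o o') : Conn a o' o := by
  have : Std.Symm (Step a) := ⟨fun _ _ ⟨c, hc, h1, h2⟩ => ⟨c, hc, h2, h1⟩⟩
  exact Std.Symm.symm _ _ h

lemma Conn.of_inter {a o o' : DoubleCone} (ho : o.Perp a) (ho' : o'.Perp a) {x : Minkowski}
    (hx : x ∈ o.region) (hx' : x ∈ o'.region) : Conn a o o' := by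
  obtain ⟨c, h1, h2⟩ := exists_sub_inter hx hx'
  exact (Relation.ReflTransGen.single ⟨o, ho, Sub.refl _, h1⟩).tail ⟨o', ho', h2, Sub.refl _⟩

/-- A bound for the position of a double cone. -/
noncomputable def size (a : DoubleCone) : ℝ :=
  1 + ‖a.past.2‖ + |a.past.1| + ‖a.future.2‖ + |a.future.1|

lemma size_pos (a : DoubleCone) : 0 < a.size := by unfold size; positivity

/-- The double cone over a large ball in the direction `n`, spacelike to `a`. -/
noncomputable def far (a : DoubleCone) (n : EuclideanSpace ℝ (Fin 3)) (s : ℝ)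
    (hs : a.size < s) : DoubleCone := overBall (0, s • n) (s - a.size) (by linarith)

/-- The radius falls short of the distance s of the centre from the origin by `size`, which exceeds
the sum of the spatial norm and the absolute time of either tip of a. -/
lemma far_perp (a : DoubleCone) {n : EuclideanSpace ℝ (Fin 3)} (hn : ‖n‖ = 1) {s : ℝ}
    (hs : a.size < s) : (a.far n s hs).Perp a := by
  have hs0 : 0 < s := a.size_pos.trans hs
  have key : ∀ y : EuclideanSpace ℝ (Fin 3), s - ‖y‖ ≤ ‖s • n - y‖ := by
    intro y
    have := norm_sub_norm_le (s • n) y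
    rwa [norm_smul, hn, Real.norm_eq_abs, abs_of_pos hs0, mul_one] at this
  have h1 := le_abs_self a.past.1
  have h2 := neg_abs_le a.past.1
  have h3 := le_abs_self a.future.1
  have h4 := neg_abs_le a.future.1
  apply perp_of_tips
  · simp only [far, overBall, forwardCone, Set.mem_ofPred_eq, Prod.fst_sub, Prod.snd_sub,
      Prod.fst_add, Prod.snd_add, add_zero, zero_add, not_lt]
    refine le_trans ?_ (key _)
    unfold size
    linarith [norm_nonneg a.future.2]
  · simp only [far, overBall, forwardCone, Set.mem_ofPred_eq, Prod.fst_sub, Prod.snd_sub,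
      sub_zero, zero_sub, not_lt]
    rw [norm_sub_rev]
    refine le_trans ?_ (key _)
    unfold size
    linarith [norm_nonneg a.past.2]

lemma exists_perp_to (a : DoubleCone) : ∃ o : DoubleCone, o.Perp a :=
  ⟨_, a.far_perp (n := EuclideanSpace.single 0 1) (by simp) (lt_add_one _)⟩

lemma far_conn_same (a : DoubleCone) {n : EuclideanSpace ℝ (Fin 3)} (hn : ‖n‖ = 1) {s s' : ℝ}
    (hs : a.size < s) (hs' : a.size < s') (h : s ≤ s') :
    Conn a (a.far n s hs) (a.far n s' hs') := by
  refine Relation.ReflTransGen.single ⟨a.far n s' hs', a.far_perp hn hs', ?_, Sub.refl _⟩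
  apply overBall_subset_of_dist
  simp only [sub_self, abs_zero, ← sub_smul, norm_smul, hn, Real.norm_eq_abs]
  rw [abs_of_nonpos (by linarith)]; linarith

/-- Directions at an angle of at most a right angle: the midpoint of the two centres lies in both
cones, because half the distance of the centres is at most 3s/4 and the radius is larger than that.
-/
lemma far_conn_of_inner_nonneg (a : DoubleCone) {n n' : EuclideanSpace ℝ (Fin 3)} (hn : ‖n‖ = 1)
    (hn' : ‖n'‖ = 1) (h : 0 ≤ ⟪n, n'⟫_ℝ) {s : ℝ} (hs : 4 * a.size < s)
    (hs1 : a.size < s) : Conn a (a.far n s hs1) (a.far n' s hs1) := by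
  have hp := a.size_pos
  have hd : ‖n - n'‖ ≤ 3 / 2 := by
    have := norm_sub_sq_real n n'
    rw [hn, hn'] at this
    nlinarith [norm_nonneg (n - n')]
  have hs0 : 0 < s := by linarith
  refine Conn.of_inter (a.far_perp hn hs1) (a.far_perp hn' hs1)
    (x := (0, (s / 2) • (n + n'))) ?_ ?_ <;> rw [far, mem_overBall]
  · have : (s / 2) • (n + n') - s • n = -((s / 2) • (n - n')) := by module
    simp only [this, sub_self, abs_zero, add_zero, norm_neg, norm_smul, Real.norm_eq_abs,
      abs_of_pos (half_pos hs0)]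
    nlinarith
  · have : (s / 2) • (n + n') - s • n' = (s / 2) • (n - n') := by module
    simp only [this, sub_self, abs_zero, add_zero, norm_smul, Real.norm_eq_abs,
      abs_of_pos (half_pos hs0)]
    nlinarith

lemma exists_unit_orthogonal (n n' : EuclideanSpace ℝ (Fin 3)) :
    ∃ k : EuclideanSpace ℝ (Fin 3), ‖k‖ = 1 ∧ ⟪n, k⟫_ℝ = 0 ∧ ⟪k, n'⟫_ℝ = 0 := by
  set W := Submodule.span ℝ ({n, n'} : Set (EuclideanSpace ℝ (Fin 3)))
  have hW : Module.finrank ℝ W ≤ 2 := by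
    refine (finrank_span_le_card _).trans ?_
    rw [Set.toFinset_insert, Set.toFinset_singleton]
    exact Finset.card_le_two
  have hsum := Submodule.finrank_add_finrank_orthogonal W
  rw [finrank_euclideanSpace_fin] at hsum
  have : 0 < Module.finrank ℝ Wᗮ := by omega
  have := Module.finrank_pos_iff.1 this
  obtain ⟨v, hv⟩ := exists_ne (0 : Wᗮ)
  have hv0 : (v : EuclideanSpace ℝ (Fin 3)) ≠ 0 := fun h => hv (Subtype.ext h)
  have h1 := (Submodule.mem_orthogonal W _).1 v.2 n (Submodule.subset_span (by simp))
  have h2 := (Submodule.mem_orthogonal' W _).1 v.2 n' (Submodule.subset_span (by simp))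
  refine ⟨‖(v : EuclideanSpace ℝ (Fin 3))‖⁻¹ • (v : EuclideanSpace ℝ (Fin 3)),
    norm_smul_inv_norm hv0, ?_, ?_⟩
  · rw [inner_smul_right, h1, mul_zero]
  · rw [inner_smul_left, h2, mul_zero]

/-- Three space dimensions provide a direction k orthogonal to both n and n'. Passing through k
covers antipodal directions as well. -/
lemma far_conn (a : DoubleCone) {n n' : EuclideanSpace ℝ (Fin 3)} (hn : ‖n‖ = 1)
    (hn' : ‖n'‖ = 1) {s s' : ℝ} (hs : a.size < s) (hs' : a.size < s') :
    Conn a (a.far n s hs) (a.far n' s' hs') := by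
  have hp := a.size_pos
  obtain ⟨k, hk, h1, h2⟩ := exists_unit_orthogonal n n'
  set t := max (max s s') (4 * a.size + 1)
  have ht1 : s ≤ t := (le_max_left _ _).trans (le_max_left _ _)
  have ht2 : s' ≤ t := (le_max_right _ _).trans (le_max_left _ _)
  have ht : 4 * a.size < t := lt_of_lt_of_le (by linarith) (le_max_right _ _)
  have hta : a.size < t := by linarith
  exact (((a.far_conn_same hn hs hta ht1).trans
    (a.far_conn_of_inner_nonneg hn hk h1.ge ht hta)).trans
    (a.far_conn_of_inner_nonneg hk hn' h2.ge ht hta)).trans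
    (a.far_conn_same hn' hs' hta ht2).symm

lemma exists_direction (u : EuclideanSpace ℝ (Fin 3)) {k : EuclideanSpace ℝ (Fin 3)}
    (hk : ‖k‖ = 1) : ∃ n, ‖n‖ = 1 ∧ u = ‖u‖ • n ∧ (u = 0 → n = k) := by
  by_cases h : u = 0
  · exact ⟨k, hk, by simp [h], fun _ => rfl⟩
  · refine ⟨‖u‖⁻¹ • u, norm_smul_inv_norm h, ?_, fun h' => absurd h' h⟩
    rw [smul_smul, mul_inv_cancel₀ (norm_ne_zero_iff.2 h), one_smul]

/-- Escape to infinity: from a point x of o a large double cone c is opened along light rays that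
move away from the tips of a. It meets o near x and meets a far cone at its centre. -/
lemma conn_far (a : DoubleCone) {o : DoubleCone} (ho : o.Perp a) :
    ∃ (n : EuclideanSpace ℝ (Fin 3)) (_ : ‖n‖ = 1) (s : ℝ) (hs : a.size < s),
      Conn a o (a.far n s hs) := by
  obtain ⟨x, hx⟩ := o.region_nonempty
  have hq := ho.not_mem_past hx
  have hr := ho.not_mem_future hx
  have ha := a.past_lt_future
  simp only [forwardCone, Set.mem_ofPred_eq, Prod.fst_sub, Prod.snd_sub, not_lt] at hq hr ha
  rw [norm_sub_rev] at hr
  -- n and m are the directions in which x is seen from the past and the future tip of a. If they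
  -- were opposite, the spatial distance of the tips would be the sum of the two distances to x,
  -- hence at least their time difference, although the tips are timelike separated.
  obtain ⟨n, m, hn, hm, hun, hvm, hnm⟩ : ∃ n m : EuclideanSpace ℝ (Fin 3), ‖n‖ = 1 ∧ ‖m‖ = 1 ∧
      x.2 - a.past.2 = ‖x.2 - a.past.2‖ • n ∧ x.2 - a.future.2 = ‖x.2 - a.future.2‖ • m ∧
      n ≠ -m := by
    obtain ⟨m, hm, hvm, hm0⟩ := exists_direction (x.2 - a.future.2)
      (k := EuclideanSpace.single 0 1) (by simp)
    obtain ⟨n, hn, hun, hn0⟩ := exists_direction (x.2 - a.past.2) hm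
    refine ⟨n, m, hn, hm, hun, hvm, fun h => ?_⟩
    have : a.future.2 - a.past.2 = (‖x.2 - a.past.2‖ + ‖x.2 - a.future.2‖) • n := by
      calc a.future.2 - a.past.2 = (x.2 - a.past.2) - (x.2 - a.future.2) := by abel
        _ = ‖x.2 - a.past.2‖ • n - ‖x.2 - a.future.2‖ • m := by rw [← hun, ← hvm]
        _ = _ := by rw [h]; module
    rw [this, norm_smul, hn, mul_one, Real.norm_eq_abs, abs_of_nonneg (by positivity)] at ha
    linarith
  have hnm2 : ‖n - m‖ < 2 := by
    have h1 := norm_sub_sq_real n m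
    have h2 := norm_add_sq_real n m
    have h3 : 0 < ‖n + m‖ := norm_pos_iff.2 fun h => hnm (eq_neg_of_add_eq_zero_left h)
    rw [hn, hm] at h1 h2
    nlinarith [norm_nonneg (n - m)]
  have he : 0 < ‖n + m‖ := norm_pos_iff.2 fun h => hnm (eq_neg_of_add_eq_zero_left h)
  set k : EuclideanSpace ℝ (Fin 3) := ‖n + m‖⁻¹ • (n + m)
  have hk : ‖k‖ = 1 := norm_smul_inv_norm (norm_pos_iff.1 he)
  set s := a.size + ‖x.2‖ + |x.1| + 1 with hsdef
  have hs : a.size < s := by linarith [norm_nonneg x.2, abs_nonneg x.1]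
  have hs0 : 0 < s := a.size_pos.trans hs
  -- Chosen so that the centre of c is x shifted in space by exactly s k.
  set t := 2 * s / ‖n + m‖ with htdef
  have ht : 0 < t := by positivity
  have hcone : ((1, (1 / 2 : ℝ) • (n - m)) : Minkowski) ∈ forwardCone := by
    simp only [forwardCone, Set.mem_ofPred_eq, norm_smul]
    norm_num; linarith
  have hcone' : ((1, -((1 / 2 : ℝ) • (n - m))) : Minkowski) ∈ forwardCone := by
    simpa [forwardCone] using hcone
  -- Along each light ray the distance from the relevant tip of a and the time difference grow by
  -- the same t, so the criterion in terms of tips stays valid.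
  let c : DoubleCone := ⟨x + t • (-1, m), x + t • (1, n), by
    have : x + t • ((1, n) : Minkowski) - (x + t • (-1, m)) =
        (2 * t) • ((1, (1 / 2 : ℝ) • (n - m)) : Minkowski) := by
      ext1
      · simp; ring
      · simp only [Prod.snd_sub, Prod.snd_add, Prod.smul_snd]; module
    rw [this]; exact forwardCone_smul hcone (by positivity)⟩
  have hca : c.Perp a := by
    apply perp_of_tips
    · simp only [c, forwardCone, Set.mem_ofPred_eq, Prod.fst_sub, Prod.snd_sub, Prod.fst_add,
        Prod.snd_add, Prod.smul_fst, Prod.smul_snd, smul_eq_mul, mul_one, not_lt]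
      have : x.2 + t • n - a.past.2 = (‖x.2 - a.past.2‖ + t) • n := by
        rw [add_smul, ← hun]; abel
      rw [this, norm_smul, hn, mul_one, Real.norm_eq_abs, abs_of_nonneg (by positivity)]
      linarith
    · simp only [c, forwardCone, Set.mem_ofPred_eq, Prod.fst_sub, Prod.snd_sub, Prod.fst_add,
        Prod.snd_add, Prod.smul_fst, Prod.smul_snd, smul_eq_mul, not_lt]
      have : a.future.2 - (x.2 + t • m) = -((‖x.2 - a.future.2‖ + t) • m) := by
        rw [add_smul, ← hvm]; abel
      rw [this, norm_neg, norm_smul, hm, mul_one, Real.norm_eq_abs, abs_of_nonneg (by positivity)]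
      linarith
  -- The segment from x, excluded, to the centre of c: small η stays in o by openness, and η = 1
  -- reaches the far cone.
  have hmid : ∀ η : ℝ, 0 < η → η ≤ 1 →
      x + (η * t) • ((0, (1 / 2 : ℝ) • (n + m)) : Minkowski) ∈ c.region := by
    intro η h0 h1
    have hη : 0 ≤ (1 - η) * t := mul_nonneg (by linarith) ht.le
    constructor
    · have e1 : x + (η * t) • ((0, (1 / 2 : ℝ) • (n + m)) : Minkowski) - c.past =
          ((1 - η) * t) • (1, -m) + (η * t) • ((1, (1 / 2 : ℝ) • (n - m)) : Minkowski) := by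
        ext1
        · simp [c]; ring
        · simp only [c, Prod.snd_sub, Prod.snd_add, Prod.smul_snd]; module
      rw [e1]
      refine forwardCone_add_closed ?_ (forwardCone_smul hcone (by positivity))
      simp [norm_smul, hm, ← abs_mul, abs_of_nonneg hη]
    · have e1 : c.future - (x + (η * t) • ((0, (1 / 2 : ℝ) • (n + m)) : Minkowski)) =
          ((1 - η) * t) • (1, n) + (η * t) • ((1, (1 / 2 : ℝ) • (n - m)) : Minkowski) := by
        ext1
        · simp [c]; ring
        · simp only [c, Prod.snd_sub, Prod.snd_add, Prod.smul_snd]; module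
      rw [e1]
      refine forwardCone_add_closed ?_ (forwardCone_smul hcone (by positivity))
      simp [norm_smul, hn, ← abs_mul, abs_of_nonneg hη]
  have hco : Conn a o c := by
    have hcont : Continuous fun η : ℝ => x + (η * t) • ((0, (1 / 2 : ℝ) • (n + m)) : Minkowski) := by
      fun_prop
    have hU := (o.isOpen_region.preimage hcont).mem_nhds (x := 0)
      (by rw [Set.mem_preimage, zero_mul, zero_smul, add_zero]; exact hx)
    obtain ⟨ε, hε, hb⟩ := Metric.mem_nhds_iff.1 hU
    set η := min (ε / 2) 1
    have hη : 0 < η := by positivity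
    have h2 := hb (a := η) (by
      rw [Metric.mem_ball, dist_zero_right, Real.norm_eq_abs, abs_of_pos hη]
      exact (min_le_left _ _).trans_lt (by linarith))
    exact Conn.of_inter ho hca h2 (hmid η hη (min_le_right _ _))
  refine ⟨k, hk, s, hs, hco.trans (Conn.of_inter hca (a.far_perp hk hs)
    (hmid 1 one_pos le_rfl) ?_)⟩
  rw [far, mem_overBall]
  have e2 : (x + (1 * t) • ((0, (1 / 2 : ℝ) • (n + m)) : Minkowski)).2 - s • k = x.2 := by
    have : (1 * t) • (1 / 2 : ℝ) • (n + m) = s • k := by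
      simp only [k, smul_smul]
      congr 1
      rw [htdef]; field_simp
    simp only [Prod.snd_add, Prod.smul_snd, this]; abel
  rw [e2]
  simp
  rw [hsdef]; linarith

/-- The spacelike complement of a double cone is connected in terms of double cones. -/
theorem conn_of_perp {a o o' : DoubleCone} (ho : o.Perp a) (ho' : o'.Perp a) : Conn a o o' := by
  obtain ⟨n, hn, s, hs, h⟩ := a.conn_far ho
  obtain ⟨n', hn', s', hs', h'⟩ := a.conn_far ho'
  exact (h.trans (a.far_conn hn hn' hs hs')).trans h'.symm

lemma exists_perp_pair (a b : DoubleCone) : ∃ o : DoubleCone, o.Perp a ∧ o.Perp b := by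
  obtain ⟨c, h1, h2⟩ := exists_sup a b
  obtain ⟨o, ho⟩ := exists_perp_to c
  exact ⟨o, (ho.symm.mono h1).symm, (ho.symm.mono h2).symm⟩

end DoubleCone

end Sectors

namespace Sectors

/-! ### Localized bimodules and their arrows -/

section Arrows

variable {H : Type*} [NormedAddCommGroup H] [InnerProductSpace ℂ H] [CompleteSpace H]
  {A : LocalNet H} {I J K L : Type} [Fintype I] [Fintype J] [Fintype K] [Fintype L]

namespace Bimodule

lemma star_apply' (σ : Bimodule A I) (x : A.quasi) (i j : I) : σ (star x) i j = star (σ x j i) := by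
  rw [map_star, Matrix.star_apply]

lemma conjTranspose_apply' (σ : Bimodule A I) (x : A.quasi) : (σ x)ᴴ = σ (star x) :=
  (map_star σ x).symm

lemma conjTranspose_one (σ : Bimodule A I) : (σ 1)ᴴ = σ 1 := by
  rw [conjTranspose_apply', star_one]

lemma mul_apply' (σ : Bimodule A I) (x y : A.quasi) (i j : I) :
    σ (x * y) i j = ∑ l, σ x i l * σ y l j := by
  rw [map_mul, Matrix.mul_apply]

lemma one_mul' (σ : Bimodule A I) (x : A.quasi) : σ 1 * σ x = σ x := by
  rw [← map_mul, one_mul]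

lemma mul_one' (σ : Bimodule A I) (x : A.quasi) : σ x * σ 1 = σ x := by
  rw [← map_mul, mul_one]

lemma sum_apply' {ι : Type*} (σ : Bimodule A I) (s : Finset ι) (f : ι → A.quasi) (i j : I) :
    σ (∑ k ∈ s, f k) i j = ∑ k ∈ s, σ (f k) i j := by
  rw [map_sum, Matrix.sum_apply]

lemma add_apply' (σ : Bimodule A I) (x y : A.quasi) (i j : I) :
    σ (x + y) i j = σ x i j + σ y i j := by
  rw [map_add, Matrix.add_apply]

lemma smul_apply' (σ : Bimodule A I) (c : ℂ) (x : A.quasi) (i j : I) :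
    σ (c • x) i j = c • σ x i j := by
  rw [map_smul, Matrix.smul_apply]

/-- The bimodule is localized in `o`. -/
def LocalizedIn (σ : Bimodule A I) (o : DoubleCone) : Prop :=
  ∀ a : DoubleCone, a.Perp o → ∀ X : A.quasi, (X : H →L[ℂ] H) ∈ A.alg a →
    ∀ i j, σ X i j = X * σ 1 i j

lemma toMorphism_localizedIn [DecidableEq I] (σ : Bimodule A I) (o : DoubleCone) :
    σ.toMorphism.LocalizedIn o ↔ σ.LocalizedIn o := by
  refine forall_congr' fun a => forall_congr' fun _ => forall_congr' fun X =>
    forall_congr' fun _ => ?_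
  constructor
  · intro h i j
    have := congrFun (congrFun h i) j
    rw [ampl_mul_apply] at this
    exact Subtype.ext this
  · intro h
    ext1 i j
    rw [ampl_mul_apply]
    exact congrArg Subtype.val (h i j)

lemma LocalizedIn.mono {σ : Bimodule A I} {o o' : DoubleCone} (h : σ.LocalizedIn o)
    (ho : o.Sub o') : σ.LocalizedIn o' :=
  fun a ha => h a (ha.symm.mono ho).symm

/-- `σ` acts on `x` as the trivial representation. -/
def Fixes (σ : Bimodule A I) (x : A.quasi) : Prop :=
  ∀ i j, σ x i j = x * σ 1 i j ∧ σ 1 i j * x = x * σ 1 i j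

/-- Commutation with the entries of σ(1) comes from comparing the localization identity for X with
the adjoint of the one for X*. -/
lemma LocalizedIn.fixes {σ : Bimodule A I} {o : DoubleCone} (h : σ.LocalizedIn o) {a : DoubleCone}
    (ha : a.Perp o) {X : A.quasi} (hX : (X : H →L[ℂ] H) ∈ A.alg a) : σ.Fixes X := by
  intro i j
  refine ⟨h a ha X hX i j, ?_⟩
  have h1 := h a ha (star X) (star_mem hX) j i
  have h2 := congrArg star h1
  rw [star_apply', star_star, star_mul, star_star, ← star_apply', star_one, h a ha X hX i j] at h2
  exact h2.symm

lemma Fixes.mul_left {σ : Bimodule A I} {y : A.quasi} (h : σ.Fixes y) (x : A.quasi) (i j : I) :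
    σ (y * x) i j = y * σ x i j := by
  rw [mul_apply', ← one_mul x, mul_apply', Finset.mul_sum]
  refine Finset.sum_congr rfl fun l _ => ?_
  rw [(h i l).1, one_mul, mul_assoc]

lemma Fixes.mul_right {σ : Bimodule A I} {y : A.quasi} (h : σ.Fixes y) (x : A.quasi) (i j : I) :
    σ (x * y) i j = σ x i j * y := by
  rw [mul_apply', ← mul_one x, mul_apply', Finset.sum_mul]
  refine Finset.sum_congr rfl fun l _ => ?_
  rw [(h l j).1, ← (h l j).2, mul_one, mul_assoc]

lemma Fixes.mul {σ : Bimodule A I} {x y : A.quasi} (hx : σ.Fixes x) (hy : σ.Fixes y) :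
    σ.Fixes (x * y) := by
  intro i j
  refine ⟨by rw [hx.mul_left, (hy i j).1, mul_assoc], ?_⟩
  rw [← mul_assoc, (hx i j).2, mul_assoc, (hy i j).2, mul_assoc]

lemma Fixes.star {σ : Bimodule A I} {x : A.quasi} (hx : σ.Fixes x) : σ.Fixes (star x) := by
  intro i j
  have h1 := congrArg Star.star (hx j i).1
  have h2 := congrArg Star.star (hx j i).2
  rw [star_mul, ← star_apply' σ 1, star_one, ← star_apply'] at h1
  rw [star_mul, star_mul, ← star_apply' σ 1, star_one] at h2
  exact ⟨h1.trans h2.symm, h2.symm⟩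

lemma Fixes.sum {ι : Type*} {σ : Bimodule A I} {s : Finset ι} {f : ι → A.quasi}
    (h : ∀ k ∈ s, σ.Fixes (f k)) : σ.Fixes (∑ k ∈ s, f k) := by
  intro i j
  rw [sum_apply', Finset.sum_mul, Finset.mul_sum]
  exact ⟨Finset.sum_congr rfl fun k hk => (h k hk i j).1,
    Finset.sum_congr rfl fun k hk => (h k hk i j).2⟩

section IsArrow

variable {ρ : Bimodule A I} {σ : Bimodule A J} {τ : Bimodule A K}

lemma IsArrow.refl (ρ : Bimodule A I) (X : A.quasi)
    (h : ∀ Y, X * Y = Y * X) : ρ.IsArrow ρ (ρ X) :=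
  ⟨ρ.mul_one' X, ρ.one_mul' X, fun Y => by rw [← map_mul, ← map_mul, h]⟩

lemma IsArrow.one (ρ : Bimodule A I) : ρ.IsArrow ρ (ρ 1) := IsArrow.refl ρ 1 (by simp)

lemma IsArrow.conjTranspose {T : Matrix J I A.quasi} (h : ρ.IsArrow σ T) : σ.IsArrow ρ Tᴴ := by
  refine ⟨?_, ?_, fun X => ?_⟩
  · rw [← σ.conjTranspose_one, ← Matrix.conjTranspose_mul, h.one_mul]
  · rw [← ρ.conjTranspose_one, ← Matrix.conjTranspose_mul, h.mul_one]
  · have := congrArg Matrix.conjTranspose (h.intertwine (star X))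
    rw [Matrix.conjTranspose_mul, Matrix.conjTranspose_mul, conjTranspose_apply',
      conjTranspose_apply', star_star] at this
    exact this.symm

lemma IsArrow.comp {S : Matrix K J A.quasi} {T : Matrix J I A.quasi} (hS : σ.IsArrow τ S)
    (hT : ρ.IsArrow σ T) : ρ.IsArrow τ (S * T) :=
  ⟨by rw [Matrix.mul_assoc, hT.mul_one], by rw [← Matrix.mul_assoc, hS.one_mul], fun X => by
    rw [Matrix.mul_assoc, hT.intertwine, ← Matrix.mul_assoc, hS.intertwine, Matrix.mul_assoc]⟩

lemma IsArrow.add {S T : Matrix J I A.quasi} (hS : ρ.IsArrow σ S) (hT : ρ.IsArrow σ T) :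
    ρ.IsArrow σ (S + T) :=
  ⟨by rw [Matrix.add_mul, hS.mul_one, hT.mul_one], by rw [Matrix.mul_add, hS.one_mul, hT.one_mul],
    fun X => by rw [Matrix.add_mul, Matrix.mul_add, hS.intertwine, hT.intertwine]⟩

lemma IsArrow.smul {T : Matrix J I A.quasi} (hT : ρ.IsArrow σ T) (c : ℂ) :
    ρ.IsArrow σ (c • T) :=
  ⟨by rw [Matrix.smul_mul, hT.mul_one], by rw [Matrix.mul_smul, hT.one_mul],
    fun X => by rw [Matrix.smul_mul, Matrix.mul_smul, hT.intertwine]⟩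

lemma IsArrow.zero : ρ.IsArrow σ 0 := ⟨by simp, by simp, by simp⟩

lemma IsArrow.sum {ι : Type*} {s : Finset ι} {T : ι → Matrix J I A.quasi}
    (h : ∀ k ∈ s, ρ.IsArrow σ (T k)) : ρ.IsArrow σ (∑ k ∈ s, T k) :=
  Finset.sum_induction _ _ (fun _ _ => IsArrow.add) IsArrow.zero h

lemma IsArrow.entry {T : Matrix J I A.quasi} (h : ρ.IsArrow σ T) (X : A.quasi) (j : J) (i : I) :
    ∑ l, T j l * ρ X l i = ∑ l, σ X j l * T l i := by
  rw [← Matrix.mul_apply, ← Matrix.mul_apply, h.intertwine]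

lemma IsUnitaryArrow.symm {U : Matrix J I A.quasi} (h : ρ.IsUnitaryArrow σ U) :
    σ.IsUnitaryArrow ρ Uᴴ :=
  ⟨⟨h.isIsometry.isArrow.conjTranspose, by rw [Matrix.conjTranspose_conjTranspose, h.mul_star_self]⟩,
    by rw [Matrix.conjTranspose_conjTranspose, h.isIsometry.star_mul_self]⟩

lemma IsIsometry.comp {S : Matrix K J A.quasi} {T : Matrix J I A.quasi} (hS : σ.IsIsometry τ S)
    (hT : ρ.IsIsometry σ T) : ρ.IsIsometry τ (S * T) :=
  ⟨hS.isArrow.comp hT.isArrow, by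
    rw [Matrix.conjTranspose_mul, Matrix.mul_assoc, ← Matrix.mul_assoc Sᴴ, hS.star_mul_self,
      hT.isArrow.one_mul, hT.star_mul_self]⟩

lemma IsUnitaryArrow.trans {S : Matrix K J A.quasi} {T : Matrix J I A.quasi}
    (hS : σ.IsUnitaryArrow τ S) (hT : ρ.IsUnitaryArrow σ T) : ρ.IsUnitaryArrow τ (S * T) :=
  ⟨hS.isIsometry.comp hT.isIsometry, by
    rw [Matrix.conjTranspose_mul, Matrix.mul_assoc, ← Matrix.mul_assoc T, hT.mul_star_self,
      hS.symm.isIsometry.isArrow.one_mul, hS.mul_star_self]⟩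

/-- The entries of arrows between localized bimodules are local. -/
lemma IsArrow.entry_mem {T : Matrix J I A.quasi} (h : ρ.IsArrow σ T) {o a c : DoubleCone}
    (hρ : ρ.LocalizedIn o) (hσ : σ.LocalizedIn a) (ho : o.Sub c) (ha : a.Sub c) (j : J) (i : I) :
    (T j i : H →L[ℂ] H) ∈ A.alg c := by
  refine A.mem_alg_of_commute c _ fun b hb x hx => ?_
  let X : A.quasi := ⟨x, A.alg_subset_quasi b hx⟩
  have h1 := h.entry X j i
  have h2 := (hρ.mono ho).fixes hb (X := X) hx
  have h3 := (hσ.mono ha).fixes hb (X := X) hx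
  have e1 : ∑ l, T j l * ρ X l i = T j i * X := by
    conv_rhs => rw [← h.mul_one, Matrix.mul_apply, Finset.sum_mul]
    exact Finset.sum_congr rfl fun l _ => by rw [(h2 l i).1, ← (h2 l i).2, mul_assoc]
  have e2 : ∑ l, σ X j l * T l i = X * T j i := by
    conv_rhs => rw [← h.one_mul, Matrix.mul_apply, Finset.mul_sum]
    exact Finset.sum_congr rfl fun l _ => by rw [(h3 j l).1, mul_assoc]
  rw [e1, e2] at h1
  exact congrArg Subtype.val h1.symm

lemma LocalizedIn.one_mem {o : DoubleCone} (h : ρ.LocalizedIn o) (i j : I) :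
    (ρ 1 i j : H →L[ℂ] H) ∈ A.alg o :=
  (IsArrow.one ρ).entry_mem h h (DoubleCone.Sub.refl _) (DoubleCone.Sub.refl _) i j

/-- `σ(X)` for `X` in `𝔄(c)` has entries in `𝔄(c)` if `σ` is localized in `c`. -/
lemma LocalizedIn.apply_mem {c : DoubleCone} (h : ρ.LocalizedIn c) {X : A.quasi}
    (hX : (X : H →L[ℂ] H) ∈ A.alg c) (i j : I) : (ρ X i j : H →L[ℂ] H) ∈ A.alg c := by
  refine A.mem_alg_of_commute c _ fun b hb y hy => ?_
  let Y : A.quasi := ⟨y, A.alg_subset_quasi b hy⟩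
  have h2 := h.fixes hb (X := Y) hy
  have h3 : X * Y = Y * X := Subtype.ext
    ((VonNeumannAlgebra.mem_commutant_iff.1 (A.locality b c hb hy)) _ hX)
  have h4 : Y * ρ X i j = ρ X i j * Y := by
    rw [← h2.mul_left, ← h2.mul_right, h3]
  exact congrArg Subtype.val h4

end IsArrow

/-- Localized bimodules that can be transported to any double cone. -/
structure IsObj (σ : Bimodule A I) : Prop where
  localized : ∃ o : DoubleCone, σ.LocalizedIn o
  transportable : ∀ o : DoubleCone, ∃ (m : ℕ) (τ : Bimodule A (Fin m)) (U : Matrix (Fin m) I A.quasi),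
    τ.LocalizedIn o ∧ σ.IsUnitaryArrow τ U

lemma IsObj.of_unitary {ρ : Bimodule A I} {σ : Bimodule A J} (hρ : ρ.IsObj)
    {U : Matrix J I A.quasi} (hU : ρ.IsUnitaryArrow σ U) (hσ : ∃ o, σ.LocalizedIn o) : σ.IsObj := by
  refine ⟨hσ, fun o => ?_⟩
  obtain ⟨m, τ, W, hτ, hW⟩ := hρ.transportable o
  exact ⟨m, τ, W * Uᴴ, hτ, hW.trans hU.symm⟩

lemma IsObj.exists_transport {σ : Bimodule A I} (h : σ.IsObj) (o : DoubleCone) :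
    ∃ (m : ℕ) (τ : Bimodule A (Fin m)) (U : Matrix (Fin m) I A.quasi),
      τ.IsObj ∧ τ.LocalizedIn o ∧ σ.IsUnitaryArrow τ U := by
  obtain ⟨m, τ, U, hτ, hU⟩ := h.transportable o
  exact ⟨m, τ, U, h.of_unitary hU ⟨o, hτ⟩, hτ, hU⟩

/-- Bimodules localized in `a` act trivially on arrows between bimodules localized spacelike
to `a`. -/
theorem IsObj.fixes_arrow {ρ : Bimodule A I} {ρ' : Bimodule A J} {σ : Bimodule A K}
    (hρ : ρ.IsObj) {T : Matrix J I A.quasi} (hT : ρ.IsArrow ρ' T) {o o' a : DoubleCone}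
    (ho : ρ.LocalizedIn o) (ho' : ρ'.LocalizedIn o') (hσ : σ.LocalizedIn a)
    (hoa : o.Perp a) (hoa' : o'.Perp a) (j : J) (i : I) : σ.Fixes (T j i) := by
  -- Charge transport along a chain of cones spacelike to a. At each link U = (U W*) W, where W ends
  -- at the previous cone and U W* is local in a cone spacelike to a. Both factors are fixed by σ,
  -- and fixed elements are closed under products and sums.
  have key : ∀ o'', DoubleCone.Conn a o o'' → ∀ (m : ℕ) (τ : Bimodule A (Fin m))
      (U : Matrix (Fin m) I A.quasi), τ.LocalizedIn o'' → ρ.IsArrow τ U →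
      ∀ k i, σ.Fixes (U k i) := by
    intro o'' h
    induction h with
    | refl =>
      intro m τ U hτ hU k i
      exact hσ.fixes hoa (hU.entry_mem ho hτ (DoubleCone.Sub.refl _) (DoubleCone.Sub.refl _) k i)
    | tail hc hs ih =>
      rename_i b c
      intro m τ U hτ hU k i
      obtain ⟨d, hd, hbd, hcd⟩ := hs
      obtain ⟨m', τ', W, hτ', hW⟩ := hρ.transportable b
      have h1 := ih m' τ' W hτ' hW.isIsometry.isArrow
      have h2 := (hU.comp hW.symm.isIsometry.isArrow).entry_mem hτ' hτ hbd hcd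
      have h3 : U = U * Wᴴ * W := by
        rw [Matrix.mul_assoc, hW.isIsometry.star_mul_self, hU.mul_one]
      rw [h3, Matrix.mul_apply]
      exact Fixes.sum fun l _ => (hσ.fixes hd (h2 k l)).mul (h1 l i)
  -- T is factored through a transport to o'; the remaining factor T W* is local in o'.
  obtain ⟨m', τ', W, hτ', hW⟩ := hρ.transportable o'
  have h1 := key o' (DoubleCone.conn_of_perp hoa hoa') m' τ' W hτ' hW.isIsometry.isArrow
  have h2 := (hT.comp hW.symm.isIsometry.isArrow).entry_mem hτ' ho' (DoubleCone.Sub.refl _)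
    (DoubleCone.Sub.refl _)
  have h3 : T = T * Wᴴ * W := by
    rw [Matrix.mul_assoc, hW.isIsometry.star_mul_self, hT.mul_one]
  rw [h3, Matrix.mul_apply]
  exact Fixes.sum fun l _ => (hσ.fixes hoa' (h2 j l)).mul (h1 l i)

end Bimodule

/-! ### Continuity -/

instance LocalNet.isClosed_quasi (A : LocalNet H) : IsClosed (A.quasi : Set (H →L[ℂ] H)) :=
  StarSubalgebra.isClosed_topologicalClosure _

namespace Bimodule

/-- A bimodule as a morphism into the C*-algebra of matrices over `𝔄`. -/
noncomputable def toCStar (ρ : Bimodule A I) : A.quasi →⋆ₙₐ[ℂ] CStarMatrix I I A.quasi where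
  toFun X := CStarMatrix.ofMatrix (ρ X)
  map_smul' c X := by rw [map_smul]; rfl
  map_zero' := by rw [map_zero]; rfl
  map_add' X Y := by rw [map_add]; rfl
  map_mul' X Y := by rw [map_mul]; rfl
  map_star' X := by rw [map_star]; rfl

/-- `CStarMatrix` carries the C*-norm, for which *-morphisms are contractive and entries are
dominated by the matrix. -/
lemma norm_apply_le (ρ : Bimodule A I) (X : A.quasi) (i j : I) : ‖ρ X i j‖ ≤ ‖X‖ := by
  let := CStarAlgebra.spectralOrder A.quasi
  let := CStarAlgebra.spectralOrderedRing A.quasi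
  exact (CStarMatrix.norm_entry_le_norm (M := ρ.toCStar X)).trans
    (NonUnitalStarAlgHom.norm_apply_le ρ.toCStar X)

lemma continuous_entry (ρ : Bimodule A I) (i j : I) : Continuous fun X => ρ X i j := by
  let f : A.quasi →ₗ[ℂ] A.quasi :=
    { toFun := fun X => ρ X i j
      map_add' := fun X Y => ρ.add_apply' X Y i j
      map_smul' := fun c X => ρ.smul_apply' c X i j }
  exact (f.mkContinuous 1 fun X => by rw [one_mul]; exact ρ.norm_apply_le X i j).continuous

/-- Bimodules that agree on all local algebras are equal. -/
lemma ext_local {ρ σ : Bimodule A I}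
    (h : ∀ (c : DoubleCone) (X : A.quasi), (X : H →L[ℂ] H) ∈ A.alg c → ρ X = σ X) : ρ = σ := by
  have key : ∀ x (hx : x ∈ StarAlgebra.adjoin ℂ
      (⋃ c ∈ {c : DoubleCone | c.region ⊆ Set.univ}, (A.alg c : Set (H →L[ℂ] H)))),
      ∀ hx' : x ∈ A.quasi, ρ ⟨x, hx'⟩ = σ ⟨x, hx'⟩ := by
    intro x hx
    refine StarAlgebra.adjoin_induction (p := fun x _ => ∀ hx' : x ∈ A.quasi,
      ρ ⟨x, hx'⟩ = σ ⟨x, hx'⟩) ?_ ?_ ?_ ?_ ?_ hx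
    · intro z hz hz'
      simp only [Set.mem_iUnion] at hz
      obtain ⟨c, _, hc⟩ := hz
      exact h c _ hc
    · intro r hr
      obtain ⟨c, _⟩ := DoubleCone.exists_perp
      exact h c _ (algebraMap_mem (A.alg c).toStarSubalgebra r)
    · intro x y hx hy h1 h2 _
      have hx' : x ∈ A.quasi := StarSubalgebra.le_topologicalClosure _ hx
      have hy' : y ∈ A.quasi := StarSubalgebra.le_topologicalClosure _ hy
      have : ρ (⟨x, hx'⟩ + ⟨y, hy'⟩) = σ (⟨x, hx'⟩ + ⟨y, hy'⟩) := by
        rw [map_add, map_add, h1, h2]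
      exact this
    · intro x y hx hy h1 h2 _
      have hx' : x ∈ A.quasi := StarSubalgebra.le_topologicalClosure _ hx
      have hy' : y ∈ A.quasi := StarSubalgebra.le_topologicalClosure _ hy
      have : ρ (⟨x, hx'⟩ * ⟨y, hy'⟩) = σ (⟨x, hx'⟩ * ⟨y, hy'⟩) := by
        rw [map_mul, map_mul, h1, h2]
      exact this
    · intro x hx h1 _
      have hx' : x ∈ A.quasi := StarSubalgebra.le_topologicalClosure _ hx
      have : ρ (star ⟨x, hx'⟩) = σ (star ⟨x, hx'⟩) := by
        rw [map_star, map_star, h1]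
      exact this
  ext1 X
  ext1 i j
  obtain ⟨u, hu, hlim⟩ := mem_closure_iff_seq_limit.1 (show (X : H →L[ℂ] H) ∈ closure _ from X.2)
  let v : ℕ → A.quasi := fun n => ⟨u n, StarSubalgebra.le_topologicalClosure _ (hu n)⟩
  have hv : Filter.Tendsto v Filter.atTop (nhds X) := by
    rw [tendsto_subtype_rng]; exact hlim
  have h1 := ((ρ.continuous_entry i j).tendsto X).comp hv
  have h2 := ((σ.continuous_entry i j).tendsto X).comp hv
  refine tendsto_nhds_unique h1 (h2.congr fun n => ?_)
  exact (congrFun (congrFun (key _ (hu n) _) i) j).symm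

/-- Bimodules localized in spacelike separated double cones commute. -/
theorem IsObj.commute {ρ : Bimodule A I} {τ : Bimodule A J} (hρ : ρ.IsObj) (hτ : τ.IsObj)
    {o a : DoubleCone} (ho : ρ.LocalizedIn o) (ha : τ.LocalizedIn a) (hoa : o.Perp a)
    (X : A.quasi) (i i' : I) (j j' : J) : ρ (τ X j j') i i' = τ (ρ X i i') j j' := by
  have main : (ρ.tensor τ) = (τ.tensor ρ).reindex (Equiv.prodComm J I) := by
    refine ext_local fun c X hX => ?_
    ext1 ⟨i, j⟩ ⟨i', j'⟩
    change ρ (τ X j j') i i' = τ (ρ X i i') j j'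
    -- ρ is transported to o₁, spacelike to a and to c, and then τ to a₁, spacelike to o, o₁ and c.
    -- The transported objects act trivially on X in 𝔄(c), so ρ(X) = U* X U and τ(X) = V* X V. What
    -- remains is to move U and V past the other object and past each other.
    obtain ⟨d, had, hcd⟩ := DoubleCone.exists_sup a c
    obtain ⟨o₁, ho₁⟩ := DoubleCone.exists_perp_to d
    obtain ⟨d', hod', hod₁⟩ := DoubleCone.exists_sup o o₁
    obtain ⟨d'', hd'', hcd''⟩ := DoubleCone.exists_sup d' c
    obtain ⟨a₁, ha₁⟩ := DoubleCone.exists_perp_to d''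
    have p1 : o₁.Perp a := (ho₁.symm.mono had).symm
    have p2 : o₁.Perp c := (ho₁.symm.mono hcd).symm
    have p3 : o.Perp a₁ := ha₁.symm.mono (hod'.trans hd'')
    have p4 : o₁.Perp a₁ := ha₁.symm.mono (hod₁.trans hd'')
    have p5 : c.Perp a₁ := ha₁.symm.mono hcd''
    obtain ⟨m, ρ₁, U, hρ₁, hU⟩ := hρ.transportable o₁
    obtain ⟨n, τ₁, V, hτ₁, hV⟩ := hτ.transportable a₁
    have f1 : ∀ k i, τ.Fixes (U k i) :=
      hρ.fixes_arrow hU.isIsometry.isArrow ho hρ₁ ha hoa p1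
    have f2 : ∀ k i, τ₁.Fixes (U k i) :=
      hρ.fixes_arrow hU.isIsometry.isArrow ho hρ₁ hτ₁ p3 p4
    have f3 : ∀ k j, ρ.Fixes (V k j) :=
      hτ.fixes_arrow hV.isIsometry.isArrow ha hτ₁ ho hoa.symm p3.symm
    -- V intertwines τ and τ₁, and both fix the entries of U: o, o₁ are spacelike to a and to a₁.
    have hUV : ∀ k i l j, U k i * V l j = V l j * U k i := by
      intro k i l j
      have h1 := hV.isIsometry.isArrow.entry (U k i) l j
      have e1 : ∑ s, V l s * τ (U k i) s j = V l j * U k i := by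
        conv_rhs => rw [← hV.isIsometry.isArrow.mul_one, Matrix.mul_apply, Finset.sum_mul]
        exact Finset.sum_congr rfl fun s _ => by
          rw [(f1 k i s j).1, ← (f1 k i s j).2, mul_assoc]
      have e2 : ∑ s, τ₁ (U k i) l s * V s j = U k i * V l j := by
        conv_rhs => rw [← hV.isIsometry.isArrow.one_mul, Matrix.mul_apply, Finset.mul_sum]
        exact Finset.sum_congr rfl fun s _ => by rw [(f2 k i l s).1, mul_assoc]
      rw [e1, e2] at h1
      exact h1.symm
    have exp : ∀ {N : ℕ} {B : Type} [Fintype B] {σ : Bimodule A B} {σ₁ : Bimodule A (Fin N)}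
        {W : Matrix (Fin N) B A.quasi}, σ.IsUnitaryArrow σ₁ W → σ₁.Fixes X →
        ∀ b b', σ X b b' = ∑ k, star (W k b) * X * W k b' := by
      intro N B _ σ σ₁ W hW hX b b'
      have h1 : σ X = Wᴴ * (σ₁ X * W) := by
        rw [← hW.isIsometry.isArrow.intertwine, ← Matrix.mul_assoc, hW.isIsometry.star_mul_self,
          one_mul']
      rw [h1, Matrix.mul_apply]
      refine Finset.sum_congr rfl fun k _ => ?_
      rw [Matrix.conjTranspose_apply, mul_assoc]
      congr 1
      conv_rhs => rw [← hW.isIsometry.isArrow.one_mul, Matrix.mul_apply, Finset.mul_sum]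
      rw [Matrix.mul_apply]
      exact Finset.sum_congr rfl fun l _ => by rw [(hX k l).1, mul_assoc]
    rw [exp hU (hρ₁.fixes p2.symm hX), exp hV (hτ₁.fixes p5 hX), sum_apply', sum_apply']
    simp_rw [fun k => (f1 k i').mul_right, fun k => (f1 k i).star.mul_left,
      fun k => (f3 k j').mul_right, fun k => (f3 k j).star.mul_left,
      exp hU (hρ₁.fixes p2.symm hX), exp hV (hτ₁.fixes p5 hX), Finset.mul_sum, Finset.sum_mul]
    rw [Finset.sum_comm]
    refine Finset.sum_congr rfl fun k _ => Finset.sum_congr rfl fun l _ => ?_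
    have e1 : star (V l j) * star (U k i) = star (U k i) * star (V l j) := by
      rw [← star_mul, ← star_mul, hUV]
    calc star (V l j) * (star (U k i) * X * U k i') * V l j'
        = (star (V l j) * star (U k i)) * X * (U k i' * V l j') := by simp only [mul_assoc]
      _ = _ := by rw [e1, hUV]; simp only [mul_assoc]
  have := congrFun (congrFun (DFunLike.congr_fun main X) (i, j)) (i', j')
  exact this

end Bimodule

end Arrows

end Sectors

namespace Sectors

section Tensor

variable {H : Type*} [NormedAddCommGroup H] [InnerProductSpace ℂ H] [CompleteSpace H]
  {A : LocalNet H} {I J K L I' J' K' : Type} [Fintype I] [Fintype J] [Fintype K] [Fintype L]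
  [Fintype I'] [Fintype J'] [Fintype K']

namespace Bimodule

/-! ### Tensor products of arrows -/

/-- The arrow `1_σ × T`. -/
noncomputable def lt (σ : Bimodule A I) (T : Matrix J K A.quasi) : Matrix (I × J) (I × K) A.quasi :=
  Matrix.of fun p q => σ (T p.2 q.2) p.1 q.1

lemma lt_apply (σ : Bimodule A I) (T : Matrix J K A.quasi) (p : I × J) (q : I × K) :
    lt σ T p q = σ (T p.2 q.2) p.1 q.1 := rfl

lemma lt_mul (σ : Bimodule A I) (S : Matrix L J A.quasi) (T : Matrix J K A.quasi) :
    lt σ (S * T) = lt σ S * lt σ T := by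
  ext1 p q
  simp only [lt_apply, Matrix.mul_apply, sum_apply', mul_apply', Fintype.sum_prod_type]
  exact Finset.sum_comm

lemma lt_conjTranspose (σ : Bimodule A I) (T : Matrix J K A.quasi) : lt σ Tᴴ = (lt σ T)ᴴ := by
  ext1 p q
  rw [Matrix.conjTranspose_apply, lt_apply, lt_apply, Matrix.conjTranspose_apply, star_apply']

lemma lt_add (σ : Bimodule A I) (S T : Matrix J K A.quasi) : lt σ (S + T) = lt σ S + lt σ T := by
  ext1 p q
  simp [lt_apply]

lemma lt_smul (σ : Bimodule A I) (c : ℂ) (T : Matrix J K A.quasi) : lt σ (c • T) = c • lt σ T := by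
  ext1 p q
  simp [lt_apply]

lemma tensor_eq_lt (ρ : Bimodule A I) (σ : Bimodule A J) (X : A.quasi) :
    (ρ.tensor σ) X = lt ρ (σ X) := rfl

lemma tensorArrow_apply (ρ : Bimodule A I) (T : Matrix J I A.quasi) (S : Matrix L K A.quasi)
    (p : J × L) (q : I × K) :
    tensorArrow ρ T S p q = ∑ k, T p.1 k * ρ (S p.2 q.2) k q.1 := rfl

lemma tensorArrow_one (ρ : Bimodule A I) (S : Matrix L K A.quasi) :
    tensorArrow ρ (ρ 1) S = lt ρ S := by
  ext1 p q
  rw [tensorArrow_apply, lt_apply, ← Matrix.mul_apply, one_mul']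

/-- The interchange law. Only T has to intertwine, since it alone is moved past ρ'(S'); the second
factors are arbitrary matrices. -/
lemma tensorArrow_comp {ρ : Bimodule A I} {ρ' : Bimodule A J} {T : Matrix J I A.quasi}
    (hT : ρ.IsArrow ρ' T) (T' : Matrix K J A.quasi) (S' : Matrix I' J' A.quasi)
    (S : Matrix J' K' A.quasi) :
    tensorArrow ρ' T' S' * tensorArrow ρ T S = tensorArrow ρ (T' * T) (S' * S) := by
  ext1 ⟨a, c⟩ ⟨e, d⟩
  simp only [tensorArrow_apply, Matrix.mul_apply, Fintype.sum_prod_type, sum_apply', mul_apply',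
    Finset.mul_sum, Finset.sum_mul]
  calc ∑ b, ∑ l, ∑ m, ∑ k, T' a k * ρ' (S' c l) k b * (T b m * ρ (S l d) m e)
      = ∑ l, ∑ m, ∑ k, ∑ b, T' a k * ρ' (S' c l) k b * (T b m * ρ (S l d) m e) := by
        rw [Finset.sum_comm]
        refine Finset.sum_congr rfl fun l _ => ?_
        rw [Finset.sum_comm]
        refine Finset.sum_congr rfl fun m _ => ?_
        rw [Finset.sum_comm]
    _ = ∑ l, ∑ m, ∑ k, ∑ b, T' a k * T k b * (ρ (S' c l) b m * ρ (S l d) m e) := by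
        refine Finset.sum_congr rfl fun l _ => Finset.sum_congr rfl fun m _ =>
          Finset.sum_congr rfl fun k _ => ?_
        simp only [mul_assoc, ← Finset.mul_sum]
        simp only [← mul_assoc, ← Finset.sum_mul]
        simp only [mul_assoc]
        rw [← hT.entry]
    _ = _ := by
        conv_rhs => rw [Finset.sum_comm]; enter [2, l]; rw [Finset.sum_comm]; enter [2, m]; rw [Finset.sum_comm]

lemma tensorArrow_apply' {ρ : Bimodule A I} {ρ' : Bimodule A J} {T : Matrix J I A.quasi}
    (hT : ρ.IsArrow ρ' T) (S : Matrix L K A.quasi) (p : J × L) (q : I × K) :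
    tensorArrow ρ T S p q = ∑ k, ρ' (S p.2 q.2) p.1 k * T k q.1 := by
  rw [tensorArrow_apply, hT.entry]

lemma tensorArrow_conjTranspose {ρ : Bimodule A I} {ρ' : Bimodule A J} {T : Matrix J I A.quasi}
    (hT : ρ.IsArrow ρ' T) (S : Matrix L K A.quasi) :
    (tensorArrow ρ T S)ᴴ = tensorArrow ρ' Tᴴ Sᴴ := by
  ext1 p q
  rw [Matrix.conjTranspose_apply, tensorArrow_apply' hT, tensorArrow_apply, star_sum]
  simp only [star_mul, Matrix.conjTranspose_apply, star_apply']

lemma IsArrow.tensor {ρ : Bimodule A I} {ρ' : Bimodule A I'} {σ : Bimodule A J}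
    {σ' : Bimodule A J'} {T : Matrix I' I A.quasi} {S : Matrix J' J A.quasi}
    (hT : ρ.IsArrow ρ' T) (hS : σ.IsArrow σ' S) :
    (ρ.tensor σ).IsArrow (ρ'.tensor σ') (tensorArrow ρ T S) := by
  refine ⟨?_, ?_, fun X => ?_⟩
  · rw [tensor_eq_lt, ← tensorArrow_one, tensorArrow_comp (IsArrow.one ρ), hT.mul_one, hS.mul_one]
  · rw [tensor_eq_lt, ← tensorArrow_one, tensorArrow_comp hT, hT.one_mul, hS.one_mul]
  · rw [tensor_eq_lt, tensor_eq_lt, ← tensorArrow_one, ← tensorArrow_one,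
      tensorArrow_comp (IsArrow.one ρ), tensorArrow_comp hT, hT.mul_one, hT.one_mul, hS.intertwine]

lemma IsIsometry.tensor {ρ : Bimodule A I} {ρ' : Bimodule A I'} {σ : Bimodule A J}
    {σ' : Bimodule A J'} {T : Matrix I' I A.quasi} {S : Matrix J' J A.quasi}
    (hT : ρ.IsIsometry ρ' T) (hS : σ.IsIsometry σ' S) :
    (ρ.tensor σ).IsIsometry (ρ'.tensor σ') (tensorArrow ρ T S) :=
  ⟨hT.isArrow.tensor hS.isArrow, by
    rw [tensorArrow_conjTranspose hT.isArrow, tensorArrow_comp hT.isArrow, hT.star_mul_self,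
      hS.star_mul_self, tensorArrow_one, tensor_eq_lt]⟩

lemma IsUnitaryArrow.tensor {ρ : Bimodule A I} {ρ' : Bimodule A I'} {σ : Bimodule A J}
    {σ' : Bimodule A J'} {T : Matrix I' I A.quasi} {S : Matrix J' J A.quasi}
    (hT : ρ.IsUnitaryArrow ρ' T) (hS : σ.IsUnitaryArrow σ' S) :
    (ρ.tensor σ).IsUnitaryArrow (ρ'.tensor σ') (tensorArrow ρ T S) :=
  ⟨hT.isIsometry.tensor hS.isIsometry, by
    rw [tensorArrow_conjTranspose hT.isIsometry.isArrow, tensorArrow_comp hT.symm.isIsometry.isArrow,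
      hT.mul_star_self, hS.mul_star_self, tensorArrow_one, tensor_eq_lt]⟩

lemma IsArrow.lt {σ : Bimodule A J} {σ' : Bimodule A J'} {S : Matrix J' J A.quasi}
    (ρ : Bimodule A I) (hS : σ.IsArrow σ' S) :
    (ρ.tensor σ).IsArrow (ρ.tensor σ') (lt ρ S) := by
  rw [← tensorArrow_one]; exact (IsArrow.one ρ).tensor hS

/-! ### Reindexing and tensor products of objects -/

lemma reindex_eq (σ : Bimodule A I) (e : I ≃ J) (X : A.quasi) :
    σ.reindex e X = (σ X).submatrix e.symm e.symm := rfl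

lemma reindex_isUnitaryArrow (σ : Bimodule A I) (e : I ≃ J) :
    σ.IsUnitaryArrow (σ.reindex e) ((σ 1).submatrix e.symm id) := by
  have hstar : ((σ 1).submatrix e.symm id)ᴴ = (σ 1).submatrix id e.symm := by
    rw [Matrix.conjTranspose_submatrix, conjTranspose_one]
  have hid : ∀ M : Matrix I I A.quasi, M = M.submatrix id id := fun M => rfl
  refine ⟨⟨⟨?_, ?_, fun X => ?_⟩, ?_⟩, ?_⟩
  · conv_lhs => enter [2]; rw [hid (σ 1)]
    rw [← Matrix.submatrix_mul _ _ _ _ _ Function.bijective_id, one_mul']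
  · rw [reindex_eq, ← Matrix.submatrix_mul _ _ _ _ _ e.symm.bijective, one_mul']
  · rw [reindex_eq, ← Matrix.submatrix_mul _ _ _ _ _ e.symm.bijective]
    conv_lhs => enter [2]; rw [hid (σ X)]
    rw [← Matrix.submatrix_mul _ _ _ _ _ Function.bijective_id, one_mul', mul_one']
  · rw [hstar, ← Matrix.submatrix_mul _ _ _ _ _ e.symm.bijective, one_mul']; rfl
  · rw [hstar, ← Matrix.submatrix_mul _ _ _ _ _ Function.bijective_id, one_mul']; rfl

lemma LocalizedIn.reindex {σ : Bimodule A I} {o : DoubleCone} (h : σ.LocalizedIn o) (e : I ≃ J) :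
    (σ.reindex e).LocalizedIn o :=
  fun a ha X hX i j => h a ha X hX (e.symm i) (e.symm j)

lemma IsObj.reindex {σ : Bimodule A I} (h : σ.IsObj) (e : I ≃ J) : (σ.reindex e).IsObj := by
  obtain ⟨o, ho⟩ := h.localized
  exact h.of_unitary (σ.reindex_isUnitaryArrow e) ⟨o, ho.reindex e⟩

lemma LocalizedIn.tensor {ρ : Bimodule A I} {σ : Bimodule A J} {o : DoubleCone}
    (hρ : ρ.LocalizedIn o) (hσ : σ.LocalizedIn o) : (ρ.tensor σ).LocalizedIn o := by
  intro a ha X hX p q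
  change ρ (σ X p.2 q.2) p.1 q.1 = X * ρ (σ 1 p.2 q.2) p.1 q.1
  rw [hσ a ha X hX, (hρ.fixes ha hX).mul_left]

lemma IsObj.tensor {ρ : Bimodule A I} {σ : Bimodule A J} (hρ : ρ.IsObj) (hσ : σ.IsObj) :
    (ρ.tensor σ).IsObj := by
  obtain ⟨o, ho⟩ := hρ.localized
  obtain ⟨a, ha⟩ := hσ.localized
  obtain ⟨c, hoc, hac⟩ := DoubleCone.exists_sup o a
  refine ⟨⟨c, (ho.mono hoc).tensor (ha.mono hac)⟩, fun b => ?_⟩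
  obtain ⟨m, ρ', U, hρ', hU⟩ := hρ.transportable b
  obtain ⟨n, σ', V, hσ', hV⟩ := hσ.transportable b
  exact ⟨_, _, _, (hρ'.tensor hσ').reindex finProdFinEquiv,
    (reindex_isUnitaryArrow _ finProdFinEquiv).trans (hU.tensor hV)⟩

lemma unit_apply (X : A.quasi) (i j : Unit) : unit A X i j = X := rfl

lemma unit_localizedIn (o : DoubleCone) : (unit A).LocalizedIn o := by
  intro a _ X _ i j
  rw [unit_apply, unit_apply, mul_one]

lemma unit_isObj : (unit A).IsObj := by
  obtain ⟨o, _, _⟩ := DoubleCone.exists_perp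
  refine ⟨⟨o, unit_localizedIn o⟩, fun b => ?_⟩
  exact ⟨1, _, _, (unit_localizedIn b).reindex (Equiv.ofUnique Unit (Fin 1)),
    reindex_isUnitaryArrow _ _⟩

lemma pow_isObj {ρ : Bimodule A I} (hρ : ρ.IsObj) (d : ℕ) : (ρ.pow d).IsObj := by
  induction d with
  | zero => exact unit_isObj.reindex _
  | succ d ih => exact (hρ.tensor ih).reindex _

/-! ### The symmetry -/

/-- The matrix `(1_σ × U*) θ (U × 1_σ)`. -/
noncomputable def exchange (σ : Bimodule A J) (U : Matrix K I A.quasi) : Matrix (J × I) (I × J) A.quasi :=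
  Matrix.of fun p q => ∑ k, σ (star (U k p.2)) p.1 q.2 * U k q.1

lemma exchange_apply (σ : Bimodule A J) (U : Matrix K I A.quasi) (p : J × I) (q : I × J) :
    exchange σ U p q = ∑ k, σ (star (U k p.2)) p.1 q.2 * U k q.1 := rfl

/-- Intertwiners fixed by `σ` can be moved through the exchange matrix. -/
lemma sum_fixes_mul (σ : Bimodule A J) {T : Matrix L K A.quasi} {U : Matrix K I A.quasi}
    {V : Matrix L I' A.quasi} (hT : ∀ l k, σ.Fixes (T l k)) (i : I') (i' : I) (j j' : J) :
    ∑ l, σ (star (V l i)) j j' * (T * U) l i' = ∑ k, σ (star ((Tᴴ * V) k i)) j j' * U k i' := by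
  simp only [Matrix.mul_apply, Finset.mul_sum, star_sum, sum_apply', Finset.sum_mul]
  rw [Finset.sum_comm]
  refine Finset.sum_congr rfl fun k _ => Finset.sum_congr rfl fun l _ => ?_
  rw [star_mul, Matrix.conjTranspose_apply, star_star, (hT l k).mul_right, mul_assoc]

/-- Two transports differ by V U*, an arrow between objects spacelike to σ. Its entries are fixed by
σ and cancel across the exchange. -/
lemma IsObj.exchange_eq {ρ : Bimodule A I} {ρ₁ : Bimodule A K} {ρ₂ : Bimodule A L}
    {σ : Bimodule A J} (hρ : ρ.IsObj) {U : Matrix K I A.quasi} {V : Matrix L I A.quasi}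
    (hU : ρ.IsUnitaryArrow ρ₁ U) (hV : ρ.IsUnitaryArrow ρ₂ V) {o₁ o₂ a : DoubleCone}
    (h₁ : ρ₁.LocalizedIn o₁) (h₂ : ρ₂.LocalizedIn o₂) (hσ : σ.LocalizedIn a)
    (p₁ : o₁.Perp a) (p₂ : o₂.Perp a) : exchange σ U = exchange σ V := by
  have hT := hV.trans hU.symm
  have hf := (hρ.of_unitary hU ⟨_, h₁⟩).fixes_arrow hT.isIsometry.isArrow h₁ h₂ hσ p₁ p₂
  have e1 : V * Uᴴ * U = V := by
    rw [Matrix.mul_assoc, hU.isIsometry.star_mul_self, hV.isIsometry.isArrow.mul_one]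
  have e2 : (V * Uᴴ)ᴴ * V = U := by
    rw [Matrix.conjTranspose_mul, Matrix.conjTranspose_conjTranspose, Matrix.mul_assoc,
      hV.isIsometry.star_mul_self, hU.isIsometry.isArrow.mul_one]
  ext1 ⟨j, i⟩ ⟨i', j'⟩
  have := sum_fixes_mul σ (U := U) (V := V) hf i i' j j'
  rw [e1, e2] at this
  exact this.symm

/-- The symmetry `ε(ρ, σ)` for bimodules over arbitrary index types. -/
noncomputable def braid (ρ : Bimodule A I) (σ : Bimodule A J) : Matrix (J × I) (I × J) A.quasi :=
  Classical.epsilon fun E => ∃ (m : ℕ) (ρ' : Bimodule A (Fin m)) (U : Matrix (Fin m) I A.quasi)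
    (o a : DoubleCone), ρ.IsUnitaryArrow ρ' U ∧ ρ'.LocalizedIn o ∧ σ.LocalizedIn a ∧ o.Perp a ∧
      E = exchange σ U

/-- The cone in which σ is regarded as localized may vary too; a transport to a cone spacelike to
both choices mediates. -/
lemma IsObj.braid_eq {ρ : Bimodule A I} {ρ' : Bimodule A K} {σ : Bimodule A J} (hρ : ρ.IsObj)
    {U : Matrix K I A.quasi} (hU : ρ.IsUnitaryArrow ρ' U) {o a : DoubleCone}
    (h : ρ'.LocalizedIn o) (hσ : σ.LocalizedIn a) (p : o.Perp a) : braid ρ σ = exchange σ U := by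
  have hex : ∃ E, ∃ (m : ℕ) (ρ' : Bimodule A (Fin m)) (U : Matrix (Fin m) I A.quasi)
      (o a : DoubleCone), ρ.IsUnitaryArrow ρ' U ∧ ρ'.LocalizedIn o ∧ σ.LocalizedIn a ∧ o.Perp a ∧
      E = exchange σ U := by
    obtain ⟨m, τ, W, hτ, hW⟩ := hρ.transportable o
    exact ⟨_, m, τ, W, o, a, hW, hτ, hσ, p, rfl⟩
  obtain ⟨m, τ, W, o', a', hW, hτ, hσ', p', h'⟩ := Classical.epsilon_spec hex
  change braid ρ σ = _ at h'
  rw [h']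
  obtain ⟨b, hb1, hb2⟩ := DoubleCone.exists_perp_pair a a'
  obtain ⟨m', τ', W', hτ', hW'⟩ := hρ.transportable b
  exact (hρ.exchange_eq hW hW' hτ hτ' hσ' p' hb2).trans
    (hρ.exchange_eq hW' hU hτ' h hσ hb1 p)

lemma fixes_of_localized {ρ : Bimodule A K} {o c : DoubleCone} (hρ : ρ.LocalizedIn o)
    (p : o.Perp c) {X : A.quasi} (hX : (X : H →L[ℂ] H) ∈ A.alg c) : ρ.Fixes X :=
  hρ.fixes p.symm hX

/-- Moving an element fixed by the target of an arrow through the arrow. -/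
lemma IsArrow.entry_fixes {ρ : Bimodule A I} {ρ' : Bimodule A J} {T : Matrix J I A.quasi}
    (h : ρ.IsArrow ρ' T) {X : A.quasi} (hX : ρ'.Fixes X) (j : J) (i : I) :
    ∑ l, T j l * ρ X l i = X * T j i := by
  rw [h.entry]
  conv_rhs => rw [← h.one_mul, Matrix.mul_apply, Finset.mul_sum]
  exact Finset.sum_congr rfl fun l _ => by rw [(hX j l).1, mul_assoc]

/-- Naturality of the symmetry in the second argument. -/
lemma IsObj.braid_natural_right {ρ : Bimodule A I} {σ : Bimodule A J} {σ' : Bimodule A J'}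
    (hρ : ρ.IsObj) (hσ : σ.IsObj) (hσ' : σ'.IsObj) {S : Matrix J' J A.quasi}
    (hS : σ.IsArrow σ' S) (j : J') (i i' : I) (j' : J) :
    ∑ l, S j l * braid ρ σ (l, i) (i', j') = (braid ρ σ' * lt ρ S) (j, i) (i', j') := by
  obtain ⟨a, ha⟩ := hσ.localized
  obtain ⟨a', ha'⟩ := hσ'.localized
  obtain ⟨c, hac, hac'⟩ := DoubleCone.exists_sup a a'
  obtain ⟨o, ho⟩ := DoubleCone.exists_perp_to c
  obtain ⟨m, ρ', U, hρ', hU⟩ := hρ.transportable o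
  -- ρ' sits spacelike to a cone containing both σ and σ', hence spacelike to the entries of S.
  have hf : ∀ l l', ρ'.Fixes (S l l') := fun l l' =>
    fixes_of_localized hρ' ho (hS.entry_mem ha ha' hac hac' l l')
  rw [hρ.braid_eq hU hρ' (ha.mono hac) ho, hρ.braid_eq hU hρ' (ha'.mono hac') ho,
    Matrix.mul_apply]
  simp only [exchange_apply, lt_apply, Fintype.sum_prod_type, Finset.mul_sum, Finset.sum_mul,
    mul_assoc]
  have e1 : ∀ k l, ∑ p, σ' (star (U k i)) j l * (U k p * ρ (S l j') p i') =
      σ' (star (U k i)) j l * S l j' * U k i' := by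
    intro k l
    rw [← Finset.mul_sum, hU.isIsometry.isArrow.entry_fixes (hf l j'), mul_assoc]
  have e2 : ∀ k, ∑ l, S j l * (σ (star (U k i)) l j' * U k i') =
      ∑ l, σ' (star (U k i)) j l * S l j' * U k i' := by
    intro k
    simp only [← mul_assoc]
    rw [← Finset.sum_mul, ← Finset.sum_mul, hS.entry]
  rw [Finset.sum_comm]
  simp only [e2]
  conv_rhs => rw [Finset.sum_comm]; enter [2, l]; rw [Finset.sum_comm]
  simp only [e1]
  rw [Finset.sum_comm]

/-- Naturality of the symmetry in the first argument. -/
lemma IsObj.braid_natural_left {ρ : Bimodule A I} {ρ' : Bimodule A I'} {σ : Bimodule A J}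
    (hρ : ρ.IsObj) (hρ' : ρ'.IsObj) (hσ : σ.IsObj) {T : Matrix I' I A.quasi}
    (hT : ρ.IsArrow ρ' T) (j : J) (i : I') (i' : I) (j' : J) :
    (lt σ T * braid ρ σ) (j, i) (i', j') = ∑ l, braid ρ' σ (j, i) (l, j') * T l i' := by
  obtain ⟨a, ha⟩ := hσ.localized
  obtain ⟨o, ho⟩ := DoubleCone.exists_perp_to a
  obtain ⟨m, ρ₁, U, hρ₁, hU⟩ := hρ.transportable o
  obtain ⟨n, ρ₂, V, hρ₂, hV⟩ := hρ'.transportable o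
  have hA := (hV.isIsometry.isArrow.comp hT).comp hU.symm.isIsometry.isArrow
  -- Between the transported objects T becomes local in o, spacelike to σ, and passes through the
  -- exchange.
  have hf : ∀ l k, σ.Fixes ((V * T * Uᴴ) l k) := fun l k =>
    ha.fixes ho (hA.entry_mem hρ₁ hρ₂ (DoubleCone.Sub.refl _) (DoubleCone.Sub.refl _) l k)
  rw [hρ.braid_eq hU hρ₁ ha ho, hρ'.braid_eq hV hρ₂ ha ho, Matrix.mul_apply]
  have h1 := sum_fixes_mul σ (U := U) (V := V) hf i i' j j'
  have e1 : V * T * Uᴴ * U = V * T := by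
    rw [Matrix.mul_assoc, hU.isIsometry.star_mul_self, Matrix.mul_assoc, hT.mul_one]
  have e2 : (V * T * Uᴴ)ᴴ * V = U * Tᴴ := by
    rw [Matrix.conjTranspose_mul, Matrix.conjTranspose_mul, Matrix.conjTranspose_conjTranspose,
      Matrix.mul_assoc, Matrix.mul_assoc, hV.isIsometry.star_mul_self,
      hT.conjTranspose.mul_one]
  rw [e1, e2] at h1
  simp only [exchange_apply, lt_apply, Fintype.sum_prod_type, Finset.mul_sum, Finset.sum_mul]
  calc ∑ x, ∑ y, ∑ k, σ (T i y) j x * (σ (star (U k y)) x j' * U k i')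
      = ∑ k, σ (star ((U * Tᴴ) k i)) j j' * U k i' := by
        simp only [Matrix.mul_apply, star_sum, sum_apply', star_mul, Matrix.conjTranspose_apply,
          star_star, mul_apply', Finset.sum_mul, mul_assoc]
        conv_lhs => enter [2, x]; rw [Finset.sum_comm]
        rw [Finset.sum_comm]
        refine Finset.sum_congr rfl fun k _ => ?_
        rw [Finset.sum_comm]
    _ = _ := by
        rw [← h1]
        simp only [Matrix.mul_apply, Finset.mul_sum, mul_assoc]
        rw [Finset.sum_comm]

/-- After transporting ρ, the intertwining property is the equality ρ'σ = σρ' of spacelike objects,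
conjugated with U. -/
lemma IsObj.braid_isArrow {ρ : Bimodule A I} {σ : Bimodule A J} (hρ : ρ.IsObj) (hσ : σ.IsObj) :
    (ρ.tensor σ).IsArrow (σ.tensor ρ) (braid ρ σ) := by
  obtain ⟨a, ha⟩ := hσ.localized
  obtain ⟨o, ho⟩ := DoubleCone.exists_perp_to a
  obtain ⟨m, ρ', U, hρ', hlρ', hU⟩ := hρ.exists_transport o
  have hc := hρ'.commute hσ hlρ' ha ho
  rw [hρ.braid_eq hU hlρ' ha ho]
  have key : ∀ X, exchange σ U * (ρ.tensor σ) X = (σ.tensor ρ) X * exchange σ U := by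
    intro X
    ext1 ⟨j, i⟩ ⟨i', j'⟩
    simp only [Matrix.mul_apply, exchange_apply, Fintype.sum_prod_type, Finset.mul_sum,
      Finset.sum_mul, tensor_eq_lt, lt_apply, mul_assoc]
    calc ∑ p, ∑ l, ∑ k, σ (star (U k i)) j l * (U k p * ρ (σ X l j') p i')
        = ∑ k, ∑ l, σ (star (U k i)) j l * ∑ p, U k p * ρ (σ X l j') p i' := by
          simp only [Finset.mul_sum]
          rw [Finset.sum_comm]
          conv_lhs => enter [2, l]; rw [Finset.sum_comm]
          rw [Finset.sum_comm]
      _ = ∑ k, ∑ l, σ (star (U k i)) j l * ∑ p, σ (ρ' X k p) l j' * U p i' := by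
          simp only [hU.isIsometry.isArrow.entry, hc]
      _ = ∑ p, σ (∑ k, star (U k i) * ρ' X k p) j j' * U p i' := by
          simp only [sum_apply', mul_apply', Finset.mul_sum, Finset.sum_mul, mul_assoc]
          conv_lhs => enter [2, k]; rw [Finset.sum_comm]
          rw [Finset.sum_comm]
      _ = ∑ p, σ (∑ s, ρ X i s * star (U p s)) j j' * U p i' := by
          refine Finset.sum_congr rfl fun p _ => ?_
          have := hU.symm.isIsometry.isArrow.entry X i p
          simp only [Matrix.conjTranspose_apply] at this
          rw [this]
      _ = ∑ l, ∑ s, ∑ p, σ (ρ X i s) j l * (σ (star (U p s)) l j' * U p i') := by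
          simp only [sum_apply', mul_apply', Finset.sum_mul, mul_assoc]
          rw [Finset.sum_comm]
          conv_lhs => enter [2, s]; rw [Finset.sum_comm]
          rw [Finset.sum_comm]
  refine ⟨?_, ?_, key⟩
  · ext1 ⟨j, i⟩ ⟨i', j'⟩
    have hf : ∀ l l', ρ'.Fixes (σ 1 l l') := fun l l' =>
      fixes_of_localized hlρ' ho (ha.one_mem l l')
    simp only [Matrix.mul_apply, exchange_apply, Fintype.sum_prod_type, Finset.sum_mul,
      tensor_eq_lt, lt_apply, mul_assoc]
    rw [Finset.sum_comm]
    conv_lhs => enter [2, l]; rw [Finset.sum_comm]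
    simp only [← Finset.mul_sum, hU.isIsometry.isArrow.entry_fixes (hf _ j')]
    rw [Finset.sum_comm]
    refine Finset.sum_congr rfl fun k _ => ?_
    simp only [← mul_assoc, ← Finset.sum_mul]
    rw [← mul_apply', mul_one]
  · rw [← key]
    ext1 ⟨j, i⟩ ⟨i', j'⟩
    have hf : ∀ l l', ρ'.Fixes (σ 1 l l') := fun l l' =>
      fixes_of_localized hlρ' ho (ha.one_mem l l')
    simp only [Matrix.mul_apply, exchange_apply, Fintype.sum_prod_type, Finset.sum_mul,
      tensor_eq_lt, lt_apply, mul_assoc]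
    rw [Finset.sum_comm]
    conv_lhs => enter [2, l]; rw [Finset.sum_comm]
    simp only [← Finset.mul_sum, hU.isIsometry.isArrow.entry_fixes (hf _ j')]
    rw [Finset.sum_comm]
    refine Finset.sum_congr rfl fun k _ => ?_
    simp only [← mul_assoc, ← Finset.sum_mul]
    rw [← mul_apply', mul_one]

end Bimodule

end Tensor

end Sectors

namespace Sectors

/-! ### The symmetry: adjoints, unitarity, tensor products and Yang–Baxter -/

section Braid

variable {H : Type*} [NormedAddCommGroup H] [InnerProductSpace ℂ H] [CompleteSpace H]
  {A : LocalNet H} {I J K L I' J' K' : Type} [Fintype I] [Fintype J] [Fintype K] [Fintype L]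
  [Fintype I'] [Fintype J'] [Fintype K']

section Sums

variable {M α β γ δ ε : Type*} [AddCommMonoid M] [Fintype α] [Fintype β] [Fintype γ] [Fintype δ]
  [Fintype ε]

lemma sum_rotate₃ (f : α → β → γ → M) : ∑ a, ∑ b, ∑ c, f a b c = ∑ c, ∑ a, ∑ b, f a b c := by
  conv_lhs => enter [2, a]; rw [Finset.sum_comm]
  rw [Finset.sum_comm]

lemma sum_rotate₄ (f : α → β → γ → δ → M) :
    ∑ a, ∑ b, ∑ c, ∑ d, f a b c d = ∑ d, ∑ a, ∑ b, ∑ c, f a b c d := by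
  conv_lhs => enter [2, a]; rw [sum_rotate₃]
  rw [Finset.sum_comm]

lemma sum_rotate₅ (f : α → β → γ → δ → ε → M) :
    ∑ a, ∑ b, ∑ c, ∑ d, ∑ e, f a b c d e = ∑ e, ∑ a, ∑ b, ∑ c, ∑ d, f a b c d e := by
  conv_lhs => enter [2, a]; rw [sum_rotate₄]
  rw [Finset.sum_comm]

end Sums

namespace Bimodule

lemma IsUnitaryArrow.apply_of_fixes {ρ : Bimodule A I} {ρ' : Bimodule A J}
    {U : Matrix J I A.quasi} (hU : ρ.IsUnitaryArrow ρ' U) {X : A.quasi} (hX : ρ'.Fixes X)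
    (i i' : I) : ρ X i i' = ∑ k, star (U k i) * X * U k i' := by
  have h1 : ρ X = Uᴴ * (U * ρ X) := by
    rw [← Matrix.mul_assoc, hU.isIsometry.star_mul_self, one_mul']
  rw [h1, Matrix.mul_apply]
  refine Finset.sum_congr rfl fun k _ => ?_
  rw [Matrix.conjTranspose_apply, mul_assoc, Matrix.mul_apply,
    hU.isIsometry.isArrow.entry_fixes hX]

/-- This is what makes the braiding a symmetry. ρ is moved from o to o' and σ from a to a', with a'
spacelike to o and o' spacelike to a and a'. Connectedness of the complements lets σ' fix U and ρ'
fix V, and both sides then expand into the same double sum. -/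
lemma IsObj.braid_conjTranspose {ρ : Bimodule A I} {σ : Bimodule A J} (hρ : ρ.IsObj)
    (hσ : σ.IsObj) : (braid ρ σ)ᴴ = braid σ ρ := by
  obtain ⟨o, ho⟩ := hρ.localized
  obtain ⟨a, ha⟩ := hσ.localized
  obtain ⟨a', ha'⟩ := DoubleCone.exists_perp_to o
  obtain ⟨c, hac, hac'⟩ := DoubleCone.exists_sup a a'
  obtain ⟨o', ho'⟩ := DoubleCone.exists_perp_to c
  have p1 : o'.Perp a := (ho'.symm.mono hac).symm
  have p2 : o'.Perp a' := (ho'.symm.mono hac').symm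
  obtain ⟨m, ρ', U, hρ', hU⟩ := hρ.transportable o'
  obtain ⟨n, σ', V, hσ', hV⟩ := hσ.transportable a'
  have f1 : ∀ k i, σ'.Fixes (U k i) :=
    hρ.fixes_arrow hU.isIsometry.isArrow ho hρ' hσ' ha'.symm p2
  have f2 : ∀ k j, ρ'.Fixes (V k j) :=
    hσ.fixes_arrow hV.isIsometry.isArrow ha hσ' hρ' p1.symm p2.symm
  rw [hρ.braid_eq hU hρ' ha p1, hσ.braid_eq hV hσ' ho ha']
  ext1 ⟨i, j⟩ ⟨j', i'⟩
  rw [Matrix.conjTranspose_apply, exchange_apply, exchange_apply, star_sum]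
  simp only [star_mul, ← star_apply', star_star, hV.apply_of_fixes (f1 _ _),
    hU.apply_of_fixes (f2 _ _).star, Finset.sum_mul, Finset.mul_sum]
  rw [Finset.sum_comm]
  simp only [mul_assoc]

lemma IsObj.braid_star_mul_self {ρ : Bimodule A I} {σ : Bimodule A J} (hρ : ρ.IsObj)
    (hσ : σ.IsObj) : (braid ρ σ)ᴴ * braid ρ σ = (ρ.tensor σ) 1 := by
  obtain ⟨a, ha⟩ := hσ.localized
  obtain ⟨o, ho⟩ := DoubleCone.exists_perp_to a
  obtain ⟨m, ρ', U, hρ', hU⟩ := hρ.transportable o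
  rw [hρ.braid_eq hU hρ' ha ho]
  have hf : ∀ k l, σ.Fixes (ρ' 1 k l) := fun k l => ha.fixes ho (hρ'.one_mem k l)
  have hf' : ∀ l l', ρ'.Fixes (σ 1 l l') := fun l l' =>
    fixes_of_localized hρ' ho (ha.one_mem l l')
  ext1 ⟨i, j⟩ ⟨i', j'⟩
  simp only [Matrix.mul_apply, Matrix.conjTranspose_apply, exchange_apply, Fintype.sum_prod_type,
    star_sum, star_mul, ← star_apply', star_star, Finset.sum_mul, Finset.mul_sum, tensor_eq_lt,
    lt_apply]
  calc ∑ b, ∑ c, ∑ l, ∑ k, star (U k i) * σ (U k c) j b * (σ (star (U l c)) b j' * U l i')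
      = ∑ l, ∑ k, star (U k i) * σ (∑ c, U k c * star (U l c)) j j' * U l i' := by
        simp only [sum_apply', mul_apply', Finset.mul_sum, Finset.sum_mul, mul_assoc]
        rw [Finset.sum_comm]
        conv_lhs => enter [2, c]; rw [Finset.sum_comm]; enter [2, l]; rw [Finset.sum_comm]
        rw [Finset.sum_comm]
        refine Finset.sum_congr rfl fun l _ => ?_
        rw [Finset.sum_comm]
    _ = ∑ l, (∑ k, star (U k i) * ρ' 1 k l) * σ 1 j j' * U l i' := by
        refine Finset.sum_congr rfl fun l _ => ?_
        rw [Finset.sum_mul, Finset.sum_mul]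
        refine Finset.sum_congr rfl fun k _ => ?_
        rw [← hU.mul_star_self, Matrix.mul_apply]
        have := (hf k l j j').1
        rw [← hU.mul_star_self, Matrix.mul_apply] at this
        simp only [Matrix.conjTranspose_apply] at this ⊢
        rw [this]
        simp only [mul_assoc]
    _ = ρ (σ 1 j j') i i' := by
        rw [hU.apply_of_fixes (hf' j j')]
        refine Finset.sum_congr rfl fun l _ => ?_
        have := congrFun (congrFun hU.symm.isIsometry.isArrow.mul_one i) l
        simp only [Matrix.mul_apply, Matrix.conjTranspose_apply] at this
        rw [this]

/-- The symmetry with a tensor product in the second argument. -/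
lemma IsObj.braid_tensor_right {ρ : Bimodule A I} {σ : Bimodule A J} {τ : Bimodule A K}
    (hρ : ρ.IsObj) (hσ : σ.IsObj) (hτ : τ.IsObj) (j j' : J) (l l' : K) (i i' : I) :
    braid ρ (σ.tensor τ) ((j, l), i) (i', (j', l')) =
      ∑ b, ∑ c, σ (braid ρ τ (l, i) (c, l')) j b * braid ρ σ (b, c) (i', j') := by
  obtain ⟨a, ha⟩ := hσ.localized
  obtain ⟨a', ha'⟩ := hτ.localized
  obtain ⟨d, had, had'⟩ := DoubleCone.exists_sup a a'
  -- One transporter U, spacelike to both σ and τ, computes all three symmetries. The inner product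
  -- U U* collapses to ρ'(1), which σ fixes.
  obtain ⟨o, ho⟩ := DoubleCone.exists_perp_to d
  obtain ⟨m, ρ', U, hρ', hU⟩ := hρ.transportable o
  have hf : ∀ k l, σ.Fixes (ρ' 1 k l) := fun k l => (ha.mono had).fixes ho (hρ'.one_mem k l)
  rw [hρ.braid_eq hU hρ' (ha.mono had) ho, hρ.braid_eq hU hρ' (ha'.mono had') ho,
    hρ.braid_eq hU hρ' ((ha.mono had).tensor (ha'.mono had')) ho]
  simp only [exchange_apply, tensor_eq_lt, lt_apply]
  symm
  calc ∑ b, ∑ c, σ (∑ k, τ (star (U k i)) l l' * U k c) j b *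
        ∑ p, σ (star (U p c)) b j' * U p i'
      = ∑ p, ∑ k, σ (τ (star (U k i)) l l' * ∑ c, U k c * star (U p c)) j j' * U p i' := by
        have e : ∀ p k, σ (τ (star (U k i)) l l' * ∑ c, U k c * star (U p c)) j j' =
            ∑ b, ∑ c, σ (τ (star (U k i)) l l' * U k c) j b * σ (star (U p c)) b j' := by
          intro p k
          rw [Finset.mul_sum, sum_apply', Finset.sum_comm]
          exact Finset.sum_congr rfl fun c _ => by rw [← mul_assoc, mul_apply']
        simp_rw [e]
        simp only [sum_apply', Finset.mul_sum, Finset.sum_mul, mul_assoc]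
        exact (sum_rotate₄ _).trans (sum_rotate₄ _)
    _ = ∑ p, (∑ k, σ (τ (star (U k i)) l l') j j' * ρ' 1 k p) * U p i' := by
        refine Finset.sum_congr rfl fun p _ => ?_
        rw [Finset.sum_mul]
        refine Finset.sum_congr rfl fun k _ => ?_
        rw [← (hf k p).mul_right, ← hU.mul_star_self, Matrix.mul_apply]
        simp only [Matrix.conjTranspose_apply]
    _ = ∑ k, σ (τ (star (U k i)) l l') j j' * ∑ p, ρ' 1 k p * U p i' := by
        simp only [Finset.mul_sum, Finset.sum_mul, mul_assoc]
        rw [Finset.sum_comm]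
    _ = _ := by
        simp only [← Matrix.mul_apply, hU.isIsometry.isArrow.one_mul]

/-- The operator `ε(ρ, ρ) × 1_ρ` on `ρ³`. -/
noncomputable def braidLeft (ρ : Bimodule A I) : Matrix (I × (I × I)) (I × (I × I)) A.quasi :=
  Matrix.reindex (Equiv.prodAssoc I I I) (Equiv.prodAssoc I I I)
    (tensorArrow (ρ.tensor ρ) (braid ρ ρ) (ρ 1))

lemma braidLeft_apply (ρ : Bimodule A I) (i j k i' j' k' : I) :
    braidLeft ρ (i, (j, k)) (i', (j', k')) =
      ∑ q, braid ρ ρ (i, j) q * (ρ.tensor ρ) (ρ 1 k k') q (i', j') := rfl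

/-- By the tensor formula (1 × ε)(ε × 1) is ε(ρ, ρρ). Naturality of the latter in its second
argument, for the arrow ε(ρ, ρ), is the claim. -/
lemma IsObj.yang_baxter {ρ : Bimodule A I} (hρ : ρ.IsObj) :
    braidLeft ρ * lt ρ (braid ρ ρ) * braidLeft ρ =
      lt ρ (braid ρ ρ) * braidLeft ρ * lt ρ (braid ρ ρ) := by
  have hb := hρ.braid_isArrow hρ
  have h1 : ∀ j l i i' j' l', (lt ρ (braid ρ ρ) * braidLeft ρ) (j, (l, i)) (i', (j', l')) =
      braid ρ (ρ.tensor ρ) ((j, l), i) (i', (j', l')) := by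
    intro j l i i' j' l'
    rw [hρ.braid_tensor_right hρ hρ, Matrix.mul_apply]
    have h3 : ∀ x y z, braidLeft ρ (x, (y, z)) (i', (j', l')) =
        ∑ b, ∑ c, ρ (ρ (ρ 1 z l') y c) x b * braid ρ ρ (b, c) (i', j') := by
      intro x y z
      rw [braidLeft_apply, hb.entry, Fintype.sum_prod_type]
      rfl
    have h4 : ∀ b c, ∑ x, ∑ y, ∑ z, ρ (braid ρ ρ (l, i) (y, z)) j x * ρ (ρ (ρ 1 z l') y c) x b =
        ρ (braid ρ ρ (l, i) (c, l')) j b := by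
      intro b c
      have h5 := congrFun (congrFun hb.mul_one (l, i)) (c, l')
      rw [Matrix.mul_apply, Fintype.sum_prod_type] at h5
      rw [← h5]
      simp only [sum_apply', mul_apply']
      rw [Finset.sum_comm]
      refine Finset.sum_congr rfl fun y _ => ?_
      rw [Finset.sum_comm]
      rfl
    simp only [Fintype.sum_prod_type, lt_apply, h3]
    simp only [← h4, Finset.mul_sum, Finset.sum_mul, mul_assoc]
    exact (sum_rotate₅ _).trans (sum_rotate₅ _)
  ext1 ⟨j, l, i⟩ ⟨i', j', l'⟩
  have h2 := hρ.braid_natural_right (hρ.tensor hρ) (hρ.tensor hρ) hb (j, l) i i' (j', l')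
  rw [Matrix.mul_assoc, Matrix.mul_apply, Matrix.mul_apply]
  rw [Matrix.mul_apply] at h2
  have h3 : ∀ q, ∑ x, ∑ c, (ρ.tensor ρ) (ρ 1 i c) q x *
      braid ρ (ρ.tensor ρ) (x, c) (i', (j', l')) = braid ρ (ρ.tensor ρ) (q, i) (i', (j', l')) := by
    intro q
    have h5 := congrFun (congrFun (hρ.braid_isArrow (hρ.tensor hρ)).one_mul (q, i)) (i', (j', l'))
    rw [Matrix.mul_apply, Fintype.sum_prod_type] at h5
    exact h5
  simp only [← h3] at h2
  simp only [Fintype.sum_prod_type] at h2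
  simp only [Fintype.sum_prod_type, h1, braidLeft_apply]
  rw [← h2]
  simp only [Finset.mul_sum, Finset.sum_mul, mul_assoc]
  exact (sum_rotate₅ _).trans (sum_rotate₅ _)

lemma IsObj.braid_absorb {ρ : Bimodule A I} {σ : Bimodule A J} (hρ : ρ.IsObj) (hσ : σ.IsObj)
    (j : J) (i : I) (q : I × J) : ∑ l, σ 1 j l * braid ρ σ (l, i) q = braid ρ σ (j, i) q := by
  have h := congrFun (congrFun (hρ.braid_isArrow hσ).one_mul (j, i)) q
  have h' := fun l => congrFun (congrFun (hρ.braid_isArrow hσ).one_mul (l, i)) q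
  simp only [Matrix.mul_apply, Fintype.sum_prod_type, tensor_eq_lt, lt_apply] at h h'
  rw [← h]
  conv_lhs => enter [2, l]; rw [← h']
  simp only [Finset.mul_sum, ← mul_assoc]
  rw [Finset.sum_comm]
  refine Finset.sum_congr rfl fun x _ => ?_
  rw [Finset.sum_comm]
  refine Finset.sum_congr rfl fun y _ => ?_
  rw [← Finset.sum_mul, ← mul_apply', one_mul]

end Bimodule

/-! ### The symmetry of objects as the braiding of bimodules -/

open Bimodule

lemma Obj.isObj {n : ℕ} (ρ : Obj A n) : ρ.bim.IsObj := by
  obtain ⟨o, ho⟩ := ρ.localized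
  refine ⟨⟨o, (toMorphism_localizedIn _ _).1 ho⟩, fun a => ?_⟩
  obtain ⟨m, τ, U, hτ, hU⟩ := ρ.exists_transport a
  exact ⟨m, τ.bim, U, (toMorphism_localizedIn _ _).1 hτ, hU⟩

lemma Obj.localizedIn_iff {n : ℕ} (ρ : Obj A n) (o : DoubleCone) :
    ρ.LocalizedIn o ↔ ρ.bim.LocalizedIn o := toMorphism_localizedIn _ _

/-- Naturality in the second argument absorbs the transport V of σ, leaving an exchange in which
only ρ is transported. So the symmetry does not depend on the choices. -/
lemma IsExchange.eq_braid {n m : ℕ} {ρ : Obj A n} {σ : Obj A m}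
    {E : Matrix (Fin m × Fin n) (Fin n × Fin m) A.quasi} (h : IsExchange ρ σ E) :
    E = braid ρ.bim σ.bim := by
  obtain ⟨o, a, n₁, m₁, ρ₁, σ₁, U, V, hoa, hρ₁, hσ₁, hU, hV, rfl⟩ := h
  rw [Obj.localizedIn_iff] at hρ₁ hσ₁
  ext1 ⟨j, i⟩ ⟨i', j'⟩
  have h1 := fun j i => ρ.isObj.braid_natural_right σ.isObj σ₁.isObj hV.isIsometry.isArrow j i i' j'
  have h2 : braid ρ.bim σ.bim (j, i) (i', j') = ∑ b, star (V b j) *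
      ∑ l, V b l * braid ρ.bim σ.bim (l, i) (i', j') := by
    rw [← ρ.isObj.braid_absorb σ.isObj, ← hV.isIsometry.star_mul_self]
    simp only [Matrix.mul_apply, Matrix.conjTranspose_apply, Finset.mul_sum, Finset.sum_mul,
      mul_assoc]
    rw [Finset.sum_comm]
  rw [h2]
  simp only [h1]
  rw [ρ.isObj.braid_eq hU hρ₁ hσ₁ hoa]
  simp only [Matrix.mul_apply, tensorArrow_apply, flip, Matrix.of_apply, Fintype.sum_prod_type,
    exchange_apply, lt_apply]
  have hflip : ∀ (F : Fin n₁ → Fin m₁ → A.quasi) (b : Fin n₁) (c : Fin m₁),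
      ∑ x, ∑ y, F y x * (if x = c ∧ y = b then 1 else 0) = F b c := by
    intro F b c
    simp [ite_and]
  simp only [fun (x : Fin n₁) (y : Fin m₁) => hflip
    (fun b c => ∑ v, Vᴴ j v * σ₁.bim (Uᴴ i b) v c) x y]
  simp only [Matrix.conjTranspose_apply, Finset.mul_sum, Finset.sum_mul, mul_assoc]
  refine (sum_rotate₄ _).trans (Finset.sum_congr rfl fun v _ => ?_)
  refine (sum_rotate₃ _).trans (Finset.sum_congr rfl fun w _ => ?_)
  exact Finset.sum_comm

lemma symmetry_eq_braid {n m : ℕ} (ρ : Obj A n) (σ : Obj A m) :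
    symmetry ρ σ = braid ρ.bim σ.bim :=
  (exists_isExchange ρ σ).choose_spec.eq_braid

end Braid

end Sectors

namespace Sectors

/-! ### Representations of the permutation groups in a tower of algebras -/

open Equiv in
/-- The permutation `1 ⊕ p`. -/
def liftPerm {n : ℕ} (p : Perm (Fin n)) : Perm (Fin (n + 1)) := Perm.decomposeFin.symm (0, p)

section liftPerm

open Equiv

variable {n : ℕ}

lemma liftPerm_zero (p : Perm (Fin n)) : liftPerm p 0 = 0 :=
  Perm.decomposeFin_symm_apply_zero _ _

lemma liftPerm_succ (p : Perm (Fin n)) (j : Fin n) : liftPerm p j.succ = (p j).succ := by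
  rw [liftPerm, Perm.decomposeFin_symm_apply_succ, swap_self, refl_apply]

lemma liftPerm_mul (p q : Perm (Fin n)) : liftPerm (p * q) = liftPerm p * liftPerm q := by
  ext1 x
  refine Fin.cases ?_ (fun j => ?_) x
  · simp [liftPerm_zero]
  · simp [liftPerm_succ]

lemma liftPerm_one : liftPerm (1 : Perm (Fin n)) = 1 := by
  ext1 x
  refine Fin.cases ?_ (fun j => ?_) x
  · simp [liftPerm_zero]
  · simp [liftPerm_succ]

lemma liftPerm_swap (a b : Fin n) : liftPerm (swap a b) = swap a.succ b.succ := by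
  ext1 x
  refine Fin.cases ?_ (fun j => ?_) x
  · rw [liftPerm_zero, swap_apply_of_ne_of_ne (Fin.succ_ne_zero _).symm (Fin.succ_ne_zero _).symm]
  · rw [liftPerm_succ, (Fin.succ_injective n).swap_apply]

lemma decomposeFin_symm_eq (k : Fin (n + 1)) (p : Perm (Fin n)) :
    Perm.decomposeFin.symm (k, p) = swap 0 k * liftPerm p := by
  ext1 x
  refine Fin.cases ?_ (fun j => ?_) x
  · rw [Perm.decomposeFin_symm_apply_zero, Perm.mul_apply, liftPerm_zero, swap_apply_left]
  · rw [Perm.decomposeFin_symm_apply_succ, Perm.mul_apply, liftPerm_succ]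

lemma exists_eq_swap_mul_liftPerm (p : Perm (Fin (n + 1))) :
    ∃ k q, p = swap 0 k * liftPerm q :=
  ⟨_, _, by rw [← decomposeFin_symm_eq, Prod.mk.eta, symm_apply_apply]⟩

lemma sign_liftPerm (p : Perm (Fin n)) : Perm.sign (liftPerm p) = Perm.sign p := by
  rw [liftPerm, Perm.decomposeFin.symm_sign]; simp

end liftPerm

/-- A tower of corners of `*`-algebras with embeddings `L` and self-adjoint symmetries `s`
satisfying the braid relations. -/
structure PermTower (B : ℕ → Type*) [∀ n, Ring (B n)] [∀ n, StarRing (B n)]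
    [∀ n, Algebra ℂ (B n)] where
  e : ∀ n, B n
  L : ∀ n, B n →ₗ[ℂ] B (n + 1)
  s : ∀ n, B (n + 2)
  L_mul : ∀ n x y, L n (x * y) = L n x * L n y
  L_star : ∀ n x, L n (star x) = star (L n x)
  L_e : ∀ n, L n (e n) = e (n + 1)
  e_mul_e : ∀ n, e n * e n = e n
  star_e : ∀ n, star (e n) = e n
  e_mul_s : ∀ n, e (n + 2) * s n = s n
  s_mul_s : ∀ n, s n * s n = e (n + 2)
  star_s : ∀ n, star (s n) = s n
  s_comm : ∀ n x, e n * x = x → x * e n = x →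
    s n * L (n + 1) (L n x) = L (n + 1) (L n x) * s n
  braid : ∀ n, s (n + 1) * L (n + 2) (s n) * s (n + 1) =
    L (n + 2) (s n) * s (n + 1) * L (n + 2) (s n)

namespace PermTower

open Equiv

variable {B : ℕ → Type*} [∀ n, Ring (B n)] [∀ n, StarRing (B n)] [∀ n, Algebra ℂ (B n)]
  (T : PermTower B)

lemma s_mul_e (n : ℕ) : T.s n * T.e (n + 2) = T.s n := by
  have := congrArg star (T.e_mul_s n)
  rwa [star_mul, T.star_s, T.star_e] at this

/-- The image of the transposition of `0` and `k`. -/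
def t : ∀ n, Fin (n + 1) → B (n + 1)
  | 0, _ => T.e 1
  | n + 1, k => Fin.cases (T.e (n + 2))
      -- The transposition (0 j+1) is the conjugate of (0 1) by (1 j+1), the shift of (0 j). For j =
      -- 0 the conjugating factor is the unit e.
      (fun j => T.L (n + 1) (t n j) * T.s n * T.L (n + 1) (t n j)) k

/-- The representation of the permutation group. -/
def u : ∀ n, Perm (Fin n) → B n
  | 0, _ => T.e 0
  -- Every permutation is uniquely (0 k)(1 ⊕ q).
  | n + 1, p => T.t n (Perm.decomposeFin p).1 * T.L n (u n (Perm.decomposeFin p).2)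

lemma t_zero (n : ℕ) : T.t n 0 = T.e (n + 1) := by cases n <;> rfl

lemma t_succ (n : ℕ) (j : Fin (n + 1)) :
    T.t (n + 1) j.succ = T.L (n + 1) (T.t n j) * T.s n * T.L (n + 1) (T.t n j) := rfl

lemma u_swap_mul_lift (n : ℕ) (k : Fin (n + 1)) (p : Perm (Fin n)) :
    T.u (n + 1) (swap 0 k * liftPerm p) = T.t n k * T.L n (T.u n p) := by
  rw [← decomposeFin_symm_eq, u, apply_symm_apply]

lemma t_props (n : ℕ) (k : Fin (n + 1)) : T.e (n + 1) * T.t n k = T.t n k ∧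
    T.t n k * T.e (n + 1) = T.t n k ∧ T.t n k * T.t n k = T.e (n + 1) ∧
    star (T.t n k) = T.t n k := by
  induction n with
  | zero => exact ⟨T.e_mul_e 1, T.e_mul_e 1, T.e_mul_e 1, T.star_e 1⟩
  | succ n ih =>
    refine Fin.cases ?_ (fun j => ?_) k
    · rw [t_zero]; exact ⟨T.e_mul_e _, T.e_mul_e _, T.e_mul_e _, T.star_e _⟩
    · obtain ⟨h1, h2, h3, h4⟩ := ih j
      rw [t_succ]
      refine ⟨?_, ?_, ?_, ?_⟩
      · rw [← mul_assoc, ← mul_assoc, ← T.L_e, ← T.L_mul, h1]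
      · rw [mul_assoc, ← T.L_e, ← T.L_mul, h2]
      · have : T.L (n + 1) (T.t n j) * T.s n * T.L (n + 1) (T.t n j) *
            (T.L (n + 1) (T.t n j) * T.s n * T.L (n + 1) (T.t n j)) =
            T.L (n + 1) (T.t n j) * (T.s n * T.L (n + 1) (T.t n j * T.t n j) * T.s n) *
              T.L (n + 1) (T.t n j) := by
          rw [T.L_mul]; simp only [mul_assoc]
        rw [this, h3, T.L_e, T.s_mul_e, T.s_mul_s, ← T.L_e, ← T.L_mul, ← T.L_mul, h2, h3]
      · rw [star_mul, star_mul, T.star_s, ← T.L_star, h4, mul_assoc]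

lemma u_props (n : ℕ) (p : Perm (Fin n)) : T.e n * T.u n p = T.u n p ∧
    T.u n p * T.e n = T.u n p := by
  induction n with
  | zero => exact ⟨T.e_mul_e 0, T.e_mul_e 0⟩
  | succ n ih =>
    obtain ⟨k, q, rfl⟩ := exists_eq_swap_mul_liftPerm p
    rw [u_swap_mul_lift]
    refine ⟨by rw [← mul_assoc, (T.t_props n k).1], ?_⟩
    rw [mul_assoc, ← T.L_e, ← T.L_mul, (ih q).2]

lemma u_one (n : ℕ) : T.u n 1 = T.e n := by
  induction n with
  | zero => rfl
  | succ n ih =>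
    have := T.u_swap_mul_lift n 0 1
    rw [swap_self, liftPerm_one] at this
    refine Eq.trans (congrArg _ ?_) (this.trans ?_)
    · exact (mul_one _).symm
    · rw [ih, T.L_e, t_zero, T.e_mul_e]

lemma u_lift (n : ℕ) (p : Perm (Fin n)) : T.u (n + 1) (liftPerm p) = T.L n (T.u n p) := by
  have := T.u_swap_mul_lift n 0 p
  rw [swap_self] at this
  refine Eq.trans (congrArg _ ?_) (this.trans ?_)
  · exact (one_mul _).symm
  · rw [t_zero, ← T.L_e, ← T.L_mul, (T.u_props n p).1]

lemma u_swap (n : ℕ) (k : Fin (n + 1)) : T.u (n + 1) (swap 0 k) = T.t n k := by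
  have := T.u_swap_mul_lift n k 1
  rwa [liftPerm_one, mul_one, u_one, T.L_e, (T.t_props n k).2.1] at this

lemma t_one (n : ℕ) : T.t (n + 1) 1 = T.s n := by
  rw [← Fin.succ_zero_eq_one, t_succ, t_zero, T.L_e, T.e_mul_s, T.s_mul_e]

lemma exists_perm {n : ℕ} {a b : Fin (n + 2)} (h : a ≠ b) :
    ∃ p : Perm (Fin (n + 2)), p 0 = a ∧ p 1 = b := by
  refine ⟨swap 0 a * swap 1 (swap 0 a b), ?_, ?_⟩
  · have : swap 0 a b ≠ 0 := by
      intro h'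
      apply h
      have := congrArg (swap 0 a) h'
      rwa [swap_apply_self, swap_apply_left, eq_comm] at this
    rw [Perm.mul_apply, swap_apply_of_ne_of_ne (by simp) this.symm, swap_apply_left]
  · rw [Perm.mul_apply, swap_apply_left, swap_apply_self]

/-- `u` is multiplicative. -/
lemma u_mul (n : ℕ) (p q : Perm (Fin n)) : T.u n (p * q) = T.u n p * T.u n q := by
  induction n with
  | zero => exact (T.e_mul_e 0).symm
  | succ n ih =>
    -- Conjugation by 1 ⊕ p permutes the elements t_k. By induction this reduces to a factor 1 ⊕ 1 ⊕
    -- q, which commutes with s.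
    have b1 : ∀ (p : Perm (Fin n)) (k : Fin (n + 1)),
        T.L n (T.u n p) * T.t n k = T.t n (liftPerm p k) * T.L n (T.u n p) := by
      intro p k
      refine Fin.cases ?_ (fun j => ?_) k
      · rw [liftPerm_zero, t_zero, ← T.L_e, ← T.L_mul, ← T.L_mul, (T.u_props n p).1,
          (T.u_props n p).2]
      · rw [liftPerm_succ]
        cases n with
        | zero => exact j.elim0
        | succ m =>
          -- This product fixes 0, hence is of the form 1 ⊕ q.
          obtain ⟨k', q, hq⟩ := exists_eq_swap_mul_liftPerm (swap 0 (p j) * p * swap 0 j)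
          have hk' : k' = 0 := by
            have := congrArg (fun f : Perm (Fin (m + 1)) => f 0) hq
            simpa [liftPerm_zero] using this.symm
          rw [hk', swap_self] at hq
          replace hq : swap 0 (p j) * p * swap 0 j = liftPerm q := hq.trans (one_mul _)
          have hp : p * swap 0 j = swap 0 (p j) * liftPerm q := by
            rw [← hq, ← mul_assoc, ← mul_assoc, swap_mul_self, one_mul]
          have hp' : liftPerm q * swap 0 j = swap 0 (p j) * p := by
            rw [← hq, mul_assoc, swap_mul_self, mul_one]
          have hc := T.s_comm m (T.u m q) (T.u_props m q).1 (T.u_props m q).2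
          rw [t_succ, t_succ, ← T.u_swap, ← T.u_swap]
          calc _ = T.L (m + 1) (T.u (m + 1) p * T.u (m + 1) (swap 0 j)) * T.s m *
                  T.L (m + 1) (T.u (m + 1) (swap 0 j)) := by
                rw [T.L_mul]; simp only [mul_assoc]
            _ = T.L (m + 1) (T.u (m + 1) (swap 0 (p j))) * (T.L (m + 1) (T.u (m + 1) (liftPerm q)) *
                  T.s m) * T.L (m + 1) (T.u (m + 1) (swap 0 j)) := by
                rw [← ih, hp, ih, T.L_mul]; simp only [mul_assoc]
            _ = T.L (m + 1) (T.u (m + 1) (swap 0 (p j))) * T.s m *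
                  T.L (m + 1) (T.u (m + 1) (liftPerm q) * T.u (m + 1) (swap 0 j)) := by
                rw [u_lift, ← hc, T.L_mul]; simp only [mul_assoc]
            _ = _ := by
                rw [← ih, hp', ih, T.L_mul]; simp only [mul_assoc]
    -- Conjugating with a permutation that takes 0, 1 to the given points reduces distinct nonzero
    -- k, m to the first two of them, where the claim is the braid relation.
    have b2 : ∀ k m : Fin (n + 1), T.t n k * T.t n m = T.u (n + 1) (swap 0 k * swap 0 m) := by
      intro k m
      by_cases hkm : k = m
      · rw [hkm, swap_mul_self, u_one, (T.t_props n m).2.2.1]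
      by_cases hk : k = 0
      · rw [hk, swap_self, t_zero, (T.t_props n m).1, ← u_swap]
        exact congrArg _ (one_mul _).symm
      by_cases hm : m = 0
      · rw [hm, swap_self, t_zero, (T.t_props n k).2.1, ← u_swap]
        exact congrArg _ (mul_one _).symm
      obtain ⟨a, rfl⟩ := Fin.exists_succ_eq.2 hk
      obtain ⟨b, rfl⟩ := Fin.exists_succ_eq.2 hm
      have hab : a ≠ b := fun h => hkm (congrArg _ h)
      have hperm : swap 0 a.succ * swap 0 b.succ = swap 0 b.succ * liftPerm (swap b a) := by
        rw [liftPerm_swap, mul_swap_eq_swap_mul (swap 0 b.succ) b.succ a.succ, swap_apply_right,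
          swap_apply_of_ne_of_ne hk hkm]
      rw [hperm, u_swap_mul_lift]
      match n, a, b, hab, ih, b1 with
      | 1, a, b, hab, _, _ => exact absurd (Subsingleton.elim a b) hab
      | n + 2, a, b, hab, ih, b1 =>
        obtain ⟨p, rfl, rfl⟩ := exists_perm hab
        have e1 : T.t (n + 2) (Fin.succ 0) = T.s (n + 1) := T.t_one (n + 1)
        have e2 : T.t (n + 2) (Fin.succ 1) =
            T.L (n + 2) (T.s n) * T.s (n + 1) * T.L (n + 2) (T.s n) := by
          rw [t_succ, t_one]
        have e3 : T.s (n + 1) * T.L (n + 2) (T.e (n + 2)) = T.s (n + 1) := by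
          rw [T.L_e, T.s_mul_e]
        have base : T.t (n + 2) (Fin.succ 0) * T.t (n + 2) (Fin.succ 1) =
            T.t (n + 2) (Fin.succ 1) * T.L (n + 2) (T.u (n + 2) (swap 1 0)) := by
          rw [swap_comm, u_swap, t_one, e1, e2, ← mul_assoc, ← mul_assoc, T.braid, mul_assoc,
            ← T.L_mul, T.s_mul_s, mul_assoc, e3]
        have hinv : T.L (n + 2) (T.u (n + 2) p) * T.L (n + 2) (T.u (n + 2) p⁻¹) = T.e (n + 3) := by
          rw [← T.L_mul, ← ih, mul_inv_cancel, u_one, T.L_e]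
        have h1 : T.t (n + 2) (p 0).succ * T.t (n + 2) (p 1).succ * T.L (n + 2) (T.u (n + 2) p) =
            T.t (n + 2) (p 1).succ * T.L (n + 2) (T.u (n + 2) (swap (p 1) (p 0))) *
              T.L (n + 2) (T.u (n + 2) p) := by
          rw [mul_assoc, ← liftPerm_succ p 1, ← b1, ← mul_assoc, ← liftPerm_succ p 0, ← b1,
            mul_assoc, base, ← mul_assoc, b1, mul_assoc, ← T.L_mul, ← ih, mul_swap_eq_swap_mul,
            ih, T.L_mul, mul_assoc]
        have h2 := congrArg (· * T.L (n + 2) (T.u (n + 2) p⁻¹)) h1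
        simp only [mul_assoc, hinv] at h2
        rwa [(T.t_props _ _).2.1, ← T.L_e, ← T.L_mul, (T.u_props _ _).2] at h2
    -- Right multiplication by 1 ⊕ y needs only the induction hypothesis; the general product is
    -- then brought to this form by b1 and b2.
    have b3 : ∀ x y, T.u (n + 1) x * T.L n (T.u n y) = T.u (n + 1) (x * liftPerm y) := by
      intro x y
      obtain ⟨k, q, rfl⟩ := exists_eq_swap_mul_liftPerm x
      rw [mul_assoc, ← liftPerm_mul, u_swap_mul_lift, u_swap_mul_lift, ih, T.L_mul, mul_assoc]
    obtain ⟨k, p, rfl⟩ := exists_eq_swap_mul_liftPerm p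
    obtain ⟨l, q, rfl⟩ := exists_eq_swap_mul_liftPerm q
    have hperm : swap 0 k * liftPerm p * (swap 0 l * liftPerm q) =
        swap 0 k * swap 0 (liftPerm p l) * liftPerm (p * q) := by
      have := mul_swap_eq_swap_mul (liftPerm p) 0 l
      rw [liftPerm_zero] at this
      rw [liftPerm_mul, mul_assoc, ← mul_assoc (liftPerm p), this]
      simp only [mul_assoc]
    rw [hperm, ← b3, ← b2, ih, u_swap_mul_lift, u_swap_mul_lift, T.L_mul, mul_assoc, mul_assoc,
      ← mul_assoc (T.L n _) (T.t n l), b1]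
    simp only [mul_assoc]

lemma star_u (n : ℕ) (p : Perm (Fin n)) : star (T.u n p) = T.u n p⁻¹ := by
  induction n with
  | zero =>
    exact T.star_e 0
  | succ n ih =>
    obtain ⟨k, q, rfl⟩ := exists_eq_swap_mul_liftPerm p
    rw [u_mul, star_mul, u_lift, ← T.L_star, ih, u_swap, (T.t_props n k).2.2.2, mul_inv_rev,
      swap_inv, u_mul, u_swap]
    congr 1
    rw [← u_lift]
    congr 1
    rw [eq_inv_iff_mul_eq_one, ← liftPerm_mul, inv_mul_cancel, liftPerm_one]

/-! ### Symmetrizers and antisymmetrizers -/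

/-- The one-dimensional representation of the permutation group sending transpositions to `c`. -/
noncomputable def chi (c : ℂ) {n : ℕ} (p : Perm (Fin n)) : ℂ :=
  if Perm.sign p = 1 then 1 else c

lemma chi_mul {c : ℂ} (hc : c * c = 1) {n : ℕ} (p q : Perm (Fin n)) :
    chi c (p * q) = chi c p * chi c q := by
  unfold chi
  rw [Perm.sign_mul]
  rcases Int.units_eq_one_or (Perm.sign p) with h | h <;>
    rcases Int.units_eq_one_or (Perm.sign q) with h' | h' <;> simp [h, h', hc]

lemma chi_one (c : ℂ) {n : ℕ} : chi c (1 : Perm (Fin n)) = 1 := by simp [chi]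

lemma chi_sq {c : ℂ} (hc : c * c = 1) {n : ℕ} (p : Perm (Fin n)) : chi c p * chi c p = 1 := by
  unfold chi; split_ifs <;> simp [hc]

lemma chi_inv (c : ℂ) {n : ℕ} (p : Perm (Fin n)) : chi c p⁻¹ = chi c p := by simp [chi]

lemma chi_lift (c : ℂ) {n : ℕ} (p : Perm (Fin n)) : chi c (liftPerm p) = chi c p := by
  simp [chi, sign_liftPerm]

lemma chi_swap (c : ℂ) {n : ℕ} {a b : Fin n} (h : a ≠ b) : chi c (swap a b) = c := by
  simp [chi, Perm.sign_swap h]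

/-- The projection onto the vectors that transform with `chi c`. -/
noncomputable def E (c : ℂ) (n : ℕ) : B n := (n.factorial : ℂ)⁻¹ • ∑ p, chi c p • T.u n p

variable {c : ℂ}

lemma u_mul_E (hc : c * c = 1) (n : ℕ) (q : Perm (Fin n)) :
    T.u n q * T.E c n = chi c q • T.E c n := by
  unfold E
  rw [mul_smul_comm, smul_comm]
  congr 1
  rw [Finset.mul_sum, Finset.smul_sum]
  refine Fintype.sum_equiv (Equiv.mulLeft q) _ _ fun p => ?_
  simp only [Equiv.coe_mulLeft]
  rw [mul_smul_comm, u_mul, smul_smul, chi_mul hc, ← mul_assoc, chi_sq hc, one_mul]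

lemma E_mul_u (hc : c * c = 1) (n : ℕ) (q : Perm (Fin n)) :
    T.E c n * T.u n q = chi c q • T.E c n := by
  unfold E
  rw [smul_mul_assoc, smul_comm]
  congr 1
  rw [Finset.sum_mul, Finset.smul_sum]
  refine Fintype.sum_equiv (Equiv.mulRight q) _ _ fun p => ?_
  simp only [Equiv.coe_mulRight]
  rw [smul_mul_assoc, u_mul, smul_smul, chi_mul hc, mul_comm (chi c p), ← mul_assoc, chi_sq hc,
    one_mul]

lemma average_eq {M : Type*} [AddCommGroup M] [Module ℂ M] (n : ℕ) (x : M) :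
    (n.factorial : ℂ)⁻¹ • ∑ _p : Perm (Fin n), x = x := by
  rw [Finset.sum_const, Finset.card_univ, Fintype.card_perm, Fintype.card_fin,
    ← Nat.cast_smul_eq_nsmul ℂ, smul_smul, inv_mul_cancel₀, one_smul]
  exact_mod_cast n.factorial_ne_zero

lemma E_mul_E (hc : c * c = 1) (n : ℕ) : T.E c n * T.E c n = T.E c n := by
  conv_lhs => enter [1]; rw [E]
  rw [smul_mul_assoc, Finset.sum_mul]
  simp only [smul_mul_assoc, T.u_mul_E hc, smul_smul, chi_sq hc, one_smul]
  exact average_eq n _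

lemma e_mul_E (n : ℕ) : T.e n * T.E c n = T.E c n := by
  rw [E, mul_smul_comm, Finset.mul_sum]
  simp only [mul_smul_comm, (T.u_props n _).1]

lemma E_mul_e (n : ℕ) : T.E c n * T.e n = T.E c n := by
  rw [E, smul_mul_assoc, Finset.sum_mul]
  simp only [smul_mul_assoc, (T.u_props n _).2]

lemma star_E [∀ n, StarModule ℂ (B n)] (hc : star c = c) (n : ℕ) : star (T.E c n) = T.E c n := by
  have hchi : ∀ p : Perm (Fin n), star (chi c p) = chi c p := fun p => by
    unfold chi; split_ifs <;> simp [hc]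
  rw [E, star_smul, star_sum]
  congr 1
  · simp
  · refine Fintype.sum_equiv (Equiv.inv _) _ _ fun p => ?_
    rw [star_smul, star_u, hchi, Equiv.inv_apply, chi_inv]

lemma L_E_mul_E (hc : c * c = 1) (n : ℕ) : T.L n (T.E c n) * T.E c (n + 1) = T.E c (n + 1) := by
  conv_lhs => enter [1]; rw [E]
  rw [map_smul, map_sum, smul_mul_assoc, Finset.sum_mul]
  simp only [map_smul, smul_mul_assoc, ← u_lift, T.u_mul_E hc, smul_smul, chi_lift, chi_sq hc,
    one_smul]
  exact average_eq n _

lemma E_mul_L_E (hc : c * c = 1) (n : ℕ) : T.E c (n + 1) * T.L n (T.E c n) = T.E c (n + 1) := by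
  conv_lhs => enter [2]; rw [E]
  rw [map_smul, map_sum, mul_smul_comm, Finset.mul_sum]
  simp only [map_smul, mul_smul_comm, ← u_lift, T.E_mul_u hc, smul_smul, chi_lift, chi_sq hc,
    one_smul]
  exact average_eq n _

lemma E_zero : T.E c 0 = T.e 0 := by
  have : ∀ p : Perm (Fin 0), chi c p • T.u 0 p = T.e 0 := by
    intro p
    rw [Subsingleton.elim p 1, chi_one, one_smul, u_one]
  rw [E]
  simp only [this]
  exact average_eq 0 _

/-- The coset decomposition of the permutation group by the transpositions (0 k). The factorials
combine to n + 1. -/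
lemma E_succ_aux (hc : c * c = 1) (n : ℕ) : ((n + 1 : ℕ) : ℂ) • T.E c (n + 1) =
    T.L n (T.E c n) + ∑ j : Fin n, c • (T.t n j.succ * T.L n (T.E c n)) := by
  have h : ∑ p, chi c p • T.u (n + 1) p =
      ∑ k, ∑ q : Perm (Fin n), chi c (swap 0 k) • chi c q • (T.t n k * T.L n (T.u n q)) := by
    rw [← Fintype.sum_prod_type']
    refine Fintype.sum_equiv Perm.decomposeFin _ _ fun p => ?_
    obtain ⟨k, q, rfl⟩ := exists_eq_swap_mul_liftPerm p
    rw [u_swap_mul_lift, chi_mul hc, chi_lift, ← decomposeFin_symm_eq, apply_symm_apply, smul_smul]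
  have h2 : ∀ k, ∑ q : Perm (Fin n), chi c (swap 0 k) • chi c q • (T.t n k * T.L n (T.u n q)) =
      chi c (swap 0 k) • (n.factorial : ℂ) • (T.t n k * T.L n (T.E c n)) := by
    intro k
    rw [E, map_smul, mul_smul_comm, smul_smul (n.factorial : ℂ), mul_inv_cancel₀, one_smul,
      map_sum, Finset.mul_sum, Finset.smul_sum]
    · simp only [map_smul, mul_smul_comm]
    · exact_mod_cast n.factorial_ne_zero
  have h3 : ((n + 1 : ℕ) : ℂ) * (((n + 1).factorial : ℕ) : ℂ)⁻¹ * (n.factorial : ℂ) = 1 := by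
    rw [Nat.factorial_succ]
    have : (n.factorial : ℂ) ≠ 0 := by exact_mod_cast n.factorial_ne_zero
    have : ((n + 1 : ℕ) : ℂ) ≠ 0 := by exact_mod_cast n.succ_ne_zero
    push_cast
    push_cast at this
    field_simp
  rw [E, h]
  simp only [h2]
  rw [smul_smul, Finset.smul_sum]
  have h4 : ∀ k, (((n + 1 : ℕ) : ℂ) * (((n + 1).factorial : ℕ) : ℂ)⁻¹) •
      chi c (swap 0 k) • (n.factorial : ℂ) • (T.t n k * T.L n (T.E c n)) =
      chi c (swap 0 k) • (T.t n k * T.L n (T.E c n)) := by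
    intro k
    rw [smul_smul, smul_smul]
    congr 1
    linear_combination chi c (swap 0 k) * h3
  simp only [h4]
  rw [Fin.sum_univ_succ]
  congr 1
  · rw [swap_self]
    change chi c (1 : Perm (Fin (n + 1))) • _ = _
    rw [chi_one, one_smul, t_zero, ← T.L_e, ← T.L_mul, e_mul_E]
  · exact Finset.sum_congr rfl fun j _ => by rw [chi_swap c (Fin.succ_ne_zero j).symm]

lemma E_one (hc : c * c = 1) : T.E c 1 = T.e 1 := by
  have := T.E_succ_aux hc 0
  simpa [E_zero, T.L_e] using this

/-- The recursion for the (anti)symmetrizers. -/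
lemma E_succ (hc : c * c = 1) (n : ℕ) : ((n + 2 : ℕ) : ℂ) • T.E c (n + 2) =
    T.L (n + 1) (T.E c (n + 1)) + (c * (n + 1 : ℕ)) •
      (T.L (n + 1) (T.E c (n + 1)) * T.s n * T.L (n + 1) (T.E c (n + 1))) := by
  have h := congrArg (T.L (n + 1) (T.E c (n + 1)) * ·) (T.E_succ_aux hc (n + 1))
  simp only [mul_smul_comm, T.L_E_mul_E hc, mul_add, ← T.L_mul, T.E_mul_E hc,
    Finset.mul_sum] at h
  rw [h]
  congr 1
  -- The conjugating transpositions are absorbed by the projections on both sides. Each contributes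
  -- the same sign, so every j yields the same term.
  have key : ∀ j : Fin (n + 1), T.L (n + 1) (T.E c (n + 1)) *
      (T.t (n + 1) j.succ * T.L (n + 1) (T.E c (n + 1))) =
      T.L (n + 1) (T.E c (n + 1)) * T.s n * T.L (n + 1) (T.E c (n + 1)) := by
    intro j
    rw [t_succ, mul_assoc (T.L _ _ * T.s n), ← T.L_mul, ← T.u_swap, T.u_mul_E hc, ← mul_assoc,
      ← mul_assoc, ← T.L_mul, T.E_mul_u hc, map_smul, smul_mul_assoc, smul_mul_assoc,
      mul_smul_comm, smul_smul, chi_sq hc, one_smul]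
  simp only [key]
  rw [Finset.sum_const, Finset.card_univ, Fintype.card_fin, ← Nat.cast_smul_eq_nsmul ℂ, smul_smul,
    mul_comm]

/-! ### Left inverses on the tower -/

/-- Positive bimodule maps `Φ` from each step of the tower to the previous one, with
`Φ(1) = r` and `Φ(s) = l`, satisfying a Pimsner–Popa inequality. -/
structure LeftInv (T : PermTower B) (r l : ℂ) where
  Φ : ∀ n, B (n + 1) →ₗ[ℂ] B n
  Pos : ∀ n, B n → Prop
  Φ_bimod : ∀ n x y z, Φ n (T.L n x * y * T.L n z) = x * Φ n y * z
  Φ_e : ∀ n, Φ n (T.e (n + 1)) = r • T.e n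
  Φ_s : ∀ n, Φ (n + 1) (T.s n) = l • T.e (n + 1)
  Φ_star : ∀ n x, Φ n (star x) = star (Φ n x)
  pos_star_mul : ∀ n x, Pos n (star x * x)
  pos_smul : ∀ n x (a : ℝ), 0 ≤ a → Pos n x → Pos n ((a : ℂ) • x)
  pos_conj : ∀ n x y, Pos n x → Pos n (star y * x * y)
  pos_neg : ∀ n x, Pos n x → Pos n (-x) → x = 0
  pos_Φ : ∀ n x, Pos (n + 1) x → Pos n (Φ n x)
  C : ℝ
  pimsner_popa : ∀ n x, x * T.e (n + 1) = x →
    Pos (n + 1) ((C : ℂ) • T.L n (Φ n (star x * x)) - star x * x)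

namespace LeftInv

variable {T} {r l : ℂ}

/-- The left inverse is applied to the recursion `E_succ`: the embedded projection contributes r,
and the term with s contributes l by the bimodule property. -/
lemma Φ_E (F : T.LeftInv r l) (hc : c * c = 1) (n : ℕ) :
    F.Φ n (T.E c (n + 1)) = ((r + c * n * l) / (n + 1)) • T.E c n := by
  have hL : ∀ n, F.Φ n (T.L n (T.E c n)) = r • T.E c n := by
    intro n
    have := F.Φ_bimod n (T.E c n) (T.e (n + 1)) (T.E c n)
    rwa [← T.L_e, ← T.L_mul, ← T.L_mul, T.E_mul_e, T.E_mul_E hc, T.L_e, F.Φ_e, mul_smul_comm,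
      smul_mul_assoc, T.E_mul_e, T.E_mul_E hc] at this
  cases n with
  | zero =>
    rw [T.E_one hc, F.Φ_e, T.E_zero]; simp
  | succ n =>
    have h := congrArg (F.Φ (n + 1)) (T.E_succ hc n)
    rw [map_smul, map_add, map_smul, hL, F.Φ_bimod, F.Φ_s, mul_smul_comm, smul_mul_assoc,
      T.E_mul_e, T.E_mul_E hc, smul_smul, ← add_smul] at h
    have h0 : ((n + 2 : ℕ) : ℂ) ≠ 0 := by exact_mod_cast (n + 1).succ_ne_zero
    have h1 := congrArg (fun x => ((n + 2 : ℕ) : ℂ)⁻¹ • x) h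
    simp only [smul_smul, inv_mul_cancel₀ h0, one_smul] at h1
    rw [h1]
    congr 1
    push_cast
    rw [div_eq_inv_mul]
    ring_nf

/-- The statistical dimension is an integer. -/
theorem exists_dimension (F : T.LeftInv r l) [∀ n, StarModule ℂ (B n)] (hr : ∃ r' : ℝ, 0 < r' ∧ r = r')
    (he : T.e 1 ≠ 0) :
    ∃ (d : ℕ) (c : ℝ), 1 ≤ d ∧ (c = 1 ∨ c = -1) ∧ ∃ l' : ℝ, 0 < l' ∧ l = (-c * l' : ℝ) ∧
      r = (d * l' : ℝ) := by
  obtain ⟨r', hr', rfl⟩ := hr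
  -- s is self-adjoint and Φ preserves adjoints, so l is real.
  have hl : star l = l := by
    have h1 := F.Φ_star 1 (T.s 0)
    rw [T.star_s, F.Φ_s, star_smul, T.star_e] at h1
    by_contra h
    have h2 : (l - star l) • T.e 1 = 0 := by rw [sub_smul, sub_eq_zero]; exact h1
    exact (smul_ne_zero (sub_ne_zero.2 (Ne.symm h)) he) h2
  obtain ⟨l₀, rfl⟩ : ∃ l₀ : ℝ, l = l₀ := ⟨l.re, (Complex.conj_eq_iff_re.1 hl).symm⟩
  have hpos : ∀ (c : ℝ), c * c = 1 → ∀ n, F.Pos n (T.E c n) := by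
    intro c hc n
    have h1 := F.pos_star_mul n (T.E c n)
    rwa [T.star_E (by simp), T.E_mul_E (by exact_mod_cast hc)] at h1
  have hneg : ∀ (c : ℝ), c * c = 1 → ∀ n (a : ℝ), a < 0 → F.Pos n ((a : ℂ) • T.E c n) →
      T.E c n = 0 := by
    intro c hc n a ha h
    refine F.pos_neg n _ (hpos c hc n) ?_
    have h1 := F.pos_smul n _ (-a)⁻¹ (inv_nonneg.2 (by linarith)) h
    rw [smul_smul] at h1
    have h2 : (((-a)⁻¹ : ℝ) : ℂ) * (a : ℂ) = -1 := by
      have : (a : ℂ) ≠ 0 := by exact_mod_cast ha.ne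
      push_cast
      field_simp
    rwa [h2, neg_one_smul] at h1
  have hstep : ∀ (c : ℝ), c * c = 1 → ∀ n : ℕ, 0 ≠ r' + c * n * l₀ → T.E c n ≠ 0 →
      T.E c (n + 1) ≠ 0 := by
    intro c hc n h0 hn h
    have h1 := F.Φ_E (c := c) (by exact_mod_cast hc) n
    rw [h, map_zero, eq_comm, smul_eq_zero] at h1
    refine h1.elim (fun h1 => ?_) hn
    rw [div_eq_zero_iff] at h1
    rcases h1 with h1 | h1
    · exact h0 (by exact_mod_cast h1.symm)
    · exact n.succ_ne_zero (by exact_mod_cast h1)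
  have hone : ∀ (c : ℝ), c * c = 1 → T.E c 1 ≠ 0 := by
    intro c hc
    rwa [T.E_one (by exact_mod_cast hc)]
  -- If l = 0, no symmetrizer vanishes and Φ(E_{n+1}) = r/(n+1) E_n. Compressing the Pimsner–Popa
  -- inequality by E_{n+1} makes (C r/(n+1) - 1) E_{n+1} positive, which fails for large n.
  have hl0 : l₀ ≠ 0 := by
    intro h0
    have hne : ∀ n, T.E (1 : ℝ) (n + 1) ≠ 0 := by
      intro n
      induction n with
      | zero => exact hone 1 (by norm_num)
      | succ n ih => exact hstep 1 (by norm_num) (n + 1) (by rw [h0]; simp [hr'.ne]) ih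
    obtain ⟨n, hn⟩ := exists_nat_gt (F.C * r')
    refine hne n (hneg 1 (by norm_num) (n + 1) (F.C * r' / (n + 1) - 1) ?_ ?_)
    · rw [sub_neg, div_lt_one (by positivity)]; linarith
    · have h1 := F.pimsner_popa n (T.E (1 : ℝ) (n + 1)) (T.E_mul_e _)
      rw [T.star_E (by simp), T.E_mul_E (by simp), F.Φ_E (by simp)] at h1
      have h2 := F.pos_conj _ _ (T.E (1 : ℝ) (n + 1)) h1
      rw [T.star_E (by simp), mul_sub, sub_mul, map_smul, mul_smul_comm, mul_smul_comm,
        T.E_mul_L_E (by simp), T.E_mul_E (by simp), smul_mul_assoc, smul_mul_assoc,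
        T.E_mul_E (by simp), smul_smul] at h2
      convert h2 using 1
      push_cast
      rw [sub_smul, one_smul]
      congr 2
      have h3 : (l₀ : ℂ) = 0 := by rw [h0, Complex.ofReal_zero]
      linear_combination (-(F.C * n / (n + 1)) : ℂ) * h3
  -- The sign for which r + c n l decreases with n.
  set c : ℝ := if 0 < l₀ then -1 else 1 with hcdef
  have hc : c = 1 ∨ c = -1 := by rw [hcdef]; split_ifs <;> simp
  have hcc : c * c = 1 := by rcases hc with h | h <;> rw [h] <;> norm_num
  have hcl : 0 < -c * l₀ := by
    rw [hcdef]
    split_ifs with h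
    · simpa using h
    · have := lt_of_le_of_ne (not_lt.1 h) hl0
      linarith
  by_contra hcon
  have hno : ∀ n : ℕ, 1 ≤ n → r' ≠ n * (-c * l₀) := by
    intro n hn h
    refine hcon ⟨n, c, hn, hc, -c * l₀, hcl, ?_, ?_⟩
    · congr 1
      linear_combination - l₀ * hcc
    · exact_mod_cast h
  -- Without a zero among the factors, none of the projections vanishes, and positivity of Φ keeps
  -- every factor positive. This contradicts their linear decrease.
  have hall : ∀ n : ℕ, T.E c (n + 1) ≠ 0 ∧ 0 < r' + c * (n + 1 : ℕ) * l₀ := by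
    have hlt : ∀ n : ℕ, T.E c (n + 1) ≠ 0 → 0 < r' + c * (n + 1 : ℕ) * l₀ := by
      intro n hn
      rcases lt_trichotomy 0 (r' + c * (n + 1 : ℕ) * l₀) with h | h | h
      · exact h
      · exact absurd (by linarith) (hno (n + 1) (by omega))
      · exfalso
        have h1 := F.pos_Φ _ _ (hpos c hcc (n + 2))
        rw [F.Φ_E (by exact_mod_cast hcc)] at h1
        refine hn (hneg c hcc (n + 1) ((r' + c * (n + 1 : ℕ) * l₀) / ((n + 1 : ℕ) + 1)) ?_ ?_)
        · exact div_neg_of_neg_of_pos h (by positivity)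
        · convert h1 using 2
          push_cast
          rfl
    intro n
    induction n with
    | zero => exact ⟨hone c hcc, hlt 0 (hone c hcc)⟩
    | succ n ih =>
      have := hstep c hcc (n + 1) ih.2.ne ih.1
      exact ⟨this, hlt _ this⟩
  obtain ⟨n, hn⟩ := exists_nat_gt (r' / (-c * l₀))
  rw [div_lt_iff₀ hcl] at hn
  have := (hall n).2
  push_cast at this
  linarith

end LeftInv

end PermTower

end Sectors

namespace Sectors

section Pairs

variable {H : Type*} [NormedAddCommGroup H] [InnerProductSpace ℂ H] [CompleteSpace H]
  {A : LocalNet H} {I J K L M P Q : Type} [Fintype I] [Fintype J] [Fintype K] [Fintype L]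
  [Fintype M] [Fintype P] [Fintype Q]

/-! ### Positivity in the quasilocal algebra -/

lemma re_inner_sum_star_mul_self {ι : Type*} (s : Finset ι) (z : ι → A.quasi) (ξ : H) :
    ⟪ξ, ((∑ i ∈ s, star (z i) * z i : A.quasi) : H →L[ℂ] H) ξ⟫_ℂ =
      ((∑ i ∈ s, ‖(z i : H →L[ℂ] H) ξ‖ ^ 2 : ℝ) : ℂ) := by
  have h : ((∑ i ∈ s, star (z i) * z i : A.quasi) : H →L[ℂ] H) =
      ∑ i ∈ s, ContinuousLinearMap.adjoint (z i : H →L[ℂ] H) * (z i : H →L[ℂ] H) := by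
    rw [AddSubmonoidClass.coe_finsetSum]
    rfl
  rw [h, sum_apply, inner_sum]
  push_cast
  refine Finset.sum_congr rfl fun i _ => ?_
  change ⟪ξ, ContinuousLinearMap.adjoint (z i : H →L[ℂ] H) ((z i : H →L[ℂ] H) ξ)⟫_ℂ = _
  rw [ContinuousLinearMap.adjoint_inner_right, inner_self_eq_norm_sq_to_K]
  rfl

lemma eq_zero_of_sum_star_mul_self {ι : Type*} {s : Finset ι} {z : ι → A.quasi}
    (h : ∑ i ∈ s, star (z i) * z i = 0) {i : ι} (hi : i ∈ s) : z i = 0 := by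
  refine Subtype.ext (ContinuousLinearMap.ext fun ξ => ?_)
  have h1 := re_inner_sum_star_mul_self s z ξ
  rw [h] at h1
  simp only [ZeroMemClass.coe_zero, zero_apply, inner_zero_right] at h1
  have h2 : ∑ i ∈ s, ‖(z i : H →L[ℂ] H) ξ‖ ^ 2 = 0 := by exact_mod_cast h1.symm
  have h3 := (Finset.sum_eq_zero_iff_of_nonneg fun i _ => by positivity).1 h2 i hi
  simpa using h3

lemma eq_zero_of_conjTranspose_mul_self {T : Matrix J I A.quasi} (h : Tᴴ * T = 0) : T = 0 := by
  ext1 j i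
  refine eq_zero_of_sum_star_mul_self (s := Finset.univ) (z := fun j => T j i) ?_ (Finset.mem_univ j)
  have := congrFun (congrFun h i) i
  simpa [Matrix.mul_apply] using this

/-- A scalar of the form `∑ zᵢ* zᵢ` is nonnegative, and positive unless all `zᵢ` vanish. -/
lemma exists_nonneg_of_sum_star_mul_self [Nontrivial H] {ι : Type*} [Fintype ι] {z : ι → A.quasi}
    {c : ℂ} (h : ∑ i, star (z i) * z i = c • (1 : A.quasi)) :
    ∃ r : ℝ, c = r ∧ 0 ≤ r ∧ (r = 0 → ∀ i, z i = 0) := by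
  obtain ⟨ξ, hξ⟩ := exists_ne (0 : H)
  have h1 := re_inner_sum_star_mul_self Finset.univ z ξ
  rw [h] at h1
  have h2 : (((c • (1 : A.quasi) : A.quasi) : H →L[ℂ] H)) ξ = c • ξ := rfl
  rw [h2, inner_smul_right, inner_self_eq_norm_sq_to_K] at h1
  have hξ' : ‖ξ‖ ^ 2 ≠ 0 := by simpa using hξ
  have h3 : c = ((∑ i, ‖(z i : H →L[ℂ] H) ξ‖ ^ 2) / ‖ξ‖ ^ 2 : ℝ) := by
    push_cast at h1 ⊢
    rw [eq_div_iff (by exact_mod_cast hξ')]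
    exact h1
  refine ⟨_, h3, by positivity, fun h0 i => ?_⟩
  rw [h0, Complex.ofReal_zero] at h3
  rw [h3, zero_smul] at h
  exact eq_zero_of_sum_star_mul_self h (Finset.mem_univ i)

/-- The quasilocal algebra has trivial centre. -/
lemma LocalNet.exists_smul_one (A : LocalNet H) {z : A.quasi} (h : ∀ X, z * X = X * z) :
    ∃ c : ℂ, z = c • (1 : A.quasi) := by
  obtain ⟨c, hc⟩ := A.irreducible z fun x hx => (congrArg Subtype.val (h ⟨x, hx⟩)).symm
  exact ⟨c, Subtype.ext hc⟩

namespace Bimodule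

/-! ### Operators in `(ι, τσ)` and the associated left inverses -/

/-- The vector `(1_τ × x) S` for a row `x` and `S ∈ (ι, τσ)`. -/
noncomputable def act (τ : Bimodule A P) (S : P → I → A.quasi) : (I → A.quasi) →ₗ[ℂ] (P → A.quasi) where
  toFun x p := ∑ q, ∑ i, τ (x i) p q * S q i
  map_add' x y := by
    ext1 p
    simp only [Pi.add_apply, map_add, Matrix.add_apply, add_mul, Finset.sum_add_distrib]
  map_smul' c x := by
    ext1 p
    simp only [Pi.smul_apply, map_smul, Matrix.smul_apply, smul_mul_assoc, Finset.smul_sum,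
      RingHom.id_apply]

lemma act_apply (τ : Bimodule A P) (S : P → I → A.quasi) (x : I → A.quasi) (p : P) :
    act τ S x p = ∑ q, ∑ i, τ (x i) p q * S q i := rfl

lemma act_mul (τ : Bimodule A P) (S : P → I → A.quasi) (x : L → A.quasi) (Y : Matrix L I A.quasi)
    (p : P) : act τ S (x ᵥ* Y) p = ∑ l, ∑ q, τ (x l) p q * act τ S (Y l) q := by
  simp only [act_apply, Matrix.vecMul, dotProduct, sum_apply', mul_apply', Finset.sum_mul,
    Finset.mul_sum, mul_assoc]
  exact (sum_rotate₄ _).trans (sum_rotate₄ _)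

lemma act_mul_left (τ : Bimodule A P) (S : P → I → A.quasi) (x : A.quasi) (y : I → A.quasi)
    (p : P) : act τ S (fun i => x * y i) p = ∑ q, τ x p q * act τ S y q := by
  have h : (fun i => x * y i) = (fun _ : Unit => x) ᵥ* Matrix.of fun _ => y := by
    ext1 i
    simp [Matrix.vecMul, dotProduct]
  rw [h, act_mul, Finset.univ_unique, Finset.sum_singleton]
  rfl

/-- `S ∈ (ι, τσ)`. -/
def IsPair (σ : Bimodule A I) (τ : Bimodule A P) (S : P → I → A.quasi) : Prop :=
  ∀ X i p, act τ S (σ X i) p = S p i * X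

/-- The positive map `B ↦ S* τ(B) S`. -/
noncomputable def sand (τ : Bimodule A P) (S : P → I → A.quasi) : Matrix I I A.quasi →ₗ[ℂ] A.quasi where
  toFun B := ∑ p, ∑ i, star (S p i) * act τ S (B i) p
  map_add' B C := by
    have : ∀ i, (B + C) i = B i + C i := fun _ => rfl
    simp only [this, map_add, Pi.add_apply, mul_add, Finset.sum_add_distrib]
  map_smul' c B := by
    have : ∀ i, (c • B) i = c • B i := fun _ => rfl
    simp only [this, map_smul, Pi.smul_apply, mul_smul_comm, Finset.smul_sum, RingHom.id_apply]

lemma sand_apply (τ : Bimodule A P) (S : P → I → A.quasi) (B : Matrix I I A.quasi) :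
    sand τ S B = ∑ p, ∑ i, star (S p i) * act τ S (B i) p := rfl

/-- S* τ(Y*Z) S is the product of the adjoint of (1 × Y)S with (1 × Z)S. Positivity and faithfulness
of the left inverses are read off from this factorization; no intertwining is needed. -/
lemma sand_conjTranspose_mul (τ : Bimodule A P) (S : P → I → A.quasi) (Y Z : Matrix K I A.quasi) :
    sand τ S (Yᴴ * Z) = ∑ k, ∑ p, star (act τ S (Y k) p) * act τ S (Z k) p := by
  have h : ∀ i p, act τ S ((Yᴴ * Z) i) p = ∑ k, ∑ q, τ (star (Y k i)) p q * act τ S (Z k) q :=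
    fun i p => act_mul τ S (Yᴴ i) Z p
  simp only [sand_apply, h]
  have h' : ∀ k q, star (act τ S (Y k) q) = ∑ p, ∑ i, star (S p i) * τ (star (Y k i)) p q :=
    fun k q => by simp only [act_apply, star_sum, star_mul, ← star_apply']
  simp only [h', Finset.mul_sum, Finset.sum_mul, mul_assoc]
  exact (sum_rotate₄ _).trans (sum_rotate₄ _)

lemma sand_mul (τ : Bimodule A P) (S : P → I → A.quasi) (Y : Matrix I K A.quasi)
    (Z : Matrix K I A.quasi) :
    sand τ S (Y * Z) = ∑ k, ∑ p, star (act τ S (fun i => star (Y i k)) p) * act τ S (Z k) p := by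
  have := sand_conjTranspose_mul τ S Yᴴ Z
  rwa [Matrix.conjTranspose_conjTranspose] at this

lemma sand_conjTranspose (τ : Bimodule A P) (S : P → I → A.quasi) (B : Matrix I I A.quasi) :
    sand τ S Bᴴ = star (sand τ S B) := by
  simp only [sand_apply, act_apply, Finset.mul_sum, star_sum, star_mul, star_star,
    Matrix.conjTranspose_apply, star_apply', mul_assoc]
  refine ((sum_rotate₄ _).trans (sum_rotate₄ _)).trans ?_
  rfl

/-- The partial application of `B ↦ S* τ(B) S`. -/
noncomputable def slice (τ : Bimodule A P) (S : P → I → A.quasi) :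
    Matrix (I × J) (I × K) A.quasi →ₗ[ℂ] Matrix J K A.quasi where
  toFun T := Matrix.of fun j k => sand τ S (Matrix.of fun i i' => T (i, j) (i', k))
  map_add' B C := by
    ext1 j k
    exact map_add (sand τ S) (Matrix.of fun i i' => B (i, j) (i', k))
      (Matrix.of fun i i' => C (i, j) (i', k))
  map_smul' c B := by
    ext1 j k
    exact map_smul (sand τ S) c (Matrix.of fun i i' => B (i, j) (i', k))

lemma slice_apply (τ : Bimodule A P) (S : P → I → A.quasi) (T : Matrix (I × J) (I × K) A.quasi)
    (j : J) (k : K) : slice τ S T j k = sand τ S (Matrix.of fun i i' => T (i, j) (i', k)) := rfl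

lemma slice_conjTranspose (τ : Bimodule A P) (S : P → I → A.quasi)
    (T : Matrix (I × J) (I × K) A.quasi) : slice τ S Tᴴ = (slice τ S T)ᴴ := by
  ext1 k j
  rw [Matrix.conjTranspose_apply, slice_apply, slice_apply, ← sand_conjTranspose]
  rfl

/-- The partial application of `act`. -/
noncomputable def sliceRow (τ : Bimodule A P) (S : P → I → A.quasi) (T : Matrix M (I × J) A.quasi) :
    Matrix (M × P) J A.quasi :=
  Matrix.of fun m j => act τ S (fun i => T m.1 (i, j)) m.2

lemma sliceRow_apply (τ : Bimodule A P) (S : P → I → A.quasi) (T : Matrix M (I × J) A.quasi)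
    (m : M × P) (j : J) : sliceRow τ S T m j = act τ S (fun i => T m.1 (i, j)) m.2 := rfl

lemma slice_conjTranspose_mul (τ : Bimodule A P) (S : P → I → A.quasi)
    (Y : Matrix M (I × J) A.quasi) (Z : Matrix M (I × K) A.quasi) :
    slice τ S (Yᴴ * Z) = (sliceRow τ S Y)ᴴ * sliceRow τ S Z := by
  ext1 j k
  rw [slice_apply, Matrix.mul_apply, Fintype.sum_prod_type]
  exact sand_conjTranspose_mul τ S (fun m i => Y m (i, j)) (fun m i => Z m (i, k))

section IsPair

variable {σ : Bimodule A I} {τ : Bimodule A P} {S : P → I → A.quasi}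

lemma IsPair.act_vecMul (h : IsPair σ τ S) (x : I → A.quasi) (X : A.quasi) (p : P) :
    act τ S (x ᵥ* σ X) p = act τ S x p * X := by
  rw [act_mul, act_apply, Finset.sum_mul, Finset.sum_comm]
  refine Finset.sum_congr rfl fun q _ => ?_
  rw [Finset.sum_mul]
  exact Finset.sum_congr rfl fun i _ => by rw [h, mul_assoc]

lemma IsPair.sand_mul_right (h : IsPair σ τ S) (B : Matrix I I A.quasi) (X : A.quasi) :
    sand τ S (B * σ X) = sand τ S B * X := by
  simp only [sand_apply, Finset.sum_mul, mul_assoc, ← h.act_vecMul]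
  rfl

lemma IsPair.sand_mul_left (h : IsPair σ τ S) (B : Matrix I I A.quasi) (X : A.quasi) :
    sand τ S (σ X * B) = X * sand τ S B := by
  have := h.sand_mul_right Bᴴ (star X)
  rw [sand_conjTranspose, ← conjTranspose_apply', ← Matrix.conjTranspose_mul, sand_conjTranspose,
    ← star_mul] at this
  exact star_injective this

lemma IsPair.slice_mul_lt (h : IsPair σ τ S) (T : Matrix (I × J) (I × K) A.quasi)
    (N : Matrix K L A.quasi) : slice τ S (T * lt σ N) = slice τ S T * N := by
  ext1 j l
  rw [slice_apply, Matrix.mul_apply]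
  have e : (Matrix.of fun i i' => (T * lt σ N) (i, j) (i', l)) =
      ∑ k, (Matrix.of fun i i' => T (i, j) (i', k)) * σ (N k l) := by
    ext1 i i'
    rw [Matrix.sum_apply, Matrix.of_apply, Matrix.mul_apply, Fintype.sum_prod_type,
      Finset.sum_comm]
    rfl
  rw [e, map_sum]
  exact Finset.sum_congr rfl fun k _ => h.sand_mul_right _ _

lemma IsPair.slice_lt_mul (h : IsPair σ τ S) (T : Matrix (I × J) (I × K) A.quasi)
    (N : Matrix L J A.quasi) : slice τ S (lt σ N * T) = N * slice τ S T := by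
  have := h.slice_mul_lt Tᴴ Nᴴ
  rw [lt_conjTranspose, ← Matrix.conjTranspose_mul, slice_conjTranspose, slice_conjTranspose,
    ← Matrix.conjTranspose_mul] at this
  exact Matrix.conjTranspose_injective this

lemma IsPair.slice_isArrow (h : IsPair σ τ S) {κ : Bimodule A J} {κ' : Bimodule A K}
    {T : Matrix (I × K) (I × J) A.quasi} (hT : (σ.tensor κ).IsArrow (σ.tensor κ') T) :
    κ.IsArrow κ' (slice τ S T) := by
  refine ⟨?_, ?_, fun X => ?_⟩
  · rw [← h.slice_mul_lt, ← tensor_eq_lt, hT.mul_one]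
  · rw [← h.slice_lt_mul, ← tensor_eq_lt, hT.one_mul]
  · rw [← h.slice_mul_lt, ← tensor_eq_lt, hT.intertwine, tensor_eq_lt, h.slice_lt_mul]

lemma IsPair.sand_one (h : IsPair σ τ S) : sand τ S (σ 1) = ∑ p, ∑ i, star (S p i) * S p i := by
  rw [sand_apply]
  exact Finset.sum_congr rfl fun p _ => Finset.sum_congr rfl fun i _ => by rw [h, mul_one]

/-- `S* S` is a scalar. -/
lemma IsPair.exists_scalar [Nontrivial H] (h : IsPair σ τ S) :
    ∃ r : ℝ, 0 ≤ r ∧ (r = 0 → ∀ p i, S p i = 0) ∧ sand τ S (σ 1) = (r : ℂ) • 1 := by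
  obtain ⟨c, hc⟩ := A.exists_smul_one (z := sand τ S (σ 1)) fun X => by
    rw [← h.sand_mul_right, ← h.sand_mul_left, one_mul', mul_one']
  have h1 : ∑ q : P × I, star (S q.1 q.2) * S q.1 q.2 = c • (1 : A.quasi) := by
    rw [← hc, h.sand_one, Fintype.sum_prod_type]
  obtain ⟨r, rfl, hr, h0⟩ := exists_nonneg_of_sum_star_mul_self h1
  exact ⟨r, hr, fun h p i => h0 h (p, i), hc⟩

lemma IsPair.slice_one (h : IsPair σ τ S) {r : ℂ} (hr : sand τ S (σ 1) = r • 1)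
    (κ : Bimodule A J) (X : A.quasi) : slice τ S ((σ.tensor κ) X) = r • κ X := by
  ext1 j k
  rw [slice_apply]
  have : (Matrix.of fun i i' => (σ.tensor κ) X (i, j) (i', k)) = σ 1 * σ (κ X j k) := by
    rw [one_mul']; rfl
  rw [this, h.sand_mul_right, hr, smul_mul_assoc, one_mul, Matrix.smul_apply]

/-- A faithful element of `(ι, τσ)`. -/
def IsFaithfulPair (σ : Bimodule A I) (τ : Bimodule A P) (S : P → I → A.quasi) : Prop :=
  IsPair σ τ S ∧ ∀ x : I → A.quasi, act τ S x = 0 → x ᵥ* σ 1 = 0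

/-- The slice of T*T is the square of the partially applied T, so faithfulness of the pair applies
row by row. The condition on T supplies the support projection σ(1). -/
lemma IsFaithfulPair.slice_faithful (h : IsFaithfulPair σ τ S) {κ : Bimodule A J}
    {T : Matrix M (I × J) A.quasi} (hT : T * (σ.tensor κ) 1 = T) (h0 : slice τ S (Tᴴ * T) = 0) :
    T = 0 := by
  rw [slice_conjTranspose_mul] at h0
  have h1 := eq_zero_of_conjTranspose_mul_self h0
  have h2 : ∀ m j i', ∑ i, T m (i, j) * σ 1 i i' = 0 := fun m j =>
    congrFun (h.2 (fun i => T m (i, j)) (funext fun p => congrFun (congrFun h1 (m, p)) j))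
  ext1 m ⟨i', j'⟩
  rw [← hT, Matrix.mul_apply, Fintype.sum_prod_type, Finset.sum_comm]
  refine Finset.sum_eq_zero fun j _ => ?_
  have h3 : ∀ i, (σ.tensor κ) 1 (i, j) (i', j') = ∑ l, σ 1 i l * σ (κ 1 j j') l i' := fun i => by
    rw [← mul_apply', one_mul]; rfl
  simp only [h3, Finset.mul_sum, ← mul_assoc]
  rw [Finset.sum_comm]
  exact Finset.sum_eq_zero fun l _ => by rw [← Finset.sum_mul, h2, zero_mul]

end IsPair

end Bimodule

end Pairs

end Sectors

namespace Sectors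

section Pairs

variable {H : Type*} [NormedAddCommGroup H] [InnerProductSpace ℂ H] [CompleteSpace H]
  {A : LocalNet H} {I J K L M P Q : Type} [Fintype I] [Fintype J] [Fintype K] [Fintype L]
  [Fintype M] [Fintype P] [Fintype Q]

lemma sum_reverse₅ {X α β γ δ ε : Type*} [AddCommMonoid X] [Fintype α] [Fintype β] [Fintype γ]
    [Fintype δ] [Fintype ε] (f : α → β → γ → δ → ε → X) :
    ∑ a, ∑ b, ∑ c, ∑ d, ∑ e, f a b c d e = ∑ e, ∑ d, ∑ b, ∑ c, ∑ a, f a b c d e :=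
  (sum_rotate₅ _).trans <| Finset.sum_congr rfl fun _ _ => (sum_rotate₄ _).trans <|
    Finset.sum_congr rfl fun _ _ => (sum_rotate₃ _).trans (sum_rotate₃ _)

namespace Bimodule

/-! ### Subobjects -/

section Restrict

variable {σ : Bimodule A I} {γ : Bimodule A J} {τ : Bimodule A P} {S : P → I → A.quasi}
  {V : Matrix I J A.quasi}

/-- The operator `(1_τ × V*) S`. -/
noncomputable def restrictPair (τ : Bimodule A P) (S : P → I → A.quasi) (V : Matrix I J A.quasi) :
    P → J → A.quasi :=
  fun p j => act τ S (Vᴴ j) p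

lemma act_restrictPair (x : J → A.quasi) (p : P) :
    act τ (restrictPair τ S V) x p = act τ S (x ᵥ* Vᴴ) p := by
  rw [act_mul, act_apply, Finset.sum_comm]
  rfl

lemma sand_restrictPair (B : Matrix J J A.quasi) :
    sand τ (restrictPair τ S V) B = sand τ S (V * B * Vᴴ) := by
  rw [Matrix.mul_assoc, sand_mul, sand_apply, Finset.sum_comm]
  refine Finset.sum_congr rfl fun j _ => Finset.sum_congr rfl fun p _ => ?_
  rw [act_restrictPair]
  rfl

lemma IsPair.restrict (h : IsPair σ τ S) (hV : γ.IsArrow σ V) :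
    IsPair γ τ (restrictPair τ S V) := by
  intro X j p
  have e : γ X j ᵥ* Vᴴ = Vᴴ j ᵥ* σ X := by
    have := congrFun (hV.conjTranspose.intertwine X) j
    exact this.symm
  rw [act_restrictPair, e, h.act_vecMul]
  rfl

lemma IsFaithfulPair.restrict (h : IsFaithfulPair σ τ S) (hV : γ.IsIsometry σ V) :
    IsFaithfulPair γ τ (restrictPair τ S V) := by
  refine ⟨h.1.restrict hV.isArrow, fun x hx => ?_⟩
  have h1 := h.2 (x ᵥ* Vᴴ) (funext fun p => by
    rw [← act_restrictPair]; exact congrFun hx p)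
  rw [Matrix.vecMul_vecMul, hV.isArrow.conjTranspose.mul_one] at h1
  rw [← hV.star_mul_self, ← Matrix.vecMul_vecMul, h1, Matrix.zero_vecMul]

/-- `S'` satisfies the conjugate equation `(S'* × 1_σ)(1_σ × S) = 1_σ` together with `S`. -/
structure IsConjugatePair (σ : Bimodule A I) (τ : Bimodule A P) (S : P → I → A.quasi)
    (S' : I → P → A.quasi) : Prop where
  isPair : IsPair σ τ S
  isPair' : IsPair τ σ S'
  zigzag : ∀ b i, ∑ p, ∑ a, star (S' a p) * σ (S p b) a i = σ 1 b i

lemma IsPair.mul_star (h : IsPair σ τ S) (X : A.quasi) (p : P) (i : I) :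
    X * star (S p i) = ∑ q, ∑ i', star (S q i') * τ (σ X i' i) q p := by
  have := congrArg star (h (star X) i p)
  rw [star_mul, star_star] at this
  rw [← this, act_apply]
  simp only [star_sum, star_mul, ← star_apply', star_star]

/-- The conjugate equation recovers x σ(1) from (1 × x)S by pairing with S'*: the entries of x move
through S'* by the adjoint of its intertwining relation. Faithfulness is immediate. -/
lemma IsConjugatePair.vecMul_one {S' : I → P → A.quasi} (h : IsConjugatePair σ τ S S')
    (x : I → A.quasi) (i : I) :
    (x ᵥ* σ 1) i = ∑ p, ∑ a, star (S' a p) * σ (act τ S x p) a i := by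
  have h1 : ∀ b p a, x b * star (S' a p) = ∑ a', ∑ q, star (S' a' q) * σ (τ (x b) q p) a' a :=
    fun b p a => h.isPair'.mul_star (x b) a p
  calc (x ᵥ* σ 1) i = ∑ b, ∑ p, ∑ a, x b * star (S' a p) * σ (S p b) a i := by
        simp only [Matrix.vecMul, dotProduct, ← h.zigzag, Finset.mul_sum, mul_assoc]
    _ = ∑ q, ∑ a', star (S' a' q) * ∑ p, ∑ b, ∑ a, σ (τ (x b) q p) a' a * σ (S p b) a i := by
        simp only [h1, Finset.sum_mul, Finset.mul_sum, mul_assoc]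
        refine (sum_rotate₅ _).trans (Finset.sum_congr rfl fun q _ => ?_)
        refine (sum_rotate₄ _).trans (Finset.sum_congr rfl fun a _ => ?_)
        rw [Finset.sum_comm]
    _ = _ := by
        simp only [act_apply, sum_apply', mul_apply']

lemma IsConjugatePair.isFaithfulPair {S' : I → P → A.quasi} (h : IsConjugatePair σ τ S S') :
    IsFaithfulPair σ τ S := by
  refine ⟨h.isPair, fun x hx => ?_⟩
  ext1 i
  rw [h.vecMul_one]
  simp [hx]

/-- A subobject keeps the partner τ: V* is absorbed into both operators, and the retained conjugate
equation is compressed by V. -/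
lemma IsConjugatePair.restrict {S' : I → P → A.quasi} (h : IsConjugatePair σ τ S S')
    (hV : γ.IsIsometry σ V) :
    IsConjugatePair γ τ (restrictPair τ S V) (fun j p => (Vᴴ *ᵥ fun i => S' i p) j) := by
  have hV' := hV.isArrow.conjTranspose
  refine ⟨h.isPair.restrict hV.isArrow, fun X p j => ?_, fun b k => ?_⟩
  · calc ∑ k, ∑ q, γ (τ X p q) j k * (Vᴴ *ᵥ fun i => S' i q) k
        = ∑ q, ∑ i, (∑ k, γ (τ X p q) j k * Vᴴ k i) * S' i q := by
          simp only [Matrix.mulVec, dotProduct, Finset.mul_sum, Finset.sum_mul, mul_assoc]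
          rw [Finset.sum_comm]
          refine Finset.sum_congr rfl fun q _ => ?_
          rw [Finset.sum_comm]
      _ = ∑ i, Vᴴ j i * ∑ a, ∑ q, σ (τ X p q) i a * S' a q := by
          simp only [← hV'.entry, Finset.mul_sum, Finset.sum_mul, mul_assoc]
          refine (sum_rotate₃ _).trans (Finset.sum_congr rfl fun i _ => ?_)
          rw [Finset.sum_comm]
      _ = _ := by
          simp only [Matrix.mulVec, dotProduct, Finset.sum_mul, mul_assoc]
          exact Finset.sum_congr rfl fun i _ => congrArg _ (h.isPair' X p i)
  · have h1 : ∀ p i, ∑ a, V i a * γ (act τ S (Vᴴ b) p) a k =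
        ∑ i', σ (act τ S (Vᴴ b) p) i i' * V i' k := fun p i => hV.isArrow.entry _ i k
    calc ∑ p, ∑ a, star ((Vᴴ *ᵥ fun i => S' i p) a) * γ (act τ S (Vᴴ b) p) a k
        = ∑ p, ∑ i, star (S' i p) * ∑ a, V i a * γ (act τ S (Vᴴ b) p) a k := by
          simp only [Matrix.mulVec, dotProduct, star_sum, star_mul, Matrix.conjTranspose_apply,
            star_star, Finset.mul_sum, Finset.sum_mul, mul_assoc]
          refine Finset.sum_congr rfl fun p _ => ?_
          rw [Finset.sum_comm]
      _ = ∑ i', (Vᴴ b ᵥ* σ 1) i' * V i' k := by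
          simp only [h1, h.vecMul_one, Finset.mul_sum, Finset.sum_mul, mul_assoc]
          exact sum_rotate₃ _
      _ = γ 1 b k := by
          have e : Vᴴ b ᵥ* σ 1 = Vᴴ b := congrFun hV'.mul_one b
          rw [e, ← hV.star_mul_self]
          rfl

end Restrict

/-! ### Products -/

section Product

variable {σ₁ : Bimodule A I} {σ₂ : Bimodule A J} {τ₁ : Bimodule A P} {τ₂ : Bimodule A Q}
  {S₁ : P → I → A.quasi} {S₂ : Q → J → A.quasi}

/-- The operator `(1 × S₁ × 1) S₂`. -/
noncomputable def prodPair (τ₂ : Bimodule A Q) (S₁ : P → I → A.quasi) (S₂ : Q → J → A.quasi) :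
    Q × P → I × J → A.quasi :=
  fun q i => ∑ q', τ₂ (S₁ q.2 i.1) q.1 q' * S₂ q' i.2

lemma act_prodPair (x : I × J → A.quasi) (q : Q × P) :
    act (τ₂.tensor τ₁) (prodPair τ₂ S₁ S₂) x q =
      act τ₂ S₂ (fun j => act τ₁ S₁ (fun i => x (i, j)) q.2) q.1 := by
  simp only [act_apply, prodPair, tensor_eq_lt, lt_apply, Fintype.sum_prod_type, sum_apply',
    mul_apply', Finset.mul_sum, Finset.sum_mul, mul_assoc]
  calc ∑ a, ∑ b, ∑ c, ∑ d, ∑ e, τ₂ (τ₁ (x (c, d)) q.2 b) q.1 a * (τ₂ (S₁ b c) a e * S₂ e d)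
      = ∑ e, ∑ d, ∑ a, ∑ b, ∑ c, τ₂ (τ₁ (x (c, d)) q.2 b) q.1 a * (τ₂ (S₁ b c) a e * S₂ e d) :=
        (sum_rotate₅ _).trans (Finset.sum_congr rfl fun e _ => sum_rotate₄ _)
    _ = _ := Finset.sum_congr rfl fun e _ => Finset.sum_congr rfl fun d _ => by
        rw [sum_rotate₃, Finset.sum_comm]
        rw [sum_rotate₃]
        refine Finset.sum_congr rfl fun _ _ => Finset.sum_comm

/-- Left inverses compose. An iterated left inverse is therefore given by a single pair for the
product, and that pair can be restricted to subobjects. -/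
lemma sand_prodPair (B : Matrix (I × J) (I × J) A.quasi) :
    sand (τ₂.tensor τ₁) (prodPair τ₂ S₁ S₂) B = sand τ₂ S₂ (slice τ₁ S₁ B) := by
  have h : ∀ j, slice τ₁ S₁ B j = fun k => ∑ p, ∑ i, star (S₁ p i) *
      act τ₁ S₁ (fun i' => B (i, j) (i', k)) p := fun j => rfl
  have h' : ∀ j q, act τ₂ S₂ (slice τ₁ S₁ B j) q = ∑ p, ∑ i, ∑ q', τ₂ (star (S₁ p i)) q q' *
      act τ₂ S₂ (fun k => act τ₁ S₁ (fun i' => B (i, j) (i', k)) p) q' := by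
    intro j q
    have e : slice τ₁ S₁ B j = ∑ p, ∑ i, fun k => star (S₁ p i) *
      act τ₁ S₁ (fun i' => B (i, j) (i', k)) p := by
      rw [h]
      ext1 k
      simp only [Finset.sum_apply]
    rw [e, map_sum, Finset.sum_apply]
    refine Finset.sum_congr rfl fun p _ => ?_
    rw [map_sum, Finset.sum_apply]
    exact Finset.sum_congr rfl fun i _ => act_mul_left _ _ _ _ _
  simp only [sand_apply (τ := τ₂), sand_apply (τ := τ₂.tensor τ₁), h', act_prodPair, prodPair,
    Fintype.sum_prod_type, star_sum, star_mul, ← star_apply', Finset.sum_mul, Finset.mul_sum,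
    mul_assoc]
  exact sum_reverse₅ _

lemma IsPair.prod (h₁ : IsPair σ₁ τ₁ S₁) (h₂ : IsPair σ₂ τ₂ S₂) :
    IsPair (σ₁.tensor σ₂) (τ₂.tensor τ₁) (prodPair τ₂ S₁ S₂) := by
  intro X i q
  rw [act_prodPair]
  have e : (fun j => act τ₁ S₁ (fun i' => (σ₁.tensor σ₂) X i (i', j)) q.2) =
      fun j => S₁ q.2 i.1 * σ₂ X i.2 j := funext fun j => h₁ (σ₂ X i.2 j) i.1 q.2
  rw [e, act_mul_left, prodPair, Finset.sum_mul]
  exact Finset.sum_congr rfl fun q' _ => by rw [h₂, mul_assoc]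

lemma IsFaithfulPair.prod (h₁ : IsFaithfulPair σ₁ τ₁ S₁) (h₂ : IsFaithfulPair σ₂ τ₂ S₂) :
    IsFaithfulPair (σ₁.tensor σ₂) (τ₂.tensor τ₁) (prodPair τ₂ S₁ S₂) := by
  refine ⟨h₁.1.prod h₂.1, fun x hx => ?_⟩
  have h3 : ∀ p j', act τ₁ S₁ (fun i' => ∑ j, ((fun i => x (i, j)) ᵥ* σ₁ (σ₂ 1 j j')) i') p = 0 := by
    intro p j'
    have e : (fun i' => ∑ j, ((fun i => x (i, j)) ᵥ* σ₁ (σ₂ 1 j j')) i') =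
        ∑ j, (fun i => x (i, j)) ᵥ* σ₁ (σ₂ 1 j j') := by
      ext1 i'
      rw [Finset.sum_apply]
    rw [e, map_sum, Finset.sum_apply]
    simp only [h₁.1.act_vecMul]
    refine congrFun (h₂.2 (fun j => act τ₁ S₁ (fun i => x (i, j)) p) (funext fun q => ?_)) j'
    rw [← act_prodPair x (q, p), hx]
    rfl
  ext1 ⟨i', j'⟩
  have h4 := congrFun (h₁.2 _ (funext fun p => h3 p j')) i'
  simp only [Matrix.vecMul, dotProduct, Finset.sum_mul, mul_assoc] at h4
  simp only [Matrix.vecMul, dotProduct, Fintype.sum_prod_type, tensor_eq_lt, lt_apply]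
  refine Eq.trans ?_ h4
  rw [Finset.sum_comm]
  refine Eq.trans ?_ ((sum_rotate₃ _).trans (sum_rotate₃ _)).symm
  refine Finset.sum_congr rfl fun j _ => Finset.sum_congr rfl fun i _ => ?_
  rw [← Finset.mul_sum, ← mul_apply', mul_one]

end Product

end Bimodule

end Pairs

end Sectors

namespace Sectors

/-! ### Positive matrices, the Pimsner–Popa inequality and the twist -/

section Twist

variable {H : Type*} [NormedAddCommGroup H] [InnerProductSpace ℂ H] [CompleteSpace H]
  {A : LocalNet H} {I J K L M P Q : Type} [Fintype I] [Fintype J] [Fintype K] [Fintype L]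
  [Fintype M] [Fintype P] [Fintype Q]

/-- The matrix is of the form `Z* Z`. -/
def IsPosMatrix (T : Matrix I I A.quasi) : Prop :=
  ∃ (K : Type) (_ : Fintype K) (Z : Matrix K I A.quasi), T = Zᴴ * Z

lemma IsPosMatrix.smul {T : Matrix I I A.quasi} (h : IsPosMatrix T) {a : ℝ} (ha : 0 ≤ a) :
    IsPosMatrix ((a : ℂ) • T) := by
  obtain ⟨K, _, Z, rfl⟩ := h
  refine ⟨K, inferInstance, (Real.sqrt a : ℂ) • Z, ?_⟩
  rw [Matrix.conjTranspose_smul, Matrix.smul_mul, Matrix.mul_smul, smul_smul]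
  congr 1
  rw [Complex.star_def, Complex.conj_ofReal, ← Complex.ofReal_mul, Real.mul_self_sqrt ha]

lemma IsPosMatrix.conj {T : Matrix I I A.quasi} (h : IsPosMatrix T) (Y : Matrix I J A.quasi) :
    IsPosMatrix (Yᴴ * T * Y) := by
  obtain ⟨K, _, Z, rfl⟩ := h
  exact ⟨K, inferInstance, Z * Y, by simp only [Matrix.conjTranspose_mul, Matrix.mul_assoc]⟩

lemma IsPosMatrix.eq_zero {T : Matrix I I A.quasi} (h : IsPosMatrix T) (h' : IsPosMatrix (-T)) :
    T = 0 := by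
  obtain ⟨K, _, Z, rfl⟩ := h
  obtain ⟨L, _, Y, hY⟩ := h'
  have h1 : ∀ k i, Z k i = 0 := by
    intro k i
    have h2 := congrFun (congrFun hY i) i
    rw [Matrix.neg_apply, neg_eq_iff_add_eq_zero] at h2
    simp only [Matrix.mul_apply, Matrix.conjTranspose_apply] at h2
    have h3 : ∑ q : K ⊕ L, star (Sum.elim (fun k => Z k i) (fun l => Y l i) q) *
        Sum.elim (fun k => Z k i) (fun l => Y l i) q = 0 := by
      rw [Fintype.sum_sum_type]
      exact h2
    exact eq_zero_of_sum_star_mul_self h3 (Finset.mem_univ (Sum.inl k))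
  have h2 : Z = 0 := by
    ext1 k i
    exact h1 k i
  rw [h2, Matrix.mul_zero]

namespace Bimodule

lemma isPosMatrix_slice {T : Matrix (I × J) (I × J) A.quasi} (h : IsPosMatrix T)
    (τ : Bimodule A P) (S : P → I → A.quasi) : IsPosMatrix (slice τ S T) := by
  obtain ⟨K, _, Z, rfl⟩ := h
  exact ⟨K × P, inferInstance, _, slice_conjTranspose_mul τ S Z Z⟩

/-- The Pimsner–Popa inequality. -/
theorem IsConjugatePair.pimsner_popa {σ : Bimodule A I} {τ : Bimodule A P} {S : P → I → A.quasi}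
    {S' : I → P → A.quasi} (h : IsConjugatePair σ τ S S') {r : ℝ} (hr : 0 < r)
    (hS' : sand σ S' (τ 1) = (r : ℂ) • 1) {N : Matrix J J A.quasi}
    {T : Matrix M (I × J) A.quasi} (hT : T * lt σ N = T) :
    IsPosMatrix ((r : ℂ) • lt σ (slice τ S (Tᴴ * T)) - Tᴴ * T) := by
  -- T factors through some σ(N), hence absorbs σ(1) in its first index.
  have hT' : ∀ m i' j', ∑ i, T m (i, j') * σ 1 i i' = T m (i', j') := by
    intro m i' j'
    have e : ∀ i, T m (i, j') = ∑ a, ∑ b, T m (a, b) * σ (N b j') a i := fun i => by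
      conv_lhs => rw [← hT, Matrix.mul_apply, Fintype.sum_prod_type]
      rfl
    simp only [e, Finset.sum_mul, mul_assoc]
    refine (sum_rotate₃ _).symm.trans (Finset.sum_congr rfl fun a _ =>
      Finset.sum_congr rfl fun b _ => ?_)
    rw [← Finset.mul_sum, ← mul_apply', mul_one]
  -- Z is 1 × (1 × T)S and Y is S'T. Then Z*Z is the embedded left inverse of T*T, Y*Z = T*T by the
  -- conjugate equation, and Y*Y = r T*T.
  let Z : Matrix (I × (M × P)) (I × J) A.quasi := lt σ (sliceRow τ S T)
  let Y : Matrix (I × (M × P)) (I × J) A.quasi := Matrix.of fun q x => S' q.1 q.2.2 * T q.2.1 x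
  have hZ : Zᴴ * Z = lt σ (slice τ S (Tᴴ * T)) := by
    rw [slice_conjTranspose_mul, lt_mul, lt_conjTranspose]
  have hNZ : Yᴴ * Z = Tᴴ * T := by
    ext1 x ⟨i', j'⟩
    have e : ∀ m, T m (i', j') = ∑ p, ∑ a, star (S' a p) *
        σ (act τ S (fun i => T m (i, j')) p) a i' := by
      intro m
      rw [← h.vecMul_one]
      exact (hT' m i' j').symm
    rw [Matrix.mul_apply, Matrix.mul_apply]
    simp only [e, Fintype.sum_prod_type, Matrix.conjTranspose_apply, Y, Z, Matrix.of_apply,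
      lt_apply, sliceRow_apply, star_mul, Finset.mul_sum, mul_assoc]
    exact (sum_rotate₃ _).symm
  have hNN : Yᴴ * Y = (r : ℂ) • (Tᴴ * T) := by
    ext1 x y
    have e : ∑ p, ∑ a, star (S' a p) * S' a p = (r : ℂ) • (1 : A.quasi) := by
      rw [← hS', h.isPair'.sand_one, Finset.sum_comm]
    rw [Matrix.smul_apply, Matrix.mul_apply, Matrix.mul_apply, Finset.smul_sum]
    simp only [Fintype.sum_prod_type, Matrix.conjTranspose_apply, Y, Matrix.of_apply, star_mul]
    refine (sum_rotate₃ _).symm.trans (Finset.sum_congr rfl fun m _ => ?_)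
    have e2 := congrArg (fun z => star (T m x) * z * T m y) e
    simp only [Finset.mul_sum, Finset.sum_mul, mul_smul_comm, smul_mul_assoc, mul_one,
      mul_assoc] at e2 ⊢
    exact e2
  have hZN : Zᴴ * Y = Tᴴ * T := by
    have := congrArg Matrix.conjTranspose hNZ
    simpa only [Matrix.conjTranspose_mul, Matrix.conjTranspose_conjTranspose] using this
  have hr' : (r : ℂ) ≠ 0 := by exact_mod_cast hr.ne'
  -- Completing the square: r Z*Z - T*T = r (Z - r⁻¹Y)*(Z - r⁻¹Y).
  have key : (r : ℂ) • lt σ (slice τ S (Tᴴ * T)) - Tᴴ * T =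
      (r : ℂ) • ((Z - (r : ℂ)⁻¹ • Y)ᴴ * (Z - (r : ℂ)⁻¹ • Y)) := by
    have hst : star (r : ℂ)⁻¹ = (r : ℂ)⁻¹ := by
      rw [← Complex.ofReal_inv, Complex.star_def, Complex.conj_ofReal]
    rw [Matrix.conjTranspose_sub, Matrix.conjTranspose_smul, hst, Matrix.sub_mul, Matrix.mul_sub,
      Matrix.mul_sub, Matrix.smul_mul, Matrix.smul_mul, Matrix.mul_smul, Matrix.mul_smul, hZ, hNZ,
      hZN, hNN, smul_smul (r : ℂ)⁻¹ (r : ℂ), inv_mul_cancel₀ hr', one_smul, sub_self, sub_zero,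
      smul_sub, smul_smul, mul_inv_cancel₀ hr', one_smul]
  rw [key]
  exact IsPosMatrix.smul ⟨_, inferInstance, _, rfl⟩ hr.le

/-! ### The twist -/

section Twist

variable {σ : Bimodule A I} {τ : Bimodule A P} {S : P → I → A.quasi}

/-- X passes S* as τ(σ(X)). As σ fixes X, this acts as τ(X), which joins the row x. -/
lemma IsPair.mul_sum_star_act (h : IsPair σ τ S) {X : A.quasi} (hX : σ.Fixes X) (x : I → A.quasi)
    (j : I) : X * ∑ p, star (S p j) * act τ S x p =
      ∑ p, star (S p j) * act τ S (fun i => X * x i) p := by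
  have h1 : ∀ p, X * star (S p j) = ∑ r, star (S r j) * τ X r p := by
    intro p
    have h2 : ∀ r, star (S r j) = ∑ q, ∑ i, star (S q i) * τ (σ 1 i j) q r := fun r => by
      rw [← h.mul_star, one_mul]
    simp only [h.mul_star, fun i => (hX i j).1, ← fun i => (hX i j).2]
    conv_rhs => enter [2, r]; rw [h2]
    simp only [mul_apply', Finset.mul_sum, Finset.sum_mul, mul_assoc]
    exact sum_rotate₃ _
  simp only [Finset.mul_sum, ← mul_assoc, h1, act_mul_left, Finset.sum_mul]
  rw [Finset.sum_comm]

/-- The factor σ(W*) leaves the left inverse by the bimodule property; only W remains inside. -/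
lemma IsPair.slice_exchange (h : IsPair σ τ S) (W : Matrix K I A.quasi) (j j' : I) :
    slice τ S (exchange σ W) j j' = ∑ k, star (W k j) * ∑ p, star (S p j') * act τ S (W k) p := by
  have e : (Matrix.of fun i i' => exchange σ W (i, j) (i', j')) =
      (Matrix.of fun i k => σ (star (W k j)) i j') * W := by
    ext1 i i'
    rw [Matrix.mul_apply]
    rfl
  rw [slice_apply, e, sand_mul]
  refine Finset.sum_congr rfl fun k _ => ?_
  rw [Finset.mul_sum]
  refine Finset.sum_congr rfl fun p _ => ?_
  have e2 : (fun i => star ((Matrix.of fun i k => σ (star (W k j)) i j') i k)) = σ (W k j) j' := by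
    ext1 i
    rw [Matrix.of_apply, ← star_apply', star_star]
  rw [e2, h, star_mul, mul_assoc]

/-- The operator `S*(ε(σ, σ))S` is the scalar `κ`. -/
def HasTwist (σ : Bimodule A I) (τ : Bimodule A P) (S : P → I → A.quasi) (κ : ℂ) : Prop :=
  slice τ S (braid σ σ) = κ • σ 1

/-- The twist is the scalar by which the left inverse acts on a charge transporter to a spacelike
cone; in this form it can be computed for products. -/
lemma IsPair.hasTwist_of_unitary (h : IsPair σ τ S) (hσ : σ.IsObj) {σ' : Bimodule A K}
    {W : Matrix K I A.quasi} (hW : σ.IsUnitaryArrow σ' W) {o o' : DoubleCone}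
    (ho : σ.LocalizedIn o) (ho' : σ'.LocalizedIn o') (hp : o'.Perp o) {κ : ℂ}
    (hκ : ∀ k j, ∑ p, star (S p j) * act τ S (W k) p = κ • W k j) : HasTwist σ τ S κ := by
  rw [HasTwist, hσ.braid_eq hW ho' ho hp, ← hW.isIsometry.star_mul_self]
  ext1 j j'
  rw [h.slice_exchange, Matrix.smul_apply, Matrix.mul_apply, Finset.smul_sum]
  exact Finset.sum_congr rfl fun k _ => by rw [hκ, mul_smul_comm]; rfl

/-- The converse to `IsPair.hasTwist_of_unitary`: multiplying the sliced exchange by W produces W W*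
= σ'(1), which σ fixes and which is therefore moved inside and absorbed by W. -/
lemma HasTwist.sum_star_act {κ : ℂ} (hκ : HasTwist σ τ S κ) (h : IsPair σ τ S) (hσ : σ.IsObj)
    {σ' : Bimodule A K} {W : Matrix K I A.quasi} (hW : σ.IsUnitaryArrow σ' W) {o o' : DoubleCone}
    (ho : σ.LocalizedIn o) (ho' : σ'.LocalizedIn o') (hp : o'.Perp o) (k : K) (j : I) :
    ∑ p, star (S p j) * act τ S (W k) p = κ • W k j := by
  rw [HasTwist, hσ.braid_eq hW ho' ho hp] at hκ
  have h1 : (W * slice τ S (exchange σ W)) k j = κ • W k j := by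
    rw [hκ, Matrix.mul_smul, hW.isIsometry.isArrow.mul_one, Matrix.smul_apply]
  simp only [Matrix.mul_apply, h.slice_exchange] at h1
  rw [← h1]
  have h2 : ∀ l, ∑ p, star (S p j) * act τ S (fun i => σ' 1 k l * W l i) p =
      ∑ i, W k i * (star (W l i) * ∑ p, star (S p j) * act τ S (W l) p) := by
    intro l
    rw [← h.mul_sum_star_act (ho.fixes hp (ho'.one_mem k l)), ← hW.mul_star_self, Matrix.mul_apply,
      Finset.sum_mul]
    exact Finset.sum_congr rfl fun i _ => by rw [mul_assoc]; rfl
  have h3 : W k = ∑ l, fun i => σ' 1 k l * W l i := by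
    ext1 i
    rw [Finset.sum_apply, ← Matrix.mul_apply, hW.isIsometry.isArrow.one_mul]
  have h4 : ∀ p, act τ S (W k) p = ∑ l, act τ S (fun i => σ' 1 k l * W l i) p := fun p => by
    rw [h3, map_sum, Finset.sum_apply]
  refine (Finset.sum_congr rfl fun p _ => congrArg (star (S p j) * ·) (h4 p)).trans ?_
  simp only [Finset.mul_sum]
  rw [Finset.sum_comm]
  simp only [h2, Finset.mul_sum]
  rw [Finset.sum_comm]

/-- Naturality of the symmetry in both arguments moves V and V* from one tensor factor to the other.
-/
lemma IsObj.braid_restrict {γ : Bimodule A J} (hγ : γ.IsObj) (hσ : σ.IsObj) {V : Matrix I J A.quasi}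
    (hV : γ.IsArrow σ V) (i i' : I) (j k : J) :
    ∑ b, (∑ a, V i a * braid γ γ (a, j) (b, k)) * star (V i' b) =
      (lt σ Vᴴ * braid σ σ * lt σ V) (i, j) (i', k) := by
  have h1 := fun b => hγ.braid_natural_right hγ hσ hV i j b k
  have h2 := fun x y => hσ.braid_natural_left hγ hσ hV.conjTranspose i j x y
  have h3 : ∀ X x, ∑ b, γ X x b * star (V i' b) = ∑ z, Vᴴ x z * σ X z i' := fun X x =>
    (hV.conjTranspose.entry X x i').symm
  simp only [h1]
  rw [Matrix.mul_apply]
  simp only [h2, Matrix.mul_apply, Fintype.sum_prod_type, lt_apply, Finset.sum_mul, mul_assoc]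
  calc ∑ b, ∑ x, ∑ y, braid γ σ (i, j) (x, y) * (γ (V y k) x b * star (V i' b))
      = ∑ x, ∑ y, braid γ σ (i, j) (x, y) * ∑ z, Vᴴ x z * σ (V y k) z i' := by
        simp only [← h3, Finset.mul_sum]
        exact (sum_rotate₃ _).trans (sum_rotate₃ _)
    _ = _ := by
        simp only [Finset.mul_sum]
        refine (sum_rotate₃ _).trans (Finset.sum_congr rfl fun z _ => ?_)
        rw [Finset.sum_comm]

lemma HasTwist.restrict {κ : ℂ} (hκ : HasTwist σ τ S κ) (h : IsPair σ τ S) (hσ : σ.IsObj)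
    {γ : Bimodule A J} (hγ : γ.IsObj) {V : Matrix I J A.quasi} (hV : γ.IsIsometry σ V) :
    HasTwist γ τ (restrictPair τ S V) κ := by
  have e : slice τ (restrictPair τ S V) (braid γ γ) =
      slice τ S (lt σ Vᴴ * braid σ σ * lt σ V) := by
    ext1 j k
    rw [slice_apply, sand_restrictPair, slice_apply]
    congr 1
    ext1 i i'
    exact hγ.braid_restrict hσ hV.isArrow i i' j k
  rw [HasTwist, e, h.slice_mul_lt, h.slice_lt_mul, hκ, Matrix.mul_smul,
    hV.isArrow.conjTranspose.mul_one, Matrix.smul_mul, hV.star_mul_self]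

end Twist

/-- The factors are transported to mutually spacelike cones a₁, a₂ inside a cone spacelike to both
objects. The transporter of the product is then W₂W₁ entry by entry, and the two left inverses
extract κ₁ and κ₂ one after the other. -/
lemma HasTwist.prod {σ₁ : Bimodule A I} {σ₂ : Bimodule A J} {τ₁ : Bimodule A P} {τ₂ : Bimodule A Q}
    {S₁ : P → I → A.quasi} {S₂ : Q → J → A.quasi} {κ₁ κ₂ : ℂ} (hκ₁ : HasTwist σ₁ τ₁ S₁ κ₁)
    (hκ₂ : HasTwist σ₂ τ₂ S₂ κ₂) (h₁ : IsPair σ₁ τ₁ S₁) (h₂ : IsPair σ₂ τ₂ S₂) (hσ₁ : σ₁.IsObj)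
    (hσ₂ : σ₂.IsObj) :
    HasTwist (σ₁.tensor σ₂) (τ₂.tensor τ₁) (prodPair τ₂ S₁ S₂) (κ₁ * κ₂) := by
  obtain ⟨o₁, ho₁⟩ := hσ₁.localized
  obtain ⟨o₂, ho₂⟩ := hσ₂.localized
  obtain ⟨c, hc₁, hc₂⟩ := DoubleCone.exists_sup o₁ o₂
  obtain ⟨c', hc'⟩ := DoubleCone.exists_perp_to c
  obtain ⟨a₁, a₂, ha₁, ha₂, ha⟩ := DoubleCone.exists_perp_sub c'
  replace ho₁ := ho₁.mono hc₁
  replace ho₂ := ho₂.mono hc₂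
  obtain ⟨n₁, σ₁', W₁, hl₁, hW₁⟩ := hσ₁.transportable a₁
  obtain ⟨n₂, σ₂', W₂, hl₂, hW₂⟩ := hσ₂.transportable a₂
  have p₁ : a₁.Perp c := hc'.mono ha₁
  have p₂ : a₂.Perp c := hc'.mono ha₂
  have f₁ : ∀ k j, σ₁'.Fixes (W₂ k j) :=
    hσ₂.fixes_arrow hW₂.isIsometry.isArrow ho₂ hl₂ hl₁ p₁.symm ha.symm
  have f₂ : ∀ k j, σ₂'.Fixes (W₁ k j) :=
    hσ₁.fixes_arrow hW₁.isIsometry.isArrow ho₁ hl₁ hl₂ p₂.symm ha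
  have w : ∀ k₁ k₂ j₁ j₂, tensorArrow σ₁ W₁ W₂ (k₁, k₂) (j₁, j₂) = W₂ k₂ j₂ * W₁ k₁ j₁ :=
    fun k₁ k₂ j₁ j₂ => hW₁.isIsometry.isArrow.entry_fixes (f₁ k₂ j₂) k₁ j₁
  refine (h₁.prod h₂).hasTwist_of_unitary (hσ₁.tensor hσ₂) (hW₁.tensor hW₂) (ho₁.tensor ho₂)
    ((hl₁.mono ha₁).tensor (hl₂.mono ha₂)) hc' ?_
  rintro ⟨k₁, k₂⟩ ⟨j₁, j₂⟩
  have e1 : ∀ j' p, act τ₁ S₁ (fun i => tensorArrow σ₁ W₁ W₂ (k₁, k₂) (i, j')) p =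
      act τ₁ S₁ (W₁ k₁) p * W₂ k₂ j' := fun j' p => h₁.act_vecMul (W₁ k₁) (W₂ k₂ j') p
  have e2 : ∀ j', ∑ p, star (S₁ p j₁) * act τ₁ S₁
      (fun i => tensorArrow σ₁ W₁ W₂ (k₁, k₂) (i, j')) p =
      κ₁ • (W₂ k₂ ᵥ* σ₂ (W₁ k₁ j₁)) j' := by
    intro j'
    have e3 : (W₂ k₂ ᵥ* σ₂ (W₁ k₁ j₁)) j' = W₁ k₁ j₁ * W₂ k₂ j' :=
      hW₂.isIsometry.isArrow.entry_fixes (f₂ k₁ j₁) k₂ j'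
    simp only [e1, e3, ← mul_assoc]
    rw [← Finset.sum_mul, hκ₁.sum_star_act h₁ hσ₁ hW₁ ho₁ hl₁ p₁, smul_mul_assoc]
  have e4 : ∀ q', act τ₂ S₂ (κ₁ • W₂ k₂ ᵥ* σ₂ (W₁ k₁ j₁)) q' = ∑ p, ∑ q,
      τ₂ (star (S₁ p j₁)) q' q * act τ₂ S₂
        (fun j' => act τ₁ S₁ (fun i => tensorArrow σ₁ W₁ W₂ (k₁, k₂) (i, j')) p) q := by
    intro q'
    have e5 : κ₁ • W₂ k₂ ᵥ* σ₂ (W₁ k₁ j₁) = ∑ p, fun j' => star (S₁ p j₁) *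
        act τ₁ S₁ (fun i => tensorArrow σ₁ W₁ W₂ (k₁, k₂) (i, j')) p := by
      ext1 j'
      rw [Finset.sum_apply]
      exact (e2 j').symm
    rw [e5, map_sum, Finset.sum_apply]
    exact Finset.sum_congr rfl fun p _ => act_mul_left _ _ _ _ _
  have e6 : ∑ q, star (S₂ q j₂) * act τ₂ S₂ (κ₁ • W₂ k₂ ᵥ* σ₂ (W₁ k₁ j₁)) q =
      (κ₁ * κ₂) • (W₂ k₂ j₂ * W₁ k₁ j₁) := by
    simp only [map_smul, Pi.smul_apply, h₂.act_vecMul, mul_smul_comm, ← mul_assoc]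
    rw [← Finset.smul_sum, ← Finset.sum_mul, hκ₂.sum_star_act h₂ hσ₂ hW₂ ho₂ hl₂ p₂,
      smul_mul_assoc, smul_smul]
  rw [w, ← e6]
  simp only [e4, act_prodPair, prodPair, Fintype.sum_prod_type, star_sum, star_mul, ← star_apply',
    Finset.sum_mul, Finset.mul_sum, mul_assoc]
  refine (sum_rotate₃ _).trans (Finset.sum_congr rfl fun q _ => ?_)
  rw [Finset.sum_comm]

end Bimodule

end Twist

end Sectors

namespace Sectors

section Tower

variable {H : Type*} [NormedAddCommGroup H] [InnerProductSpace ℂ H] [CompleteSpace H]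
  {A : LocalNet H} {I J K L M P Q : Type} [Fintype I] [Fintype J] [Fintype K] [Fintype L]
  [Fintype M] [Fintype P] [Fintype Q]

lemma IsPosMatrix.submatrix {T : Matrix I I A.quasi} (h : IsPosMatrix T) (f : J → I) :
    IsPosMatrix (T.submatrix f f) := by
  obtain ⟨K, _, Z, rfl⟩ := h
  exact ⟨K, inferInstance, Z.submatrix id f, rfl⟩

namespace Bimodule

/-! ### The tower of tensor powers -/

/-- The identification of multi-indices `(i₀, i₁), i` with multi-indices. -/
def consEquiv₂ (I : Type) (n : ℕ) : (I × I) × (Fin n → I) ≃ (Fin (n + 2) → I) :=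
  (Equiv.prodAssoc _ _ _).trans
    ((Equiv.prodCongr (Equiv.refl _) (Fin.consEquiv fun _ => I)).trans (Fin.consEquiv fun _ => I))

/-- The identification of multi-indices `(i₀, (i₁, i₂)), i` with multi-indices. -/
def consEquiv₃ (I : Type) (n : ℕ) : (I × (I × I)) × (Fin n → I) ≃ (Fin (n + 3) → I) :=
  (Equiv.prodAssoc _ _ _).trans
    ((Equiv.prodCongr (Equiv.refl _) (consEquiv₂ I n)).trans (Fin.consEquiv fun _ => I))

lemma submatrix_symm_mul (e : I ≃ J) (S T : Matrix I I A.quasi) :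
    S.submatrix e.symm e.symm * T.submatrix e.symm e.symm = (S * T).submatrix e.symm e.symm :=
  Matrix.submatrix_mul_equiv _ _ _ _ _

lemma IsArrow.reindex {ρ : Bimodule A I} {σ : Bimodule A J} {T : Matrix J I A.quasi}
    (h : ρ.IsArrow σ T) (e : I ≃ K) (f : J ≃ L) :
    (ρ.reindex e).IsArrow (σ.reindex f) (T.submatrix f.symm e.symm) := by
  refine ⟨?_, ?_, fun X => ?_⟩
  · rw [reindex_eq, Matrix.submatrix_mul_equiv, h.mul_one]
  · rw [reindex_eq, Matrix.submatrix_mul_equiv, h.one_mul]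
  · rw [reindex_eq, reindex_eq, Matrix.submatrix_mul_equiv, Matrix.submatrix_mul_equiv,
      h.intertwine]

variable (ρ : Bimodule A I)

/-- The map `T ↦ 1_ρ × T` on powers. -/
noncomputable def powL (n : ℕ) : Matrix (Fin n → I) (Fin n → I) A.quasi →ₗ[ℂ]
    Matrix (Fin (n + 1) → I) (Fin (n + 1) → I) A.quasi where
  toFun T := (lt ρ T).submatrix (Fin.consEquiv fun _ => I).symm (Fin.consEquiv fun _ => I).symm
  map_add' S T := by rw [lt_add]; rfl
  map_smul' c T := by rw [lt_smul]; rfl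

lemma powL_apply (n : ℕ) (T : Matrix (Fin n → I) (Fin n → I) A.quasi) :
    ρ.powL n T =
      (lt ρ T).submatrix (Fin.consEquiv fun _ => I).symm (Fin.consEquiv fun _ => I).symm := rfl

/-- The operator `ε(ρ, ρ) × 1` on `ρ^(n + 2)`. -/
noncomputable def powS (n : ℕ) : Matrix (Fin (n + 2) → I) (Fin (n + 2) → I) A.quasi :=
  (tensorArrow (ρ.tensor ρ) (braid ρ ρ) (ρ.pow n 1)).submatrix (consEquiv₂ I n).symm
    (consEquiv₂ I n).symm

lemma powL_powL (n : ℕ) (T : Matrix (Fin n → I) (Fin n → I) A.quasi) :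
    ρ.powL (n + 1) (ρ.powL n T) = (tensorArrow (ρ.tensor ρ) ((ρ.tensor ρ) 1) T).submatrix
      (consEquiv₂ I n).symm (consEquiv₂ I n).symm := by
  rw [tensorArrow_one]
  rfl

lemma pow_succ_one (n : ℕ) : ρ.pow (n + 1) 1 = ρ.powL n (ρ.pow n 1) := rfl

lemma braidLeft_isArrow (hρ : ρ.IsObj) :
    (ρ.tensor (ρ.tensor ρ)).IsArrow (ρ.tensor (ρ.tensor ρ)) (braidLeft ρ) :=
  ((hρ.braid_isArrow hρ).tensor (IsArrow.one ρ)).reindex (Equiv.prodAssoc I I I)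
    (Equiv.prodAssoc I I I)

/-- Together with `powL_powS`, this writes neighbouring exchanges on a power as operators on the
first three factors, so that the Yang–Baxter equation on ρ³ suffices. -/
lemma powS_succ (n : ℕ) : ρ.powS (n + 1) =
    (tensorArrow (ρ.tensor (ρ.tensor ρ)) (braidLeft ρ) (ρ.pow n 1)).submatrix
      (consEquiv₃ I n).symm (consEquiv₃ I n).symm := by
  have h : ∀ (i j k : I) (l : Fin n → I) (i' j' k' : I) (l' : Fin n → I),
      ∑ q, braid ρ ρ (i, j) q * (ρ.tensor ρ) (ρ (ρ.pow n 1 l l') k k') q (i', j') =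
      ∑ q, braidLeft ρ (i, (j, k)) q *
        (ρ.tensor (ρ.tensor ρ)) (ρ.pow n 1 l l') q (i', (j', k')) := by
    intro i j k l i' j' k' l'
    have h1 : ∀ X q, (ρ.tensor ρ) (ρ X k k') q (i', j') = ∑ c, ∑ r,
        (ρ.tensor ρ) (ρ 1 k c) q r * (ρ.tensor ρ) (ρ X c k') r (i', j') := by
      intro X q
      conv_lhs => rw [← one_mul X, mul_apply', sum_apply']
      exact Finset.sum_congr rfl fun c _ => mul_apply' _ _ _ _ _
    simp only [h1, Fintype.sum_prod_type, braidLeft_apply, Finset.mul_sum, Finset.sum_mul,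
      mul_assoc]
    refine Eq.trans ?_ ((sum_rotate₅ _).trans (sum_rotate₅ _)).symm
    refine Finset.sum_congr rfl fun a _ => Finset.sum_congr rfl fun b _ => ?_
    exact (sum_rotate₃ _).symm
  ext1 f g
  exact h (f 0) (f 1) (f 2) (fun i => f i.succ.succ.succ) (g 0) (g 1) (g 2)
    (fun i => g i.succ.succ.succ)

lemma powL_powS (n : ℕ) : ρ.powL (n + 2) (ρ.powS n) =
    (tensorArrow (ρ.tensor (ρ.tensor ρ)) (lt ρ (braid ρ ρ)) (ρ.pow n 1)).submatrix
      (consEquiv₃ I n).symm (consEquiv₃ I n).symm := by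
  have h : ∀ (i : I) (j : I × I) (l : Fin n → I) (i' : I) (j' : I × I) (l' : Fin n → I),
      ρ (∑ q, braid ρ ρ j q * (ρ.tensor ρ) (ρ.pow n 1 l l') q j') i i' =
      ∑ q, lt ρ (braid ρ ρ) (i, j) q * (ρ.tensor (ρ.tensor ρ)) (ρ.pow n 1 l l') q (i', j') := by
    intro i j l i' j' l'
    rw [sum_apply', Fintype.sum_prod_type (f := fun q => lt ρ (braid ρ ρ) (i, j) q * _),
      Finset.sum_comm]
    exact Finset.sum_congr rfl fun q _ => mul_apply' _ _ _ _ _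
  ext1 f g
  exact h (f 0) (f 1, f 2) (fun i => f i.succ.succ.succ) (g 0) (g 1, g 2)
    (fun i => g i.succ.succ.succ)

variable {ρ}

/-- The tower of the tensor powers of an object. -/
noncomputable def permTower [DecidableEq I] (hρ : ρ.IsObj) :
    PermTower fun n => Matrix (Fin n → I) (Fin n → I) A.quasi where
  e n := ρ.pow n 1
  L := ρ.powL
  s := ρ.powS
  L_mul n x y := by rw [powL_apply, lt_mul, powL_apply, powL_apply, submatrix_symm_mul]
  L_star n x := by
    rw [Matrix.star_eq_conjTranspose, Matrix.star_eq_conjTranspose, powL_apply, powL_apply,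
      lt_conjTranspose]
    rfl
  L_e n := rfl
  e_mul_e n := one_mul' _ _
  star_e n := conjTranspose_one _
  e_mul_s n := by
    rw [pow_succ_one, pow_succ_one, powL_powL, powS, submatrix_symm_mul,
      tensorArrow_comp (hρ.braid_isArrow hρ), (hρ.braid_isArrow hρ).one_mul, one_mul']
  s_mul_s n := by
    rw [pow_succ_one, pow_succ_one, powL_powL, powS, submatrix_symm_mul,
      tensorArrow_comp (hρ.braid_isArrow hρ), one_mul']
    conv_lhs => enter [1, 2, 1]; rw [← hρ.braid_conjTranspose hρ]
    rw [hρ.braid_star_mul_self hρ]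
  star_s n := by
    rw [Matrix.star_eq_conjTranspose, powS, Matrix.conjTranspose_submatrix,
      tensorArrow_conjTranspose (hρ.braid_isArrow hρ), hρ.braid_conjTranspose hρ,
      conjTranspose_one]
  s_comm n x h₁ h₂ := by
    rw [powL_powL, powS, submatrix_symm_mul, submatrix_symm_mul, tensorArrow_comp (IsArrow.one _),
      tensorArrow_comp (hρ.braid_isArrow hρ), h₁, h₂, (hρ.braid_isArrow hρ).one_mul,
      (hρ.braid_isArrow hρ).mul_one]
  braid n := by
    have h1 := ρ.braidLeft_isArrow hρ
    have h2 := (hρ.braid_isArrow hρ).lt ρ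
    rw [powS_succ, powL_powS, submatrix_symm_mul, submatrix_symm_mul, submatrix_symm_mul,
      submatrix_symm_mul, tensorArrow_comp h2, tensorArrow_comp h1, tensorArrow_comp h1,
      tensorArrow_comp h2, hρ.yang_baxter]

lemma submatrix_mul_equiv' (e : I ≃ J) (S T : Matrix J J A.quasi) :
    (S * T).submatrix e e = S.submatrix e e * T.submatrix e e :=
  (Matrix.submatrix_mul_equiv _ _ _ _ _).symm

/-- The partial application of `B ↦ S* τ(B) S` to operators on powers. -/
noncomputable def powΦ (τ : Bimodule A P) (S : P → I → A.quasi) (n : ℕ) :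
    Matrix (Fin (n + 1) → I) (Fin (n + 1) → I) A.quasi →ₗ[ℂ]
      Matrix (Fin n → I) (Fin n → I) A.quasi where
  toFun T := slice τ S (T.submatrix (Fin.consEquiv fun _ => I) (Fin.consEquiv fun _ => I))
  map_add' T T' := by rw [Matrix.submatrix_add]; exact map_add _ _ _
  map_smul' c T := by rw [Matrix.submatrix_smul]; exact map_smul (slice τ S) c _

lemma powΦ_apply (τ : Bimodule A P) (S : P → I → A.quasi) (n : ℕ)
    (T : Matrix (Fin (n + 1) → I) (Fin (n + 1) → I) A.quasi) : powΦ τ S n T =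
      slice τ S (T.submatrix (Fin.consEquiv fun _ => I) (Fin.consEquiv fun _ => I)) := rfl

lemma powL_submatrix (n : ℕ) (T : Matrix (Fin n → I) (Fin n → I) A.quasi) :
    (ρ.powL n T).submatrix (Fin.consEquiv fun _ => I) (Fin.consEquiv fun _ => I) = lt ρ T := rfl

lemma IsPair.slice_tensorArrow {τ : Bimodule A P} {S : P → I → A.quasi} (h : IsPair ρ τ S)
    (E : Matrix (I × I) (I × I) A.quasi) (Y : Matrix K L A.quasi) :
    slice τ S ((tensorArrow (ρ.tensor ρ) E Y).submatrix (Equiv.prodAssoc I I K).symm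
      (Equiv.prodAssoc I I L).symm) = tensorArrow ρ (slice τ S E) Y := by
  ext1 ⟨i₂, k⟩ ⟨j₂, l⟩
  rw [slice_apply, tensorArrow_apply]
  have e : (Matrix.of fun i i' => ((tensorArrow (ρ.tensor ρ) E Y).submatrix
      (Equiv.prodAssoc I I K).symm (Equiv.prodAssoc I I L).symm) (i, (i₂, k)) (i', (j₂, l))) =
      ∑ q, (Matrix.of fun i i' => E (i, i₂) (i', q)) * ρ (ρ (Y k l) q j₂) := by
    ext1 i i'
    rw [Matrix.sum_apply]
    simp only [Matrix.mul_apply]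
    rw [Finset.sum_comm]
    exact Fintype.sum_prod_type _
  rw [e, map_sum]
  exact Finset.sum_congr rfl fun q _ => h.sand_mul_right _ _

lemma tensorArrow_smul_left (c : ℂ) (T : Matrix J I A.quasi) (Y : Matrix K L A.quasi) :
    tensorArrow ρ (c • T) Y = c • tensorArrow ρ T Y := by
  ext1 p q
  rw [Matrix.smul_apply, tensorArrow_apply, tensorArrow_apply, Finset.smul_sum]
  exact Finset.sum_congr rfl fun k _ => by rw [Matrix.smul_apply, smul_mul_assoc]

lemma submatrix_symm_submatrix (e : I ≃ J) (T : Matrix J J A.quasi) :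
    (T.submatrix e e).submatrix e.symm e.symm = T := by
  rw [Matrix.submatrix_submatrix, Equiv.self_comp_symm, Matrix.submatrix_id_id]

/-- The left inverse on the tower. -/
noncomputable def leftInv [DecidableEq I] (hρ : ρ.IsObj) {τ : Bimodule A P} {S : P → I → A.quasi}
    {S' : I → P → A.quasi} (h : IsConjugatePair ρ τ S S') {r r' : ℝ} (hr' : 0 < r')
    (hS : sand τ S (ρ 1) = (r : ℂ) • 1) (hS' : sand ρ S' (τ 1) = (r' : ℂ) • 1) {l : ℂ}
    (hl : HasTwist ρ τ S l) : (permTower hρ).LeftInv (r : ℂ) l where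
  Φ := powΦ τ S
  Pos _ T := IsPosMatrix T
  Φ_bimod n x y z := by
    change powΦ τ S n (ρ.powL n x * y * ρ.powL n z) = _
    rw [powΦ_apply, submatrix_mul_equiv', submatrix_mul_equiv', powL_submatrix, powL_submatrix,
      h.isPair.slice_mul_lt, h.isPair.slice_lt_mul]
    rfl
  Φ_e n := h.isPair.slice_one hS (ρ.pow n) 1
  Φ_s n := by
    change powΦ τ S (n + 1) (ρ.powS n) = l • ρ.pow (n + 1) 1
    have h1 := h.isPair.slice_tensorArrow (braid ρ ρ) (ρ.pow n 1)
    have h2 := congrArg (fun T => Matrix.submatrix T (Fin.consEquiv fun _ => I).symm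
      (Fin.consEquiv fun _ => I).symm) h1
    refine Eq.trans ?_ (h2.trans ?_)
    · rfl
    · rw [hl, tensorArrow_smul_left, tensorArrow_one]
      rfl
  Φ_star n x := by
    change powΦ τ S n xᴴ = (powΦ τ S n x)ᴴ
    rw [powΦ_apply, powΦ_apply, ← slice_conjTranspose]
    rfl
  pos_star_mul n x := ⟨_, inferInstance, x, rfl⟩
  pos_smul n x a ha hx := hx.smul ha
  pos_conj n x y hx := hx.conj y
  pos_neg n x hx hx' := hx.eq_zero hx'
  pos_Φ n x hx := by
    exact isPosMatrix_slice (hx.submatrix _) τ S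
  C := r'
  pimsner_popa n x hx := by
    have h1 := h.pimsner_popa hr' hS' (N := ρ.pow n 1)
      (T := x.submatrix (Fin.consEquiv fun _ => I) (Fin.consEquiv fun _ => I)) ?_
    · have h2 := h1.submatrix (Fin.consEquiv fun _ => I).symm
      rwa [Matrix.conjTranspose_submatrix, ← submatrix_mul_equiv', Matrix.submatrix_sub,
        Pi.sub_apply, Pi.sub_apply, submatrix_symm_submatrix, Matrix.submatrix_smul] at h2
    · conv_rhs => rw [← hx, submatrix_mul_equiv']
      rfl

end Bimodule

end Tower

end Sectors

namespace Sectors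

section Powers

variable {H : Type*} [NormedAddCommGroup H] [InnerProductSpace ℂ H] [CompleteSpace H]
  {A : LocalNet H} {I J K L M P Q : Type} [Fintype I] [Fintype J] [Fintype K] [Fintype L]
  [Fintype M] [Fintype P] [Fintype Q]

namespace Bimodule

/-! ### Left inverses of the powers -/

/-- The iteration of the partial application of `B ↦ S* τ(B) S`. -/
noncomputable def powSand (τ : Bimodule A P) (S : P → I → A.quasi) :
    ∀ n, Matrix (Fin n → I) (Fin n → I) A.quasi →ₗ[ℂ] A.quasi
  | 0 => Matrix.entryLinearMap ℂ A.quasi default default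
  | n + 1 => (powSand τ S n) ∘ₗ (powΦ τ S n)

variable {ρ : Bimodule A I} {τ : Bimodule A P} {S : P → I → A.quasi}

lemma isFaithfulPair_pow_zero (ρ : Bimodule A I) :
    IsFaithfulPair (ρ.pow 0) (unit A) (fun _ _ => 1) := by
  have h : ∀ x : (Fin 0 → I) → A.quasi, act (unit A) (fun _ _ => 1) x () = x default := by
    intro x
    simp only [act_apply, unit_apply, Finset.univ_unique, Finset.sum_singleton, mul_one]
  refine ⟨fun X i p => ?_, fun x hx => ?_⟩
  · rw [h, one_mul]
    rfl
  · have : x = 0 := by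
      ext1 i
      rw [Subsingleton.elim i default, ← h x, hx]
      rfl
    rw [this, Matrix.zero_vecMul]

lemma hasTwist_pow_zero (ρ : Bimodule A I) (hρ : ρ.IsObj) :
    HasTwist (ρ.pow 0) (unit A) (fun _ _ => 1) 1 := by
  obtain ⟨o, o', ho⟩ := DoubleCone.exists_perp
  obtain ⟨m, σ', W, hσ', hW⟩ := (pow_isObj hρ 0).transportable o
  refine (isFaithfulPair_pow_zero ρ).1.hasTwist_of_unitary (pow_isObj hρ 0) hW
    ((unit_localizedIn o').reindex _) hσ' ho fun k j => ?_
  simp only [act_apply, unit_apply, Finset.univ_unique, Finset.sum_singleton, mul_one, star_one,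
    one_mul, one_smul]
  rw [Subsingleton.elim j default]

/-- The powers of an object with a left inverse have left inverses. -/
theorem exists_pow_pair (hρ : ρ.IsObj) (hτ : τ.IsObj) (h : IsFaithfulPair ρ τ S) {κ : ℂ}
    (hκ : HasTwist ρ τ S κ) (n : ℕ) :
    ∃ (P' : Type) (_ : Fintype P') (τ' : Bimodule A P') (S' : P' → (Fin n → I) → A.quasi),
      τ'.IsObj ∧ IsFaithfulPair (ρ.pow n) τ' S' ∧ HasTwist (ρ.pow n) τ' S' (κ ^ n) ∧
        ∀ B, sand τ' S' B = powSand τ S n B := by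
  induction n with
  | zero =>
    refine ⟨Unit, inferInstance, unit A, fun _ _ => 1, unit_isObj, isFaithfulPair_pow_zero ρ, ?_,
      fun B => ?_⟩
    · rw [pow_zero]; exact hasTwist_pow_zero ρ hρ
    · simp only [sand_apply, act_apply, unit_apply, Finset.univ_unique, Finset.sum_singleton,
        mul_one, star_one, one_mul]
      rfl
  | succ n ih =>
    obtain ⟨P', _, τ', S', hτ', h', hκ', hs⟩ := ih
    -- ρ^(n+1) is ρρ^n with renamed multi-indices; the product pair is restricted along this
    -- unitary.
    have hV := ((ρ.tensor (ρ.pow n)).reindex_isUnitaryArrow (Fin.consEquiv fun _ => I)).symm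
    have hp := h.prod h'
    have hσ := hρ.tensor (pow_isObj hρ n)
    refine ⟨P' × P, inferInstance, τ'.tensor τ, _, hτ'.tensor hτ, hp.restrict hV.isIsometry,
      ?_, fun B => ?_⟩
    · rw [pow_succ']
      exact (hκ.prod hκ' h.1 h'.1 hρ (pow_isObj hρ n)).restrict hp.1 hσ (pow_isObj hρ (n + 1))
        hV.isIsometry
    · have e : ∀ (M : Matrix (I × (Fin n → I)) (I × (Fin n → I)) A.quasi) (e : I × (Fin n → I) ≃
          (Fin (n + 1) → I)), (M.submatrix e.symm id)ᴴ * B * (M.submatrix e.symm id)ᴴᴴ =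
          Mᴴ * B.submatrix e e * M := by
        intro M e
        have h1 : B = (B.submatrix e e).submatrix e.symm e.symm :=
          (submatrix_symm_submatrix e B).symm
        rw [Matrix.conjTranspose_conjTranspose, Matrix.conjTranspose_submatrix]
        conv_lhs => rw [h1]
        rw [Matrix.submatrix_mul_equiv, Matrix.submatrix_mul_equiv, Matrix.submatrix_id_id]
      rw [sand_restrictPair, e, conjTranspose_one, hp.1.sand_mul_right, hp.1.sand_mul_left,
        one_mul, mul_one, sand_prodPair, hs]
      rfl

/-! ### Scaling -/

lemma act_smul_right (c : ℂ) (x : I → A.quasi) (p : P) :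
    act τ (fun p i => c • S p i) x p = c • act τ S x p := by
  simp only [act_apply, Finset.smul_sum, mul_smul_comm]

lemma sand_smul_right (c : ℂ) (B : Matrix I I A.quasi) :
    sand τ (fun p i => c • S p i) B = (star c * c) • sand τ S B := by
  simp only [sand_apply, act_smul_right, star_smul, smul_mul_assoc, mul_smul_comm, smul_smul,
    Finset.smul_sum, mul_comm]

lemma slice_smul_right (c : ℂ) (T : Matrix (I × J) (I × K) A.quasi) :
    slice τ (fun p i => c • S p i) T = (star c * c) • slice τ S T := by
  ext1 j k
  rw [slice_apply, sand_smul_right]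
  rfl

lemma IsPair.smul (h : IsPair ρ τ S) (c : ℂ) : IsPair ρ τ (fun p i => c • S p i) := by
  intro X i p
  rw [act_smul_right, h, smul_mul_assoc]

lemma HasTwist.smul {κ : ℂ} (h : HasTwist ρ τ S κ) (c : ℂ) :
    HasTwist ρ τ (fun p i => c • S p i) (star c * c * κ) := by
  rw [HasTwist, slice_smul_right, h, smul_smul]

lemma IsConjugatePair.smul {S' : I → P → A.quasi} (h : IsConjugatePair ρ τ S S') {c : ℂ}
    (hc : c ≠ 0) :
    IsConjugatePair ρ τ (fun p i => c • S p i) (fun i p => star c⁻¹ • S' i p) := by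
  refine ⟨h.isPair.smul c, h.isPair'.smul _, fun b i => ?_⟩
  rw [← h.zigzag]
  refine Finset.sum_congr rfl fun p _ => Finset.sum_congr rfl fun a _ => ?_
  rw [star_smul, star_star, smul_apply', smul_mul_assoc, mul_smul_comm, smul_smul,
    inv_mul_cancel₀ hc, one_smul]

lemma IsConjugatePair.exists_scalars [Nontrivial H] {S' : I → P → A.quasi}
    (h : IsConjugatePair ρ τ S S') (h0 : ρ 1 ≠ 0) :
    ∃ r r' : ℝ, 0 < r ∧ 0 < r' ∧ sand τ S (ρ 1) = (r : ℂ) • 1 ∧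
      sand ρ S' (τ 1) = (r' : ℂ) • 1 := by
  obtain ⟨r, hr, hr0, hs⟩ := h.isPair.exists_scalar
  obtain ⟨r', hr', hr0', hs'⟩ := h.isPair'.exists_scalar
  refine ⟨r, r', lt_of_le_of_ne hr fun e => h0 ?_, lt_of_le_of_ne hr' fun e => h0 ?_, hs, hs'⟩
  · ext1 b i
    rw [← h.zigzag]
    simp [hr0 e.symm]
  · ext1 b i
    rw [← h.zigzag]
    simp [hr0' e.symm]

/-- S X = τ(ρ(X)) S vanishes with ρ(X), and S*S is a nonzero scalar. -/
lemma IsPair.eq_zero_of_apply (h : IsPair ρ τ S) {r : ℂ} (hr : r ≠ 0)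
    (hs : sand τ S (ρ 1) = r • 1) {X : A.quasi} (hX : ρ X = 0) : X = 0 := by
  have h1 : ∀ p i, S p i * X = 0 := by
    intro p i
    rw [← h X i p, hX]
    exact congrFun (map_zero (act τ S)) p
  have h2 := congrArg (· * X) hs
  simp only [h.sand_one, Finset.sum_mul, mul_assoc, h1, mul_zero, Finset.sum_const_zero,
    smul_mul_assoc, one_mul] at h2
  exact (smul_eq_zero.1 h2.symm).resolve_left hr

/-- A left inverse with `S* S = ±κ` for the twist `κ` forces `ε(γ, γ) = ±1`. -/
lemma IsFaithfulPair.braid_eq_smul (h : IsFaithfulPair ρ τ S) (hρ : ρ.IsObj)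
    (hs : sand τ S (ρ 1) = 1) {χ : ℝ} (hχ : χ * χ = 1) (hκ : HasTwist ρ τ S χ) :
    braid ρ ρ = (χ : ℂ) • (ρ.tensor ρ) 1 := by
  have hb := hρ.braid_isArrow hρ
  have hχ' : (χ : ℂ) * χ = 1 := by exact_mod_cast hχ
  rw [← sub_eq_zero]
  refine h.slice_faithful (κ := ρ) ?_ ?_
  · rw [Matrix.sub_mul, hb.mul_one, Matrix.smul_mul, one_mul']
  · have hst : star (χ : ℂ) = χ := by rw [Complex.star_def, Complex.conj_ofReal]
    -- For the self-adjoint unitary ε this square is 2 - 2χε, whose left inverse is 2 - 2χ² = 0.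
    have h1 : (braid ρ ρ - (χ : ℂ) • (ρ.tensor ρ) 1)ᴴ * (braid ρ ρ - (χ : ℂ) • (ρ.tensor ρ) 1) =
        (2 : ℂ) • (ρ.tensor ρ) 1 - (2 * χ : ℂ) • braid ρ ρ := by
      rw [Matrix.conjTranspose_sub, Matrix.conjTranspose_smul, conjTranspose_one, hst,
        Matrix.sub_mul, Matrix.mul_sub, Matrix.mul_sub, hρ.braid_star_mul_self hρ,
        hρ.braid_conjTranspose hρ, Matrix.mul_smul, hb.mul_one, Matrix.smul_mul, hb.one_mul,
        Matrix.smul_mul, Matrix.mul_smul, one_mul', smul_smul, hχ', one_smul, two_smul, two_mul,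
        add_smul]
      abel
    have h2 := h.1.slice_one (r := 1) (by rw [hs, one_smul]) ρ 1
    rw [h1, map_sub, map_smul, map_smul, h2, hκ, smul_smul, smul_smul, mul_assoc, hχ', mul_one,
      sub_self]

/-! ### Subobjects -/

/-- The subobject given by a projection. -/
noncomputable def corner (σ : Bimodule A I) (p : Matrix I I A.quasi) (hp : σ.IsArrow σ p)
    (hpp : p * p = p) (hps : pᴴ = p) : Bimodule A I where
  toFun X := p * σ X
  map_smul' c X := by rw [map_smul, Matrix.mul_smul]; rfl
  map_zero' := by rw [map_zero, Matrix.mul_zero]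
  map_add' X Y := by rw [map_add, Matrix.mul_add]
  map_mul' X Y := by
    rw [map_mul, Matrix.mul_assoc p, ← Matrix.mul_assoc (σ X) p, ← hp.intertwine,
      ← Matrix.mul_assoc, ← Matrix.mul_assoc, ← Matrix.mul_assoc, hpp]
  map_star' X := by
    rw [map_star, Matrix.star_eq_conjTranspose, Matrix.star_eq_conjTranspose,
      Matrix.conjTranspose_mul, hps, conjTranspose_apply', hp.intertwine]

section corner

variable {σ : Bimodule A I} {p : Matrix I I A.quasi} (hp : σ.IsArrow σ p) (hpp : p * p = p)
  (hps : pᴴ = p)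

lemma corner_one : corner σ p hp hpp hps 1 = p := hp.mul_one

lemma corner_isIsometry : (corner σ p hp hpp hps).IsIsometry σ p := by
  refine ⟨⟨?_, hp.one_mul, fun X => ?_⟩, ?_⟩
  · rw [corner_one, hpp]
  · change p * (p * σ X) = _
    rw [← Matrix.mul_assoc, hpp, hp.intertwine]
  · rw [corner_one, hps, hpp]

lemma LocalizedIn.corner {o : DoubleCone} (h : σ.LocalizedIn o) :
    (corner σ p hp hpp hps).LocalizedIn o := by
  intro a ha X hX i j
  rw [corner_one]
  exact hp.entry_fixes (h.fixes ha hX) i j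

lemma IsObj.corner (h : σ.IsObj) : (corner σ p hp hpp hps).IsObj := by
  obtain ⟨o, ho⟩ := h.localized
  refine ⟨⟨o, ho.corner hp hpp hps⟩, fun a => ?_⟩
  obtain ⟨m, σ', U, hσ', hU⟩ := h.transportable a
  have hUi := hU.isIsometry.isArrow
  have hUU := hU.isIsometry.star_mul_self
  have hq : σ'.IsArrow σ' (U * p * Uᴴ) := (hUi.comp hp).comp hUi.conjTranspose
  have hqq : U * p * Uᴴ * (U * p * Uᴴ) = U * p * Uᴴ := by
    calc U * p * Uᴴ * (U * p * Uᴴ) = U * p * (Uᴴ * U) * p * Uᴴ := by simp only [Matrix.mul_assoc]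
      _ = _ := by rw [hUU, Matrix.mul_assoc U, hp.mul_one, Matrix.mul_assoc U, hpp]
  have hqs : (U * p * Uᴴ)ᴴ = U * p * Uᴴ := by
    rw [Matrix.conjTranspose_mul, Matrix.conjTranspose_mul, Matrix.conjTranspose_conjTranspose,
      hps, Matrix.mul_assoc]
  refine ⟨m, Bimodule.corner σ' _ hq hqq hqs, U * p, hσ'.corner hq hqq hqs, ⟨⟨⟨?_, ?_, fun X => ?_⟩, ?_⟩, ?_⟩⟩
  · rw [corner_one, Matrix.mul_assoc, hpp]
  · rw [corner_one]
    calc U * p * Uᴴ * (U * p) = U * p * (Uᴴ * U) * p := by simp only [Matrix.mul_assoc]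
      _ = _ := by rw [hUU, Matrix.mul_assoc U, hp.mul_one, Matrix.mul_assoc U, hpp]
  · change U * p * (p * σ X) = U * p * Uᴴ * σ' X * (U * p)
    calc U * p * (p * σ X) = U * p * (σ 1 * σ X * p) := by rw [hp.intertwine, one_mul']
      _ = U * p * (Uᴴ * U) * (σ X * p) := by rw [hUU]; simp only [Matrix.mul_assoc]
      _ = U * p * Uᴴ * (U * σ X) * p := by simp only [Matrix.mul_assoc]
      _ = _ := by rw [hUi.intertwine]; simp only [Matrix.mul_assoc]
  · rw [corner_one, Matrix.conjTranspose_mul, hps, Matrix.mul_assoc, ← Matrix.mul_assoc Uᴴ, hUU,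
      hp.one_mul, hpp]
  · rw [corner_one, Matrix.conjTranspose_mul, hps, Matrix.mul_assoc, ← Matrix.mul_assoc p p, hpp,
      ← Matrix.mul_assoc]

end corner

end Bimodule

end Powers

end Sectors

namespace Sectors

section Statistics

variable {H : Type*} [NormedAddCommGroup H] [InnerProductSpace ℂ H] [CompleteSpace H]
  {A : LocalNet H} {I J K L M P Q : Type} [Fintype I] [Fintype J] [Fintype K] [Fintype L]
  [Fintype M] [Fintype P] [Fintype Q]

namespace Bimodule

/-! ### The permutation group acts by arrows -/

section Arrows

variable [DecidableEq I] {ρ : Bimodule A I} (hρ : ρ.IsObj)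

lemma powL_isArrow {n : ℕ} {T : Matrix (Fin n → I) (Fin n → I) A.quasi}
    (h : (ρ.pow n).IsArrow (ρ.pow n) T) : (ρ.pow (n + 1)).IsArrow (ρ.pow (n + 1)) (ρ.powL n T) :=
  (h.lt ρ).reindex _ _

lemma powS_isArrow (hρ : ρ.IsObj) (n : ℕ) :
    (ρ.pow (n + 2)).IsArrow (ρ.pow (n + 2)) (ρ.powS n) :=
  ((hρ.braid_isArrow hρ).tensor (IsArrow.one (ρ.pow n))).reindex (consEquiv₂ I n) (consEquiv₂ I n)

lemma permTower_t_isArrow (n : ℕ) (k : Fin (n + 1)) :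
    (ρ.pow (n + 1)).IsArrow (ρ.pow (n + 1)) ((permTower hρ).t n k) := by
  induction n with
  | zero => exact IsArrow.one _
  | succ n ih =>
    refine Fin.cases (IsArrow.one _) (fun j => ?_) k
    exact ((powL_isArrow (ih j)).comp (powS_isArrow hρ n)).comp (powL_isArrow (ih j))

lemma permTower_u_isArrow (n : ℕ) (p : Equiv.Perm (Fin n)) :
    (ρ.pow n).IsArrow (ρ.pow n) ((permTower hρ).u n p) := by
  induction n with
  | zero => exact IsArrow.one _
  | succ n ih => exact (permTower_t_isArrow hρ n _).comp (powL_isArrow (ih _))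

lemma permTower_E_isArrow (c : ℂ) (n : ℕ) :
    (ρ.pow n).IsArrow (ρ.pow n) ((permTower hρ).E c n) :=
  (IsArrow.sum fun p _ => (permTower_u_isArrow hρ n p).smul _).smul _

end Arrows

/-- For r = d and l = -c the recursion factors are (d - k)/(k + 1), and their product over k < n is
the binomial coefficient. -/
lemma powSand_E [DecidableEq I] {ρ : Bimodule A I} (hρ : ρ.IsObj) {τ : Bimodule A P}
    {S : P → I → A.quasi} {d : ℕ} {c : ℂ} (hc : c * c = 1)
    (F : (permTower hρ).LeftInv d (-c)) (hF : F.Φ = powΦ τ S) {n : ℕ} (hn : n ≤ d) :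
    powSand τ S n ((permTower hρ).E c n) = ((d.choose n : ℕ) : ℂ) • (1 : A.quasi) := by
  induction n with
  | zero =>
    rw [PermTower.E_zero, Nat.choose_zero_right, Nat.cast_one, one_smul]
    rfl
  | succ n ih =>
    have h1 := F.Φ_E hc n
    rw [hF] at h1
    change powSand τ S n (powΦ τ S n ((permTower hρ).E c (n + 1))) = _
    rw [h1, map_smul, ih (by omega), smul_smul]
    congr 1
    have h2 := Nat.choose_succ_right_eq d n
    have h3 : ((d.choose (n + 1) : ℕ) : ℂ) * (n + 1) = (d.choose n : ℕ) * (d - n) := by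
      rw [← Nat.cast_sub (by omega)]
      exact_mod_cast h2
    have h4 : ((n : ℂ) + 1) ≠ 0 := by exact_mod_cast n.succ_ne_zero
    rw [div_mul_eq_mul_div, div_eq_iff h4, h3]
    linear_combination (-(n : ℂ) * (d.choose n : ℕ)) * hc

/-- A conjugate pair can be rescaled in such a way that its dimension is an integer. -/
theorem IsConjugatePair.exists_normalized [Nontrivial H] [DecidableEq I] {ρ : Bimodule A I}
    (hρ : ρ.IsObj) (h0 : ρ 1 ≠ 0)
    (hirr : ∀ T, ρ.IsArrow ρ T → ∃ c : ℂ, T = c • ρ 1) {τ : Bimodule A P}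
    {S : P → I → A.quasi} {S' : I → P → A.quasi} (h : IsConjugatePair ρ τ S S') :
    ∃ (d : ℕ) (c : ℝ) (S : P → I → A.quasi), 1 ≤ d ∧ (c = 1 ∨ c = -1) ∧
      IsFaithfulPair ρ τ S ∧ HasTwist ρ τ S (-c : ℂ) ∧
      ∀ n ≤ d, powSand τ S n ((permTower hρ).E c n) = ((d.choose n : ℕ) : ℂ) • (1 : A.quasi) := by
  obtain ⟨r, r', hr, hr', hs, hs'⟩ := h.exists_scalars h0
  obtain ⟨l, hl⟩ := hirr _ (h.isPair.slice_isArrow (hρ.braid_isArrow hρ))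
  have he : (permTower hρ).e 1 ≠ 0 := by
    intro e
    apply h0
    ext1 i j
    have := congrFun (congrFun e fun _ => i) fun _ => j
    exact this
  obtain ⟨d, c, hd, hc, l', hl', h1, h2⟩ :=
    (leftInv hρ h hr' hs hs' hl).exists_dimension ⟨r, hr, rfl⟩ he
  -- Scaling S by the inverse square root of l' changes (r, l) from (d l', -c l') to (d, -c).
  obtain ⟨t, ht⟩ : ∃ t : ℝ, t = (Real.sqrt l')⁻¹ := ⟨_, rfl⟩
  have ht0 : t ≠ 0 := by rw [ht]; exact inv_ne_zero (Real.sqrt_pos.2 hl').ne'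
  have htt : star (t : ℂ) * t = (l' : ℂ)⁻¹ := by
    rw [Complex.star_def, Complex.conj_ofReal, ← Complex.ofReal_mul, ht, ← mul_inv,
      Real.mul_self_sqrt hl'.le, Complex.ofReal_inv]
  have hl'0 : (l' : ℂ) ≠ 0 := by exact_mod_cast hl'.ne'
  have h' := h.smul (c := (t : ℂ)) (by exact_mod_cast ht0)
  have hs1 : sand τ (fun p i => (t : ℂ) • S p i) (ρ 1) = ((d : ℝ) : ℂ) • 1 := by
    rw [sand_smul_right, hs, smul_smul, htt, h2]
    congr 1
    push_cast
    field_simp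
  have hl1 : HasTwist ρ τ (fun p i => (t : ℂ) • S p i) (-c : ℂ) := by
    have := HasTwist.smul (ρ := ρ) (τ := τ) hl (t : ℂ)
    rw [htt, h1] at this
    convert this using 1
    push_cast
    field_simp
  -- The partner S' was scaled inversely, so the Pimsner–Popa constant is taken afresh.
  obtain ⟨r₁, r₁', _, hr₁', _, hs₁'⟩ := h'.exists_scalars h0
  refine ⟨d, c, _, hd, hc, h'.isFaithfulPair, hl1, fun n hn => ?_⟩
  have hcc : (c : ℂ) * c = 1 := by rcases hc with h | h <;> rw [h] <;> norm_num
  exact powSand_E hρ hcc (leftInv hρ h' hr₁' (by simpa using hs1) hs₁' hl1) rfl hn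

end Bimodule

/-! ### Statistics triples of irreducible objects -/

open Bimodule

lemma Bimodule.IsUnitaryArrow.toMorphism {ρ : Bimodule A I} {σ : Bimodule A J}
    {U : Matrix J I A.quasi} (h : ρ.IsUnitaryArrow σ U) :
    ρ.toMorphism.IsUnitary σ.toMorphism (toOp U) := by
  have hi := h.isIsometry.isArrow
  refine ⟨⟨?_, ?_, fun X => ?_⟩, ?_, ?_⟩
  · exact (toOp_mul _ _).symm.trans (congrArg toOp hi.mul_one)
  · exact (toOp_mul _ _).symm.trans (congrArg toOp hi.one_mul)
  · exact (toOp_mul _ _).symm.trans ((congrArg toOp (hi.intertwine X)).trans (toOp_mul _ _))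
  · rw [← toOp_conjTranspose, ← toOp_mul, h.isIsometry.star_mul_self]
    rfl
  · rw [← toOp_conjTranspose, ← toOp_mul, h.mul_star_self]
    rfl

/-- A localized transportable bimodule as an object. -/
noncomputable def Bimodule.IsObj.toObj {n : ℕ} {σ : Bimodule A (Fin n)} (h : σ.IsObj) : Obj A n where
  bim := σ
  localized := by
    obtain ⟨o, ho⟩ := h.localized
    exact ⟨o, (toMorphism_localizedIn _ _).2 ho⟩
  transportable o := by
    obtain ⟨m, τ, U, hτ, hU⟩ := h.transportable o
    exact ⟨m, τ.toMorphism, toOp U, (toMorphism_localizedIn _ _).2 hτ, hU.toMorphism⟩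

lemma adjacentExchange_zero {n : ℕ} (ρ : Obj A n) (d : ℕ) :
    adjacentExchange ρ (d + 2) 0 = ρ.bim.powS d := by
  rw [adjacentExchange, symmetry_eq_braid]
  rfl

lemma adjacentExchange_succ {n : ℕ} (ρ : Obj A n) (d k : ℕ) :
    adjacentExchange ρ (d + 1) (k + 1) = ρ.bim.powL d (adjacentExchange ρ d k) := by
  rw [adjacentExchange, tensorArrow_one]
  rfl

lemma isPermutationRep_u {n : ℕ} (ρ : Obj A n) (d : ℕ) :
    IsPermutationRep ρ d ((permTower ρ.isObj).u d) := by
  refine ⟨(permTower ρ.isObj).u_one d, (permTower ρ.isObj).u_mul d, fun k => ?_⟩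
  induction k generalizing d with
  | zero =>
    intro hk
    obtain ⟨d, rfl⟩ : ∃ d', d = d' + 2 := ⟨d - 2, by omega⟩
    rw [adjacentExchange_zero]
    exact ((permTower ρ.isObj).u_swap (d + 1) 1).trans ((permTower ρ.isObj).t_one d)
  | succ k ih =>
    intro hk
    obtain ⟨d, rfl⟩ : ∃ d', d = d' + 1 := ⟨d - 1, by omega⟩
    rw [adjacentExchange_succ, ← ih d (by omega)]
    refine Eq.trans ?_ ((permTower ρ.isObj).u_lift d _)
    rw [liftPerm_swap]
    rfl

/-- Irreducible objects with conjugates have finite statistics. -/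
theorem exists_isStatisticsTriple [Nontrivial H] {n : ℕ} {ρ : Obj A n} (hirr : ρ.Irreducible)
    {τ : Bimodule A P} (hτ : τ.IsObj) {S : P → Fin n → A.quasi} {S' : Fin n → P → A.quasi}
    (h : IsConjugatePair ρ.bim τ S S') :
    ∃ (d m : ℕ) (γ : Obj A m) (V : Matrix (Fin d → Fin n) (Fin m) A.quasi),
      IsStatisticsTriple ρ d γ V := by
  obtain ⟨d, c, S, hd, hc, hS, hκ, hE⟩ := h.exists_normalized ρ.isObj hirr.1 hirr.2
  have hcc : (c : ℂ) * c = 1 := by rcases hc with h | h <;> rw [h] <;> norm_num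
  obtain ⟨P', _, τ', S', hτ', h', hκ', hs⟩ := exists_pow_pair ρ.isObj hτ hS hκ d
  set T := permTower ρ.isObj with hT
  have hst : star (c : ℂ) = c := by rw [Complex.star_def, Complex.conj_ofReal]
  have hp := permTower_E_isArrow ρ.isObj c d
  have hpp := T.E_mul_E hcc d
  have hps : (T.E c d)ᴴ = T.E c d := T.star_E hst d
  have hγ₀ := (pow_isObj ρ.isObj d).corner hp hpp hps
  -- Objects carry indices in some `Fin m`, so the multi-indices of ρ^d are renumbered.
  set e := Fintype.equivFin (Fin d → Fin n)
  have hγ := hγ₀.reindex e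
  have hU := (reindex_isUnitaryArrow (corner (ρ.bim.pow d) _ hp hpp hps) e).symm
  have hV := (corner_isIsometry hp hpp hps).comp hU.isIsometry
  have hVV : ∀ W, W = T.E c d * (((corner (ρ.bim.pow d) _ hp hpp hps) 1).submatrix e.symm id)ᴴ →
      W * Wᴴ = T.E c d := by
    rintro W rfl
    rw [Matrix.conjTranspose_mul, hps, Matrix.mul_assoc, ← Matrix.mul_assoc _ _ (T.E c d),
      hU.mul_star_self, corner_one, hpp, hpp]
  replace hVV := hVV _ rfl
  set V := T.E c d * (((corner (ρ.bim.pow d) _ hp hpp hps) 1).submatrix e.symm id)ᴴ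
  have hSγ := h'.restrict hV
  have hκγ := hκ'.restrict h'.1 (pow_isObj ρ.isObj d) hγ hV
  -- The left inverse of γ is normalized because its value on E_d is the binomial coefficient of d
  -- over d.
  have hsγ : sand τ' (restrictPair τ' S' V)
      (((corner (ρ.bim.pow d) _ hp hpp hps).reindex e) 1) = 1 := by
    rw [sand_restrictPair, hV.isArrow.mul_one, hVV, hs, hE d le_rfl, Nat.choose_self, Nat.cast_one,
      one_smul]
  -- The twist is multiplicative and survives restriction, so γ inherits (-c)^d, a sign.
  have hχ : ((-c) ^ d) * ((-c) ^ d) = 1 := by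
    rw [← mul_pow]
    have : -c * -c = 1 := by rcases hc with h | h <;> rw [h] <;> norm_num
    rw [this, one_pow]
  have hb := hSγ.braid_eq_smul hγ hsγ hχ (by push_cast; exact hκγ)
  refine ⟨d, _, hγ.toObj, V, hd, ?_, ?_, hV, T.u d, isPermutationRep_u ρ d, ?_⟩
  · rw [Obj.Simple, symmetry_eq_braid]
    rcases mul_self_eq_one_iff.1 hχ with h | h
    · left
      rw [h, Complex.ofReal_one, one_smul] at hb
      exact hb
    · right
      rw [h, Complex.ofReal_neg, Complex.ofReal_one, neg_one_smul] at hb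
      exact hb
  · intro X hX
    exact hSγ.1.eq_zero_of_apply one_ne_zero (by rw [hsγ, one_smul]) hX
  · rw [hVV, PermTower.E]
    rcases hc with rfl | rfl
    · right
      simp [PermTower.chi]
    · left
      congr 1
      refine Finset.sum_congr rfl fun p _ => ?_
      congr 1
      rw [PermTower.chi]
      rcases Int.units_eq_one_or (Equiv.Perm.sign p) with h | h <;> simp [h]

/-- The simple objects of the triples have faithful left inverses. -/
theorem IsStatisticsTriple.exists_pair [Nontrivial H] {n : ℕ} {ρ : Obj A n} (hirr : ρ.Irreducible)
    {τ : Bimodule A P} (hτ : τ.IsObj) {S : P → Fin n → A.quasi} {S' : Fin n → P → A.quasi}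
    (h : IsConjugatePair ρ.bim τ S S') {d m : ℕ} {γ : Obj A m}
    {V : Matrix (Fin d → Fin n) (Fin m) A.quasi} (hV : IsStatisticsTriple ρ d γ V) :
    ∃ (P' : Type) (_ : Fintype P') (τ' : Bimodule A P') (S' : P' → Fin m → A.quasi),
      τ'.IsObj ∧ IsFaithfulPair γ.bim τ' S' := by
  obtain ⟨d₀, c, S, hd, hc, hS, hκ, hE⟩ := h.exists_normalized ρ.isObj hirr.1 hirr.2
  -- The exponent d is that of the given triple and need not equal d₀: every power of ρ has a
  -- faithful pair, and γ inherits it through V.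
  obtain ⟨P', _, τ', S', hτ', h', -⟩ := exists_pow_pair ρ.isObj hτ hS hκ d
  exact ⟨P', inferInstance, τ', _, hτ', h'.restrict hV.isIsometry⟩

end Statistics

end Sectors

namespace Sectors

section FiniteDimension

/-! ### Finite dimension -/

/-- Gram–Schmidt turns a linearly independent family into an orthonormal one of the same size. -/
lemma finiteDimensional_of_orthonormal_le {E : Type*} [AddCommGroup E] [Module ℂ E]
    (c : InnerProductSpace.Core ℂ E) (k : ℕ)
    (h : ∀ (m : ℕ) (v : Fin m → E), (∀ i j, c.inner (v i) (v j) = if i = j then 1 else 0) →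
      m ≤ k) : FiniteDimensional ℂ E := by
  let := c
  let : NormedAddCommGroup E := InnerProductSpace.Core.toNormedAddCommGroup (𝕜 := ℂ)
  let : InnerProductSpace ℂ E := InnerProductSpace.ofCore c.toCore
  have hr : Module.rank ℂ E ≤ k := by
    refine rank_le fun s hs => ?_
    have h1 : LinearIndependent ℂ (fun i : Fin s.card => (s.equivFin.symm i : E)) :=
      hs.comp _ s.equivFin.symm.injective
    have h2 := InnerProductSpace.gramSchmidtNormed_orthonormal (𝕜 := ℂ) h1
    exact h _ _ (orthonormal_iff_ite.1 h2)
  exact Module.rank_lt_aleph0_iff.1 (hr.trans_lt Cardinal.natCast_lt_aleph0)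

lemma exists_orthogonal_projection {E : Type*} [AddCommGroup E] [Module ℂ E]
    (c : InnerProductSpace.Core ℂ E) [FiniteDimensional ℂ E] (K : Submodule ℂ E) (p : E) :
    ∃ q ∈ K, ∀ k ∈ K, c.inner (q - p) k = 0 := by
  let := c
  let : NormedAddCommGroup E := InnerProductSpace.Core.toNormedAddCommGroup (𝕜 := ℂ)
  let : InnerProductSpace ℂ E := InnerProductSpace.ofCore c.toCore
  refine ⟨K.starProjection p, K.starProjection_apply_mem p, fun k hk => ?_⟩
  have h : ⟪p - K.starProjection p, k⟫_ℂ = 0 := K.starProjection_inner_eq_zero p k hk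
  rw [← neg_sub, inner_neg_left, neg_eq_zero] at h
  exact h

variable {H : Type*} [NormedAddCommGroup H] [InnerProductSpace ℂ H] [CompleteSpace H]
  {A : LocalNet H} {I J K L M P Q : Type} [Fintype I] [Fintype J] [Fintype K] [Fintype L]
  [Fintype M] [Fintype P] [Fintype Q]

namespace Bimodule

/-- The left inverse `T ↦ S* τ(T) S` in the vector state of `ξ`. -/
noncomputable def vecTrace (τ : Bimodule A P) (S : P → I → A.quasi) (ξ : H) :
    Matrix I I A.quasi →ₗ[ℂ] ℂ where
  toFun T := ⟪ξ, (sand τ S T : H →L[ℂ] H) ξ⟫_ℂ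
  map_add' B C := by
    rw [map_add, AddMemClass.coe_add, add_apply, inner_add_right]
  map_smul' c B := by
    rw [map_smul, RingHom.id_apply, smul_eq_mul, ← inner_smul_right]
    rfl

/-- The space of arrows from `σ` to itself. -/
noncomputable def endos (σ : Bimodule A I) : Submodule ℂ (Matrix I I A.quasi) where
  carrier := {T | σ.IsArrow σ T}
  zero_mem' := IsArrow.zero
  add_mem' := IsArrow.add
  smul_mem' c _ h := h.smul c

section Trace

variable {σ : Bimodule A I} {τ : Bimodule A P} {S : P → I → A.quasi} {ξ : H}

lemma vecTrace_conjTranspose (T : Matrix I I A.quasi) :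
    vecTrace τ S ξ Tᴴ = star (vecTrace τ S ξ T) := by
  change ⟪ξ, (sand τ S Tᴴ : H →L[ℂ] H) ξ⟫_ℂ = star ⟪ξ, (sand τ S T : H →L[ℂ] H) ξ⟫_ℂ
  rw [sand_conjTranspose, Complex.star_def, inner_conj_symm]
  exact ContinuousLinearMap.adjoint_inner_right _ _ _

lemma vecTrace_nonneg {T : Matrix I I A.quasi} (h : IsPosMatrix T) : 0 ≤ vecTrace τ S ξ T := by
  obtain ⟨K, _, Z, rfl⟩ := h
  change 0 ≤ ⟪ξ, (sand τ S (Zᴴ * Z) : H →L[ℂ] H) ξ⟫_ℂ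
  rw [sand_conjTranspose_mul, ← Fintype.sum_prod_type' (f := fun k p => star (act τ S (Z k) p) *
    act τ S (Z k) p), re_inner_sum_star_mul_self]
  exact Complex.zero_le_real.2 (by positivity)

/-- On arrows the left inverse commutes with 𝔄, hence is scalar; the vector state merely reads off
the scalar. -/
lemma IsPair.sand_eq_vecTrace (h : IsPair σ τ S) (hξ : ‖ξ‖ = 1) {T : Matrix I I A.quasi}
    (hT : σ.IsArrow σ T) : sand τ S T = vecTrace τ S ξ T • (1 : A.quasi) := by
  obtain ⟨c, hc⟩ := A.exists_smul_one (z := sand τ S T) fun X => by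
    rw [← h.sand_mul_right, ← h.sand_mul_left, hT.intertwine]
  have h1 : vecTrace τ S ξ T = c := by
    change ⟪ξ, (sand τ S T : H →L[ℂ] H) ξ⟫_ℂ = c
    rw [hc]
    change ⟪ξ, c • ξ⟫_ℂ = c
    rw [inner_smul_right, inner_self_eq_norm_sq_to_K, hξ]
    simp
  rw [h1, hc]

lemma IsFaithfulPair.eq_zero_of_vecTrace (h : IsFaithfulPair σ τ S) (hξ : ‖ξ‖ = 1)
    {T : Matrix I I A.quasi} (hT : σ.IsArrow σ T) (h0 : vecTrace τ S ξ (Tᴴ * T) = 0) : T = 0 := by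
  have h1 := h.1.sand_eq_vecTrace hξ (hT.conjTranspose.comp hT)
  rw [h0, zero_smul, sand_conjTranspose_mul] at h1
  have h1' : ∑ q : I × P, star (act τ S (T q.1) q.2) * act τ S (T q.1) q.2 = 0 := by
    rw [Fintype.sum_prod_type]
    exact h1
  have h2 : ∀ q : I × P, act τ S (T q.1) q.2 = 0 := fun q =>
    eq_zero_of_sum_star_mul_self (z := fun q : I × P => act τ S (T q.1) q.2) h1'
      (Finset.mem_univ q)
  rw [← hT.mul_one]
  ext1 k i
  exact congrFun (h.2 (T k) (funext fun p => h2 (k, p))) i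

/-- The scalar product `t(T* T')` on the arrows from `σ` to itself. -/
@[reducible]
noncomputable def endosCore (h : IsFaithfulPair σ τ S) (hξ : ‖ξ‖ = 1) :
    InnerProductSpace.Core ℂ σ.endos where
  inner x y := vecTrace τ S ξ ((x : Matrix I I A.quasi)ᴴ * y)
  conj_inner_symm x y := by
    rw [← Complex.star_def, ← vecTrace_conjTranspose, Matrix.conjTranspose_mul,
      Matrix.conjTranspose_conjTranspose]
  re_inner_nonneg x := (Complex.nonneg_iff.1 (vecTrace_nonneg ⟨I, inferInstance, _, rfl⟩)).1
  add_left x y z := by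
    rw [Submodule.coe_add, Matrix.conjTranspose_add, Matrix.add_mul, map_add]
  smul_left x y c := by
    rw [Submodule.coe_smul, Matrix.conjTranspose_smul, Matrix.smul_mul, map_smul]
    rfl
  definite x hx := Subtype.ext (h.eq_zero_of_vecTrace hξ x.2 hx)

/-- For the row T of the f_k, orthogonality makes the left inverse of T*T equal to a, so T*T ≤ r'a.
With N = TT* and the trace t this gives t(N²) ≤ r'a t(N), while Cauchy–Schwarz with t(1) = r gives
t(N)² ≤ r t(N²). -/
lemma IsConjugatePair.vecTrace_sum_le {S' : I → P → A.quasi} (h : IsConjugatePair σ τ S S')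
    (hξ : ‖ξ‖ = 1) {r r' : ℝ} (hr : 0 < r) (hr' : 0 < r') (hs : sand τ S (σ 1) = (r : ℂ) • 1)
    (hs' : sand σ S' (τ 1) = (r' : ℂ) • 1) [DecidableEq K] {a : ℝ} (ha : 0 ≤ a)
    {f : K → Matrix I I A.quasi} (hf : ∀ k, σ.IsArrow σ (f k))
    (ho : ∀ k l, vecTrace τ S ξ ((f k)ᴴ * f l) = if k = l then (a : ℂ) else 0) :
    (vecTrace τ S ξ (∑ k, f k * (f k)ᴴ)).re ≤ a * (r * r') := by
  obtain ⟨T, hTf⟩ : ∃ T : Matrix I (I × K) A.quasi, ∀ i q, T i q = f q.2 i q.1 :=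
    ⟨Matrix.of fun i q => f q.2 i q.1, fun _ _ => rfl⟩
  have hT : T * lt σ (1 : Matrix K K A.quasi) = T := by
    ext1 i ⟨i', k⟩
    rw [Matrix.mul_apply, Fintype.sum_prod_type]
    rw [hTf]
    conv_rhs => rw [← (hf k).mul_one, Matrix.mul_apply]
    refine Finset.sum_congr rfl fun l _ => ?_
    rw [Finset.sum_eq_single k]
    · rw [lt_apply, Matrix.one_apply_eq, hTf]
    · intro b _ hb
      rw [lt_apply, Matrix.one_apply_ne hb, map_zero, Matrix.zero_apply, mul_zero]
    · simp
  have hsl : slice τ S (Tᴴ * T) = (a : ℂ) • (1 : Matrix K K A.quasi) := by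
    ext1 k l
    have h1 := h.isPair.sand_eq_vecTrace hξ ((hf k).conjTranspose.comp (hf l))
    rw [slice_apply]
    refine Eq.trans ?_ (h1.trans ?_)
    · congr 1
      ext1 i i'
      simp only [Matrix.of_apply, Matrix.mul_apply, Matrix.conjTranspose_apply, hTf]
    · rw [ho, Matrix.smul_apply, Matrix.one_apply]
      split_ifs <;> simp
  have hP := h.pimsner_popa hr' hs' hT
  rw [hsl, lt_smul] at hP
  have hN : T * Tᴴ = ∑ k, f k * (f k)ᴴ := by
    ext1 i j
    rw [Matrix.mul_apply, Fintype.sum_prod_type, Finset.sum_comm, Matrix.sum_apply]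
    simp only [Matrix.mul_apply, Matrix.conjTranspose_apply, hTf]
  have hNa : σ.IsArrow σ (T * Tᴴ) := by
    rw [hN]
    exact IsArrow.sum fun k _ => (hf k).comp (hf k).conjTranspose
  have hNs : (T * Tᴴ)ᴴ = T * Tᴴ := by
    rw [Matrix.conjTranspose_mul, Matrix.conjTranspose_conjTranspose]
  rw [← hN]
  obtain ⟨N, hNN⟩ : ∃ N, T * Tᴴ = N := ⟨_, rfl⟩
  rw [hNN] at hNa hNs ⊢
  have h2 := vecTrace_nonneg (τ := τ) (S := S) (ξ := ξ) (hP.conj Tᴴ)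
  -- The Pimsner–Popa inequality, conjugated by T*, becomes an inequality between N and N².
  have e2 : Tᴴᴴ * ((r' : ℂ) • (a : ℂ) • lt σ (1 : Matrix K K A.quasi) - Tᴴ * T) * Tᴴ =
      ((r' * a : ℝ) : ℂ) • N - N * N := by
    rw [Matrix.conjTranspose_conjTranspose, Matrix.mul_sub, Matrix.mul_smul, Matrix.mul_smul, hT,
      Matrix.sub_mul, Matrix.smul_mul, Matrix.smul_mul, hNN, ← Matrix.mul_assoc, hNN,
      Matrix.mul_assoc, hNN, smul_smul]
    push_cast
    rfl
  rw [e2, map_sub, map_smul] at h2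
  have ht1 : vecTrace τ S ξ (σ 1) = r := by
    change ⟪ξ, (sand τ S (σ 1) : H →L[ℂ] H) ξ⟫_ℂ = r
    rw [hs]
    change ⟪ξ, (r : ℂ) • ξ⟫_ℂ = r
    rw [inner_smul_right, inner_self_eq_norm_sq_to_K, hξ]
    simp
  set ν := (vecTrace τ S ξ N).re with hν
  set μ := (vecTrace τ S ξ (N * N)).re with hμ
  have h3 : μ ≤ r' * a * ν := by
    have := (Complex.nonneg_iff.1 h2).1
    rw [Complex.sub_re, smul_eq_mul, Complex.re_ofReal_mul] at this
    linarith
  -- Cauchy–Schwarz in the form t((N - ν/r)²) ≥ 0.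
  have h4 : 0 ≤ μ - 2 * (ν / r) * ν + (ν / r) * (ν / r) * r := by
    have h5 := vecTrace_nonneg (τ := τ) (S := S) (ξ := ξ)
      ⟨I, inferInstance, N - ((ν / r : ℝ) : ℂ) • σ 1, rfl⟩
    have e5 : (N - ((ν / r : ℝ) : ℂ) • σ 1)ᴴ * (N - ((ν / r : ℝ) : ℂ) • σ 1) =
        N * N - ((2 * (ν / r) : ℝ) : ℂ) • N + ((ν / r * (ν / r) : ℝ) : ℂ) • σ 1 := by
      rw [Matrix.conjTranspose_sub, Matrix.conjTranspose_smul, conjTranspose_one, hNs,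
        Complex.star_def, Complex.conj_ofReal, Matrix.sub_mul, Matrix.mul_sub, Matrix.mul_sub,
        Matrix.mul_smul, hNa.mul_one, Matrix.smul_mul, hNa.one_mul, Matrix.smul_mul,
        Matrix.mul_smul, one_mul', smul_smul]
      push_cast
      rw [two_mul, add_smul]
      abel
    rw [e5, map_add, map_sub, map_smul, map_smul, ht1] at h5
    have := (Complex.nonneg_iff.1 h5).1
    rw [Complex.add_re, Complex.sub_re, smul_eq_mul, smul_eq_mul, Complex.re_ofReal_mul,
      Complex.re_ofReal_mul, Complex.ofReal_re] at this
    linarith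
  have h6 : ν * ν ≤ (a * (r * r')) * ν := by
    have : μ - 2 * (ν / r) * ν + (ν / r) * (ν / r) * r = μ - ν * ν / r := by
      field_simp
      ring
    rw [this] at h4
    have h7 : ν * ν / r ≤ r' * a * ν := by linarith
    rw [div_le_iff₀ hr] at h7
    linarith
  by_contra! h8
  have h9 : 0 < ν := lt_of_le_of_lt (by positivity) h8
  exact absurd (le_of_mul_le_mul_right h6 h9) (not_le.2 h8)

/-- Objects with conjugates have finite-dimensional spaces of arrows. -/
lemma IsConjugatePair.finiteDimensional [Nontrivial H] {S' : I → P → A.quasi}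
    (h : IsConjugatePair σ τ S S') (h0 : σ 1 ≠ 0) : FiniteDimensional ℂ σ.endos := by
  obtain ⟨r, r', hr, hr', hs, hs'⟩ := h.exists_scalars h0
  obtain ⟨ξ, hξ⟩ := exists_norm_eq H zero_le_one
  -- For an orthonormal family the traces of v v* add up to at most rr', and each of them is at
  -- least 1/(rr'). Hence there are at most (rr')² members.
  refine finiteDimensional_of_orthonormal_le (endosCore h.isFaithfulPair hξ)
    ⌊(r * r') * (r * r')⌋₊ fun m v hv => ?_
  replace hv : ∀ i j, vecTrace τ S ξ ((v i : Matrix I I A.quasi)ᴴ * v j) =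
    if i = j then 1 else 0 := hv
  have h1 := h.vecTrace_sum_le hξ hr hr' hs hs' zero_le_one (fun k => (v k).2)
    (by simpa using hv)
  -- The lower bound is the same estimate for the single element v*, with a = t(v v*): the sum is
  -- then v*v, of trace 1.
  have h2 : ∀ k, 1 ≤ (vecTrace τ S ξ (v k * (v k : Matrix I I A.quasi)ᴴ)).re * (r * r') := by
    intro k
    have hk : 0 ≤ vecTrace τ S ξ (v k * (v k : Matrix I I A.quasi)ᴴ) :=
      vecTrace_nonneg ⟨I, inferInstance, (v k : Matrix I I A.quasi)ᴴ, by
        rw [Matrix.conjTranspose_conjTranspose]⟩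
    obtain ⟨hk1, hk2⟩ := Complex.nonneg_iff.1 hk
    have := h.vecTrace_sum_le (K := Unit) hξ hr hr' hs hs' hk1
      (f := fun _ => (v k : Matrix I I A.quasi)ᴴ)
      (fun _ => (v k).2.conjTranspose) (fun _ _ => by
        rw [Matrix.conjTranspose_conjTranspose, if_pos rfl]
        exact Complex.ext rfl (by simpa using hk2.symm))
    simpa [Matrix.conjTranspose_conjTranspose, hv] using this
  rw [map_sum, Complex.re_sum, one_mul] at h1
  have h3 : (m : ℝ) ≤ (∑ k, (vecTrace τ S ξ (v k * (v k : Matrix I I A.quasi)ᴴ)).re) * (r * r') := by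
    rw [Finset.sum_mul]
    calc (m : ℝ) = ∑ k : Fin m, 1 := by simp
      _ ≤ _ := Finset.sum_le_sum fun k _ => h2 k
  refine Nat.le_floor (h3.trans ?_)
  gcongr

end Trace

end Bimodule

end FiniteDimension

end Sectors

namespace Sectors

section Decomposition

variable {H : Type*} [NormedAddCommGroup H] [InnerProductSpace ℂ H] [CompleteSpace H]
  {A : LocalNet H} {I J K L M P Q : Type} [Fintype I] [Fintype J] [Fintype K] [Fintype L]
  [Fintype M] [Fintype P] [Fintype Q]

namespace Bimodule

/-! ### Decomposition into irreducible objects -/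

/-- `p` is a projection in `(σ, σ)`. -/
structure IsProj (σ : Bimodule A I) (p : Matrix I I A.quasi) : Prop where
  isArrow : σ.IsArrow σ p
  mul_self : p * p = p
  star_eq : pᴴ = p

/-- The reduced algebra `p (σ, σ) p`. -/
noncomputable def cornerEndos (σ : Bimodule A I) (p : Matrix I I A.quasi) : Submodule ℂ σ.endos where
  carrier := {T | p * T = T ∧ T * p = (T : Matrix I I A.quasi)}
  zero_mem' := ⟨Matrix.mul_zero _, Matrix.zero_mul _⟩
  add_mem' := by
    rintro S T ⟨h1, h2⟩ ⟨k1, k2⟩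
    refine ⟨?_, ?_⟩
    · rw [Submodule.coe_add, Matrix.mul_add, h1, k1]
    · rw [Submodule.coe_add, Matrix.add_mul, h2, k2]
  smul_mem' := by
    rintro c T ⟨h1, h2⟩
    refine ⟨?_, ?_⟩
    · rw [Submodule.coe_smul, Matrix.mul_smul, h1]
    · rw [Submodule.coe_smul, Matrix.smul_mul, h2]

section Projections

variable {σ : Bimodule A I} {τ : Bimodule A P} {S : P → I → A.quasi}

lemma IsProj.sub {p q : Matrix I I A.quasi} (hp : σ.IsProj p) (hq : σ.IsProj q) (h : p * q = q) :
    σ.IsProj (p - q) := by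
  have h' : q * p = q := by
    have := congrArg Matrix.conjTranspose h
    rwa [Matrix.conjTranspose_mul, hp.star_eq, hq.star_eq] at this
  refine ⟨?_, ?_, ?_⟩
  · have := hp.isArrow.add (hq.isArrow.smul (-1))
    rwa [neg_one_smul, ← sub_eq_add_neg] at this
  · rw [Matrix.sub_mul, Matrix.mul_sub, Matrix.mul_sub, hp.mul_self, hq.mul_self, h, h', sub_self,
      sub_zero]
  · rw [Matrix.conjTranspose_sub, hp.star_eq, hq.star_eq]

lemma IsFaithfulPair.exists_orthogonal (h : IsFaithfulPair σ τ S) {ξ : H} (hξ : ‖ξ‖ = 1)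
    [FiniteDimensional ℂ σ.endos] (N : Submodule ℂ σ.endos) (p : σ.endos) :
    ∃ q ∈ N, ∀ k ∈ N, vecTrace τ S ξ
      (((q : Matrix I I A.quasi) - (p : Matrix I I A.quasi))ᴴ * (k : Matrix I I A.quasi)) = 0 :=
  exists_orthogonal_projection (endosCore h hξ) N p

/-- A projection that is not minimal dominates a nontrivial projection. -/
lemma IsFaithfulPair.exists_isProj [Nontrivial H] (h : IsFaithfulPair σ τ S)
    [FiniteDimensional ℂ σ.endos] {p : Matrix I I A.quasi} (hp : σ.IsProj p)
    {T : Matrix I I A.quasi} (hT : σ.IsArrow σ T) (hpT : p * T = T) (hTp : T * p = T)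
    (hTs : ∀ c : ℂ, T ≠ c • p) :
    ∃ q, σ.IsProj q ∧ p * q = q ∧ q ≠ 0 ∧ q ≠ p := by
  obtain ⟨ξ, hξ⟩ := exists_norm_eq H zero_le_one
  let C := σ.cornerEndos p
  have hp0 : p ≠ 0 := by
    rintro rfl
    exact hTs 0 (by rw [smul_zero, ← hTp, Matrix.mul_zero])
  let e : C := ⟨⟨p, hp.isArrow⟩, hp.mul_self, hp.mul_self⟩
  have : Nontrivial C := ⟨e, 0, fun he => hp0 (congrArg (fun x : C => (x : Matrix I I A.quasi)) he)⟩
  -- Left multiplication by T on the finite-dimensional corner p(σ, σ)p has an eigenvalue t. The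
  -- projection sought is the one generating its eigenspace as a right ideal.
  let l : Module.End ℂ C :=
    { toFun := fun k => ⟨⟨T * k, hT.comp k.1.2⟩, by
        refine ⟨?_, ?_⟩
        · change p * (T * k.1.1) = T * k.1.1
          rw [← Matrix.mul_assoc, hpT]
        · change T * k.1.1 * p = T * k.1.1
          rw [Matrix.mul_assoc, k.2.2]⟩
      map_add' := fun x y => Subtype.ext (Subtype.ext (Matrix.mul_add _ _ _))
      map_smul' := fun c x => Subtype.ext (Subtype.ext (Matrix.mul_smul _ _ _)) }
  obtain ⟨t, ht⟩ := Module.End.exists_eigenvalue (K := ℂ) (V := C) l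
  obtain ⟨v, hv⟩ := ht.exists_hasEigenvector
  have hv1 : T * v = t • (v : Matrix I I A.quasi) :=
    congrArg (fun x : C => (x : Matrix I I A.quasi)) hv.apply_eq_smul
  let N : Submodule ℂ σ.endos :=
    { carrier := {k | k ∈ C ∧ T * k = t • (k : Matrix I I A.quasi)}
      zero_mem' := ⟨C.zero_mem, by simp⟩
      add_mem' := by
        rintro x y ⟨hx, hx'⟩ ⟨hy, hy'⟩
        refine ⟨C.add_mem hx hy, ?_⟩
        rw [Submodule.coe_add, Matrix.mul_add, hx', hy', smul_add]
      smul_mem' := by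
        rintro c x ⟨hx, hx'⟩
        refine ⟨C.smul_mem c hx, ?_⟩
        rw [Submodule.coe_smul, Matrix.mul_smul, hx', smul_comm] }
  -- q is the orthogonal projection of p onto the eigenspace N for the scalar product of the left
  -- inverse.
  obtain ⟨⟨q, hqa⟩, ⟨⟨hq1, hq2⟩, hq3⟩, hq⟩ :=
    h.exists_orthogonal hξ N ⟨p, hp.isArrow⟩
  change p * q = q at hq1
  change q * p = q at hq2
  change T * q = t • q at hq3
  -- With y = (q - p)*k the element k y* is again in the right ideal N, so orthogonality says that y
  -- y* has trace zero. Faithfulness gives y = 0, that is, q*k = pk = k. For k = q this yields q*q =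
  -- q.
  have hqk : ∀ k : σ.endos, k ∈ N → qᴴ * k.1 = k := by
    intro k hk
    obtain ⟨⟨hk1, hk2⟩, hk3⟩ := id hk
    have hx : σ.IsArrow σ ((q - p)ᴴ * k.1) :=
      (hqa.conjTranspose.comp k.2).add ((hp.isArrow.conjTranspose.comp k.2).smul (-1)) |> fun h => by
        rwa [neg_one_smul, ← sub_eq_add_neg, ← Matrix.sub_mul, ← Matrix.conjTranspose_sub] at h
    have hmem : (⟨k.1 * ((q - p)ᴴ * k.1)ᴴ, k.2.comp hx.conjTranspose⟩ : σ.endos) ∈ N := by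
      refine ⟨⟨?_, ?_⟩, ?_⟩
      · change p * (k.1 * _) = k.1 * _
        rw [← Matrix.mul_assoc, hk1]
      · change k.1 * _ * p = k.1 * _
        rw [Matrix.conjTranspose_mul, Matrix.conjTranspose_conjTranspose, Matrix.mul_assoc,
          Matrix.mul_assoc, Matrix.sub_mul, hq2, hp.mul_self]
      · change T * (k.1 * _) = t • (k.1 * _)
        rw [← Matrix.mul_assoc, hk3, Matrix.smul_mul]
    have h0 := hq _ hmem
    dsimp only at h0
    have h1 := h.eq_zero_of_vecTrace hξ hx.conjTranspose
      (by rw [Matrix.conjTranspose_conjTranspose, Matrix.mul_assoc]; exact h0)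
    rw [Matrix.conjTranspose_eq_zero, Matrix.conjTranspose_sub, hp.star_eq, Matrix.sub_mul,
      sub_eq_zero, hk1] at h1
    exact h1
  have hqq : qᴴ * q = q := hqk ⟨q, hqa⟩ ⟨⟨hq1, hq2⟩, hq3⟩
  have hqs : qᴴ = q := by
    have := congrArg Matrix.conjTranspose hqq
    rw [Matrix.conjTranspose_mul, Matrix.conjTranspose_conjTranspose, hqq] at this
    exact this.symm
  -- q = 0 would annihilate the eigenvector, and q = p would make T the scalar multiple t p.
  refine ⟨q, ⟨hqa, by rwa [hqs] at hqq, hqs⟩, hq1, ?_, ?_⟩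
  · rintro rfl
    refine hv.2 (Subtype.ext (Subtype.ext ?_))
    have := hqk v.1 ⟨v.2, hv1⟩
    rw [Matrix.conjTranspose_zero, Matrix.zero_mul] at this
    exact this.symm
  · rintro rfl
    exact hTs t (hTp.symm.trans hq3)

/-- Projections are finite sums of minimal projections. -/
lemma IsFaithfulPair.exists_minimal [Nontrivial H] (h : IsFaithfulPair σ τ S)
    [FiniteDimensional ℂ σ.endos] {p : Matrix I I A.quasi} (hp : σ.IsProj p) :
    ∃ (k : Type) (_ : Fintype k) (q : k → Matrix I I A.quasi), (∀ i, σ.IsProj (q i) ∧ q i ≠ 0 ∧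
      ∀ T, σ.IsArrow σ T → q i * T = T → T * q i = T → ∃ c : ℂ, T = c • q i) ∧ ∑ i, q i = p := by
  -- Induction on the dimension of the corner of p: a projection that is not minimal splits into q
  -- and p - q with strictly smaller corners.
  induction hn : Module.finrank ℂ (σ.cornerEndos p) using Nat.strong_induction_on generalizing p with
  | _ n ih =>
    by_cases h0 : p = 0
    · exact ⟨Empty, inferInstance, Empty.elim, fun i => i.elim, by rw [h0]; simp⟩
    by_cases hm : ∀ T, σ.IsArrow σ T → p * T = T → T * p = T → ∃ c : ℂ, T = c • p
    · exact ⟨Unit, inferInstance, fun _ => p, fun _ => ⟨hp, h0, hm⟩, by simp⟩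
    push Not at hm
    obtain ⟨T, hT, hpT, hTp, hTs⟩ := hm
    obtain ⟨q, hq, hpq, hq0, hqp⟩ := h.exists_isProj hp hT hpT hTp hTs
    have lt : ∀ q, σ.IsProj q → p * q = q → q ≠ p →
        Module.finrank ℂ (σ.cornerEndos q) < Module.finrank ℂ (σ.cornerEndos p) := by
      intro q hq hpq hqp
      have hqp' : q * p = q := by
        have := congrArg Matrix.conjTranspose hpq
        rwa [Matrix.conjTranspose_mul, hp.star_eq, hq.star_eq] at this
      refine Submodule.finrank_lt_finrank_of_lt (lt_of_le_of_ne ?_ fun e => ?_)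
      · rintro T ⟨h1, h2⟩
        refine ⟨?_, ?_⟩
        · rw [← h1, ← Matrix.mul_assoc, hpq]
        · rw [← h2, Matrix.mul_assoc, hqp']
      · have h1 : (⟨p, hp.isArrow⟩ : σ.endos) ∈ σ.cornerEndos p := ⟨hp.mul_self, hp.mul_self⟩
        rw [← e] at h1
        exact hqp (hqp'.symm.trans h1.1)
    have hq' := hp.sub hq hpq
    obtain ⟨k₁, _, q₁, h₁, s₁⟩ := ih _ (hn ▸ lt q hq hpq hqp) hq rfl
    obtain ⟨k₂, _, q₂, h₂, s₂⟩ := ih _ (hn ▸ lt (p - q) hq'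
      (by rw [Matrix.mul_sub, hp.mul_self, hpq]) (by simpa using hq0)) hq' rfl
    refine ⟨k₁ ⊕ k₂, inferInstance, Sum.elim q₁ q₂, ?_, ?_⟩
    · rintro (i | i)
      · exact h₁ i
      · exact h₂ i
    · rw [Fintype.sum_sum_type]
      simp only [Sum.elim_inl, Sum.elim_inr, s₁, s₂, add_sub_cancel]

end Projections

end Bimodule

open Bimodule

/-- Objects with conjugates are finite direct sums of irreducible objects with conjugates. -/
theorem isDirectSumOf_irreducible [Nontrivial H] {n : ℕ} {ρ : Obj A n} {τ : Bimodule A P}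
    {S : P → Fin n → A.quasi} {S' : Fin n → P → A.quasi} (h : IsConjugatePair ρ.bim τ S S') :
    ρ.IsDirectSumOf fun _ σ => σ.Irreducible ∧ ∃ S S', IsConjugatePair σ.bim τ S S' := by
  have hF := h.isFaithfulPair
  have : FiniteDimensional ℂ ρ.bim.endos := by
    -- The zero object has only the zero arrow; the dimension bound requires a nonzero object.
    by_cases h0 : ρ.bim 1 = 0
    · have : Subsingleton ρ.bim.endos := ⟨fun x y => Subtype.ext (by
        rw [← x.2.mul_one, ← y.2.mul_one, h0, Matrix.mul_zero, Matrix.mul_zero])⟩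
      infer_instance
    · exact h.finiteDimensional h0
  obtain ⟨k, _, q, hq, hs⟩ := hF.exists_minimal (p := ρ.bim 1)
    ⟨IsArrow.one _, one_mul' _ _, conjTranspose_one _⟩
  let e := Fintype.equivFin k
  have hc : ∀ i, (corner ρ.bim (q i) (hq i).1.isArrow (hq i).1.mul_self (hq i).1.star_eq).IsObj :=
    fun i => ρ.isObj.corner _ _ _
  have hV : ∀ i, (hc i).toObj.bim.IsIsometry ρ.bim (q i) := fun i =>
    corner_isIsometry (hq i).1.isArrow (hq i).1.mul_self (hq i).1.star_eq
  have h1 : ∀ i, (hc i).toObj.bim 1 = q i := fun i =>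
    corner_one (hq i).1.isArrow (hq i).1.mul_self (hq i).1.star_eq
  refine ⟨Fintype.card k, fun _ => n, fun i => (hc (e.symm i)).toObj, fun i => q (e.symm i),
    fun i => ⟨⟨?_, fun T hT => ?_⟩, _, _, h.restrict (hV _)⟩, fun i => hV _, ?_⟩
  · intro h0
    exact (hq (e.symm i)).2.1 ((h1 _).symm.trans h0)
  · have h2 : q (e.symm i) * T = T := (congrArg (· * T) (h1 _).symm).trans hT.one_mul
    have h3 : T * q (e.symm i) = T := (congrArg (T * ·) (h1 _).symm).trans hT.mul_one
    have h4 := (hV (e.symm i)).isArrow.comp (hT.comp (hV (e.symm i)).isArrow.conjTranspose)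
    rw [(hq _).1.star_eq, h3, h2] at h4
    obtain ⟨c, hc⟩ := (hq (e.symm i)).2.2 T h4 h2 h3
    exact ⟨c, hc.trans (congrArg (c • ·) (h1 _).symm)⟩
  · rw [← hs, ← e.symm.sum_comp]
    refine Finset.sum_congr rfl fun i _ => ?_
    rw [(hq _).1.star_eq, (hq _).1.mul_self]

end Decomposition

end Sectors

namespace Sectors

section Extension

variable {H : Type*} [NormedAddCommGroup H] [InnerProductSpace ℂ H] [CompleteSpace H]
  {A : LocalNet H} {I J K L M P Q : Type} [Fintype I] [Fintype J] [Fintype K] [Fintype L]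
  [Fintype M] [Fintype P] [Fintype Q]

/-! ### The extension to the commutants -/

lemma ampl_comm [DecidableEq I] [DecidableEq J] {T : Matrix J I (H →L[ℂ] H)} {X : H →L[ℂ] H}
    (h : ∀ j i, T j i * X = X * T j i) : T * ampl I X = ampl J X * T := by
  ext1 j i
  rw [mul_ampl_apply, ampl_mul_apply, h]

lemma ampl_mul [DecidableEq I] (X Y : H →L[ℂ] H) : ampl I (X * Y) = ampl I X * ampl I Y := by
  simp [ampl]

lemma LocalNet.commute_of_mem {a : DoubleCone} {X Y : H →L[ℂ] H}
    (hX : X ∈ (A.alg a).commutant) (hY : Y ∈ A.alg a) : Y * X = X * Y :=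
  VonNeumannAlgebra.mem_commutant_iff.1 hX Y hY

lemma LocalNet.mem_commutant_of_perp {a c : DoubleCone} (h : c.Perp a) {X : H →L[ℂ] H}
    (hX : X ∈ A.alg c) : X ∈ (A.alg a).commutant :=
  A.locality c a h hX

lemma LocalNet.commutant_mono {a b : DoubleCone} (h : a.Sub b) {X : H →L[ℂ] H}
    (hX : X ∈ (A.alg b).commutant) : X ∈ (A.alg a).commutant :=
  VonNeumannAlgebra.mem_commutant_iff.2 fun _ hY =>
    LocalNet.commute_of_mem hX (A.isotony a b h hY)

namespace Bimodule

/-- `X ↦ U* (X ⊗ 1) U`. -/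
noncomputable def extBy [DecidableEq J] (U : Matrix J I A.quasi) (X : H →L[ℂ] H) :
    Matrix I I (H →L[ℂ] H) :=
  (toOp U)ᴴ * ampl J X * toOp U

lemma extBy_apply [DecidableEq J] (U : Matrix J I A.quasi) (X : H →L[ℂ] H) (i i' : I) :
    extBy U X i i' = ∑ j, star (U j i : H →L[ℂ] H) * (X * U j i') := by
  rw [extBy, Matrix.mul_assoc, Matrix.mul_apply]
  exact Finset.sum_congr rfl fun j _ => by rw [ampl_mul_apply]; rfl

section Ext

variable [DecidableEq J] {σ : Bimodule A I} {σ' : Bimodule A J} {U : Matrix J I A.quasi}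
  {a : DoubleCone}

lemma LocalizedIn.one_comm (h : σ'.LocalizedIn a) {X : H →L[ℂ] H}
    (hX : X ∈ (A.alg a).commutant) : toOp (σ' 1) * ampl J X = ampl J X * toOp (σ' 1) :=
  ampl_comm fun j i => LocalNet.commute_of_mem hX (h.one_mem j i)

lemma extBy_mul (hU : σ.IsUnitaryArrow σ' U) (hσ' : σ'.LocalizedIn a) {X : H →L[ℂ] H}
    (hX : X ∈ (A.alg a).commutant) (Y : H →L[ℂ] H) :
    extBy U (X * Y) = extBy U X * extBy U Y := by
  have h1 : toOp U * (toOp U)ᴴ = toOp (σ' 1) := by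
    rw [← toOp_conjTranspose, ← toOp_mul, hU.mul_star_self]
  have h2 : (toOp U)ᴴ * toOp (σ' 1) = (toOp U)ᴴ := by
    rw [← toOp_conjTranspose, ← toOp_mul, hU.isIsometry.isArrow.conjTranspose.mul_one]
  calc extBy U (X * Y) = (toOp U)ᴴ * toOp (σ' 1) * (ampl J X * ampl J Y) * toOp U := by
        rw [h2, ← ampl_mul]
        rfl
    _ = (toOp U)ᴴ * (toOp (σ' 1) * ampl J X) * ampl J Y * toOp U := by
        simp only [Matrix.mul_assoc]
    _ = _ := by
        rw [hσ'.one_comm hX, ← h1]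
        simp only [extBy, Matrix.mul_assoc]

lemma extBy_of_perp (hU : σ.IsUnitaryArrow σ' U) (hσ' : σ'.LocalizedIn a) {c : DoubleCone}
    (hc : c.Perp a) {X : A.quasi} (hX : (X : H →L[ℂ] H) ∈ A.alg c) :
    extBy U (X : H →L[ℂ] H) = toOp (σ X) := by
  have h1 : σ X = Uᴴ * (σ' X * U) := by
    rw [← hU.isIsometry.isArrow.intertwine, ← Matrix.mul_assoc, hU.isIsometry.star_mul_self,
      one_mul']
  have h2 : toOp (σ' X * U) = ampl J (X : H →L[ℂ] H) * toOp U := by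
    conv_rhs => rw [← hU.isIsometry.isArrow.one_mul, toOp_mul, ← Matrix.mul_assoc]
    rw [toOp_mul]
    congr 1
    ext1 j j'
    rw [ampl_mul_apply]
    exact congrArg Subtype.val (hσ' c hc X hX j j')
  rw [h1, toOp_mul, h2, toOp_conjTranspose, extBy, Matrix.mul_assoc]

/-- For Y in 𝔄(a), localization of σ in o moves Y through U* and U as σ'(Y). This has entries in
𝔄(a), which commute with X. -/
lemma extBy_mem (hU : σ.IsUnitaryArrow σ' U) (hσ' : σ'.LocalizedIn a) {o : DoubleCone}
    (hσ : σ.LocalizedIn o) (ho : a.Perp o) {X : H →L[ℂ] H} (hX : X ∈ (A.alg a).commutant)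
    (i i' : I) : extBy U X i i' ∈ (A.alg a).commutant := by
  refine VonNeumannAlgebra.mem_commutant_iff.2 fun Y₀ hY => ?_
  obtain ⟨Y, rfl⟩ : ∃ Y : A.quasi, (Y : H →L[ℂ] H) = Y₀ := ⟨⟨Y₀, A.alg_subset_quasi a hY⟩, rfl⟩
  classical
  have f := hσ.fixes ho hY
  have h1 : toOp U * ampl I (Y : H →L[ℂ] H) = toOp (σ' Y) * toOp U := by
    rw [← toOp_mul, ← hU.isIsometry.isArrow.intertwine]
    conv_lhs => rw [← hU.isIsometry.isArrow.mul_one, toOp_mul, Matrix.mul_assoc]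
    rw [toOp_mul]
    congr 1
    ext1 j j'
    rw [mul_ampl_apply]
    exact congrArg Subtype.val ((f j j').2.trans (f j j').1.symm)
  have h2 : ampl I (Y : H →L[ℂ] H) * (toOp U)ᴴ = (toOp U)ᴴ * toOp (σ' Y) := by
    rw [← toOp_conjTranspose, ← toOp_mul, hU.isIsometry.isArrow.conjTranspose.intertwine]
    conv_lhs => rw [← hU.isIsometry.isArrow.conjTranspose.one_mul, toOp_mul, ← Matrix.mul_assoc]
    rw [toOp_mul]
    congr 1
    ext1 j j'
    rw [ampl_mul_apply]
    exact congrArg Subtype.val (f j j').1.symm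
  have h3 : toOp (σ' Y) * ampl J X = ampl J X * toOp (σ' Y) :=
    ampl_comm fun j i => LocalNet.commute_of_mem hX (hσ'.apply_mem hY j i)
  have h4 : ampl I (Y : H →L[ℂ] H) * extBy U X = extBy U X * ampl I (Y : H →L[ℂ] H) := by
    calc _ = ampl I (Y : H →L[ℂ] H) * (toOp U)ᴴ * ampl J X * toOp U := by
          simp only [extBy, Matrix.mul_assoc]
      _ = (toOp U)ᴴ * (toOp (σ' Y) * ampl J X) * toOp U := by
          rw [h2]
          simp only [Matrix.mul_assoc]
      _ = (toOp U)ᴴ * ampl J X * (toOp (σ' Y) * toOp U) := by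
          rw [h3]
          simp only [Matrix.mul_assoc]
      _ = _ := by
          rw [← h1]
          simp only [extBy, Matrix.mul_assoc]
  have := congrFun (congrFun h4 i) i'
  rwa [ampl_mul_apply, mul_ampl_apply] at this

end Ext

/-- The entries of `S ∈ (ι, τσ)` are local. -/
lemma IsPair.mem {σ : Bimodule A I} {τ : Bimodule A P} {S : P → I → A.quasi} (h : IsPair σ τ S)
    {o : DoubleCone} (hσ : σ.LocalizedIn o) (hτ : τ.LocalizedIn o) (p : P) (i : I) :
    (S p i : H →L[ℂ] H) ∈ A.alg o := by
  refine A.mem_alg_of_commute o _ fun b hb x hx => ?_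
  let X : A.quasi := ⟨x, A.alg_subset_quasi b hx⟩
  have h1 : σ X i = fun j => X * σ 1 i j := funext fun j => ((hσ.fixes hb (X := X) hx) i j).1
  have h2 : S p i * X = X * S p i := by
    have h2 : σ 1 i = fun j => 1 * σ 1 i j := funext fun j => (one_mul _).symm
    have h3 := h 1 i p
    rw [h2, act_mul_left, mul_one] at h3
    rw [← h, h1, act_mul_left, ← h3, Finset.mul_sum]
    exact Finset.sum_congr rfl fun q _ => by rw [((hτ.fixes hb (X := X) hx) p q).1, mul_assoc]
  exact congrArg Subtype.val h2.symm

/-- The fundamental compatibility of `S ∈ (ι, τσ)` with the extensions of `σ` and `τ`. -/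
theorem IsPair.sum_extBy [DecidableEq K] [DecidableEq L] {σ : Bimodule A I} {τ : Bimodule A P}
    {S : P → I → A.quasi} (h : IsPair σ τ S) (hσ : σ.IsObj) (hτ : τ.IsObj) {σ' : Bimodule A K}
    {τ' : Bimodule A L} {U : Matrix K I A.quasi} {V : Matrix L P A.quasi}
    (hU : σ.IsUnitaryArrow σ' U) (hV : τ.IsUnitaryArrow τ' V) {o a : DoubleCone} (ho : a.Perp o)
    (hσo : σ.LocalizedIn o) (hσ' : σ'.LocalizedIn a) (hτ' : τ'.LocalizedIn a) {X : H →L[ℂ] H}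
    (hX : X ∈ (A.alg a).commutant) (p : P) (i : I) :
    ∑ q, ∑ j, extBy V (extBy U X i j) p q * S q j = S p i * X := by
  have hU' := hU.isIsometry.isArrow
  have hV' := hV.isIsometry.isArrow
  have hτ'o : τ'.IsObj := hτ.of_unitary hV ⟨a, hτ'⟩
  -- Q is S carried to the cone a. For Y local in a cone spacelike to a, S Y = τ(σ(Y)) S; the
  -- transports turn τ into τ' and σ into σ', both of which fix Y. So Q commutes with Y, and Haag
  -- duality puts its entries into 𝔄(a).
  let Q : K → L → A.quasi := fun k l => ∑ q, ∑ j, U k j * (V l q * S q j)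
  have hQ : ∀ k l, (Q k l : H →L[ℂ] H) ∈ A.alg a := by
    intro k l
    refine A.mem_alg_of_commute a _ fun c hc y hy => ?_
    obtain ⟨Y, rfl⟩ : ∃ Y : A.quasi, (Y : H →L[ℂ] H) = y := ⟨⟨y, A.alg_subset_quasi c hy⟩, rfl⟩
    have f1 : σ'.Fixes Y := hσ'.fixes hc hy
    have f2 : τ'.Fixes Y := hτ'.fixes hc hy
    have f3 : ∀ t t', σ.Fixes (τ' 1 t t') := fun t t' =>
      hσo.fixes ho (hτ'.one_mem t t')
    -- σ and τ' are localized spacelike to each other and commute, so τ' acts trivially on σ(Y)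
    -- although Y need not be spacelike to o.
    have f4 : ∀ t t' j j', τ' (σ Y j j') t t' = σ Y j j' * τ' 1 t t' := by
      intro t t' j j'
      rw [← hσ.commute hτ'o hσo hτ' ho.symm, (f2 t t').1, (f3 t t').mul_right]
    have e1 : ∀ j j' q', ∑ q, V l q * τ (σ Y j j') q q' = σ Y j j' * V l q' := by
      intro j j' q'
      rw [hV'.entry]
      conv_rhs => rw [← hV'.one_mul, Matrix.mul_apply, Finset.mul_sum]
      exact Finset.sum_congr rfl fun t _ => by rw [f4, mul_assoc]
    have e2 : Q k l * Y = Y * Q k l := by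
      calc Q k l * Y = ∑ q, ∑ j, U k j * (V l q * act τ S (σ Y j) q) := by
            simp only [Q, Finset.sum_mul, mul_assoc, h Y]
        _ = ∑ j, ∑ q', ∑ j', U k j * ((∑ q, V l q * τ (σ Y j j') q q') * S q' j') := by
            simp only [act_apply, Finset.mul_sum, Finset.sum_mul, mul_assoc]
            rw [Finset.sum_comm]
            exact Finset.sum_congr rfl fun j _ => (sum_rotate₃ _).symm
        _ = ∑ q', ∑ j', (∑ j, U k j * σ Y j j') * (V l q' * S q' j') := by
            simp only [e1, Finset.sum_mul, mul_assoc]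
            exact (sum_rotate₃ _).symm
        _ = ∑ q', ∑ j', Y * U k j' * (V l q' * S q' j') := by
            refine Finset.sum_congr rfl fun q' _ => Finset.sum_congr rfl fun j' _ => ?_
            rw [hU'.entry]
            congr 1
            conv_rhs => rw [← hU'.one_mul, Matrix.mul_apply, Finset.mul_sum]
            exact Finset.sum_congr rfl fun t _ => by rw [(f1 k t).1, mul_assoc]
        _ = Y * Q k l := by simp only [Q, Finset.mul_sum, mul_assoc]
    exact congrArg Subtype.val e2.symm
  have key : ∀ Z : H →L[ℂ] H, ∑ q, ∑ j, extBy V (extBy U Z i j) p q * S q j =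
      ∑ k, ∑ l, star (V l p : H →L[ℂ] H) * (star (U k i : H →L[ℂ] H) * (Z * Q k l)) := by
    intro Z
    have hQc : ∀ k l, (Q k l : H →L[ℂ] H) = ∑ q, ∑ j, (U k j : H →L[ℂ] H) * (V l q * S q j) := by
      intro k l
      simp only [Q, AddSubmonoidClass.coe_finsetSum, MulMemClass.coe_mul]
    simp only [extBy_apply, hQc, Finset.sum_mul, Finset.mul_sum, mul_assoc]
    exact (sum_rotate₄ _).trans ((sum_rotate₄ _).trans Finset.sum_comm)
  -- X in 𝔄(a)' passes Q; the remaining coefficient is the case X = 1, that is, S itself.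
  have h1 : ∑ k, ∑ l, star (V l p : H →L[ℂ] H) * (star (U k i : H →L[ℂ] H) * (X * Q k l)) =
      (∑ k, ∑ l, star (V l p : H →L[ℂ] H) * (star (U k i : H →L[ℂ] H) * (1 * Q k l))) * X := by
    simp only [Finset.sum_mul, one_mul, mul_assoc, ← LocalNet.commute_of_mem hX (hQ _ _)]
  rw [key, h1, ← key]
  congr 1
  have h2 : ∀ j, extBy U (1 : H →L[ℂ] H) i j = σ 1 i j := by
    intro j
    rw [← hU.isIsometry.star_mul_self, extBy_apply, Matrix.mul_apply]
    simp [AddSubmonoidClass.coe_finsetSum]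
  have h3 : ∀ j q, extBy V (σ 1 i j : H →L[ℂ] H) p q = τ (σ 1 i j) p q := fun j q =>
    congrFun (congrFun (extBy_of_perp hV hτ' ho.symm (hσo.one_mem i j)) p) q
  simp only [h2, h3]
  have h4 := h 1 i p
  rw [mul_one, act_apply] at h4
  rw [← h4]
  simp only [AddSubmonoidClass.coe_finsetSum, MulMemClass.coe_mul]

end Bimodule

end Extension

end Sectors

namespace Sectors

section LeftInverse

variable {H : Type*} [NormedAddCommGroup H] [InnerProductSpace ℂ H] [CompleteSpace H]
  {A : LocalNet H} {I J K L M P Q : Type} [Fintype I] [Fintype J] [Fintype K] [Fintype L]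
  [Fintype M] [Fintype P] [Fintype Q]

open Bimodule

/-! ### The extension of an object -/

/-- Independence of the transporter: W U* intertwines two morphisms localized in a, so its entries
lie in 𝔄(a) and commute with X. -/
lemma Obj.ext_eq_extBy {n : ℕ} (ρ : Obj A n) {a : DoubleCone} [DecidableEq J] {σ : Bimodule A J}
    {U : Matrix J (Fin n) A.quasi} (hU : ρ.bim.IsUnitaryArrow σ U) (hσ : σ.LocalizedIn a)
    {X : H →L[ℂ] H} (hX : X ∈ (A.alg a).commutant) : ρ.ext a X = extBy U X := by
  obtain ⟨hτ, hW⟩ := (ρ.transportable a).choose_spec.choose_spec.choose_spec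
  change (ρ.transporter a)ᴴ * _ * ρ.transporter a = _
  change Morphism.IsUnitary _ _ (ρ.transporter a) at hW
  generalize (ρ.transportable a).choose_spec.choose = τ at hτ hW
  generalize ρ.transporter a = W at hW ⊢
  have hU' := hU.toMorphism
  have u1 : toOp (ρ.bim 1) * (toOp U)ᴴ = (toOp U)ᴴ := by
    rw [← toOp_conjTranspose, ← toOp_mul, hU.isIsometry.isArrow.conjTranspose.one_mul]
  have u2 : ∀ X, (toOp U)ᴴ * toOp (σ X) = toOp (ρ.bim X) * (toOp U)ᴴ := fun X => by
    rw [← toOp_conjTranspose, ← toOp_mul, hU.isIsometry.isArrow.conjTranspose.intertwine, toOp_mul]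
  have hT : σ.toMorphism.IsIntertwiner τ (W * (toOp U)ᴴ) := by
    refine ⟨?_, ?_, fun X => ?_⟩
    · change W * (toOp U)ᴴ * toOp (σ 1) = W * (toOp U)ᴴ
      rw [Matrix.mul_assoc, u2, u1]
    · rw [← Matrix.mul_assoc, hW.isIntertwiner.one_mul]
    · change W * (toOp U)ᴴ * toOp (σ X) = τ X * (W * (toOp U)ᴴ)
      rw [Matrix.mul_assoc, u2, ← Matrix.mul_assoc, ← Matrix.mul_assoc]
      exact congrArg (· * (toOp U)ᴴ) (hW.isIntertwiner.intertwine X)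
  have hc := ampl_comm (T := W * (toOp U)ᴴ) fun j i => LocalNet.commute_of_mem hX (hT.apply_mem
    ((toMorphism_localizedIn _ _).2 hσ) hτ (DoubleCone.Sub.refl a) (DoubleCone.Sub.refl a) j i)
  have h1 : W = W * (toOp U)ᴴ * toOp U := by
    rw [Matrix.mul_assoc, hU'.star_mul_self, hW.isIntertwiner.mul_one]
  have h2 : Wᴴ * (W * (toOp U)ᴴ) = (toOp U)ᴴ := by
    rw [← Matrix.mul_assoc, hW.star_mul_self]
    exact u1
  conv_lhs => enter [2]; rw [h1]
  rw [Matrix.mul_assoc, ← Matrix.mul_assoc (ampl _ X), ← hc, ← Matrix.mul_assoc,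
    ← Matrix.mul_assoc, h2]
  rfl

lemma Obj.ext_add {n : ℕ} (ρ : Obj A n) (a : DoubleCone) (X Y : H →L[ℂ] H) :
    ρ.ext a (X + Y) = ρ.ext a X + ρ.ext a Y := by
  have : ∀ k : ℕ, ampl (Fin k) (X + Y) = ampl (Fin k) X + ampl (Fin k) Y := fun k => by
    simp [ampl]
  simp only [Obj.ext, this, Matrix.mul_add, Matrix.add_mul]

lemma Obj.ext_smul {n : ℕ} (ρ : Obj A n) (a : DoubleCone) (c : ℂ) (X : H →L[ℂ] H) :
    ρ.ext a (c • X) = c • ρ.ext a X := by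
  have : ∀ k : ℕ, ampl (Fin k) (c • X) = c • ampl (Fin k) X := fun k => by
    rw [ampl, ampl, ← Matrix.diagonal_smul]
    rfl
  simp only [Obj.ext, this, Matrix.mul_smul, Matrix.smul_mul]

/-- The extension as a linear map. -/
noncomputable def Obj.extₗ {n : ℕ} (ρ : Obj A n) (a : DoubleCone) :
    (H →L[ℂ] H) →ₗ[ℂ] Matrix (Fin n) (Fin n) (H →L[ℂ] H) where
  toFun := ρ.ext a
  map_add' := ρ.ext_add a
  map_smul' := ρ.ext_smul a

lemma Obj.ext_sum {n : ℕ} (ρ : Obj A n) (a : DoubleCone) {ι : Type*} (s : Finset ι)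
    (f : ι → H →L[ℂ] H) (i j : Fin n) :
    ρ.ext a (∑ k ∈ s, f k) i j = ∑ k ∈ s, ρ.ext a (f k) i j := by
  have := map_sum (ρ.extₗ a) f s
  exact (congrFun (congrFun this i) j).trans (Matrix.sum_apply _ _ _ _)

lemma Obj.ext_conjTranspose {n : ℕ} (ρ : Obj A n) (a : DoubleCone) (X : H →L[ℂ] H) :
    (ρ.ext a X)ᴴ = ρ.ext a (star X) := by
  have : ∀ k : ℕ, (ampl (Fin k) X)ᴴ = ampl (Fin k) (star X) := fun k => by
    rw [ampl, Matrix.diagonal_conjTranspose]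
    rfl
  simp only [Obj.ext, Matrix.conjTranspose_mul, Matrix.conjTranspose_conjTranspose, this,
    Matrix.mul_assoc]

section

variable {n m : ℕ} {ρ : Obj A n} {a b : DoubleCone} {X Y : H →L[ℂ] H}

lemma Obj.ext_mul (hX : X ∈ (A.alg a).commutant) (hY : Y ∈ (A.alg a).commutant) :
    ρ.ext a (X * Y) = ρ.ext a X * ρ.ext a Y := by
  obtain ⟨k, σ, U, hσ, hU⟩ := ρ.isObj.transportable a
  rw [ρ.ext_eq_extBy hU hσ hX, ρ.ext_eq_extBy hU hσ hY, ρ.ext_eq_extBy hU hσ (mul_mem hX hY),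
    extBy_mul hU hσ hX]

lemma Obj.ext_of_perp (hb : b.Perp a) {X : A.quasi} (hX : (X : H →L[ℂ] H) ∈ A.alg b) :
    ρ.ext a (X : H →L[ℂ] H) = toOp (ρ.bim X) := by
  obtain ⟨k, σ, U, hσ, hU⟩ := ρ.isObj.transportable a
  rw [ρ.ext_eq_extBy hU hσ (LocalNet.mem_commutant_of_perp hb hX), extBy_of_perp hU hσ hb hX]

lemma Obj.ext_mem {o : DoubleCone} (hρ : ρ.LocalizedIn o) (ho : a.Perp o)
    (hX : X ∈ (A.alg a).commutant) (i j : Fin n) : ρ.ext a X i j ∈ (A.alg a).commutant := by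
  obtain ⟨k, σ, U, hσ, hU⟩ := ρ.isObj.transportable a
  rw [ρ.ext_eq_extBy hU hσ hX]
  exact extBy_mem hU hσ ((ρ.localizedIn_iff o).1 hρ) ho hX i j

lemma Obj.ext_of_sub (h : a.Sub b) (hX : X ∈ (A.alg b).commutant) : ρ.ext a X = ρ.ext b X := by
  obtain ⟨k, σ, U, hσ, hU⟩ := ρ.isObj.transportable a
  rw [ρ.ext_eq_extBy hU hσ (LocalNet.commutant_mono h hX), ρ.ext_eq_extBy hU (hσ.mono h) hX]

lemma Obj.mul_ext : toOp (ρ.bim 1) * ρ.ext a X = ρ.ext a X ∧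
    ρ.ext a X * toOp (ρ.bim 1) = ρ.ext a X := by
  obtain ⟨hτ, hW⟩ := (ρ.transportable a).choose_spec.choose_spec.choose_spec
  change Morphism.IsUnitary _ _ (ρ.transporter a) at hW
  have h1 : ρ.transporter a * toOp (ρ.bim 1) = ρ.transporter a := hW.isIntertwiner.mul_one
  refine ⟨?_, ?_⟩
  · have h2 := congrArg Matrix.conjTranspose h1
    rw [Matrix.conjTranspose_mul, ← toOp_conjTranspose, conjTranspose_one] at h2
    simp only [Obj.ext, ← Matrix.mul_assoc, h2]
  · simp only [Obj.ext, Matrix.mul_assoc, h1]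

lemma Obj.reduced_mono (h : a.Sub b) {B : Matrix (Fin n) (Fin n) (H →L[ℂ] H)}
    (hB : B ∈ ρ.reduced b) : B ∈ ρ.reduced a :=
  ⟨fun i j => LocalNet.commutant_mono h (hB.1 i j), hB.2⟩

lemma Obj.reduced_conjTranspose_mul {B C : Matrix (Fin n) (Fin n) (H →L[ℂ] H)}
    (hB : B ∈ ρ.reduced a) (hC : C ∈ ρ.reduced a) : Bᴴ * C ∈ ρ.reduced a := by
  refine ⟨fun i j => ?_, ?_, ?_⟩
  · rw [Matrix.mul_apply]
    exact sum_mem fun k _ => mul_mem (star_mem (hB.1 k i)) (hC.1 k j)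
  · have := congrArg Matrix.conjTranspose hB.2.2
    rw [Matrix.conjTranspose_mul, ← toOp_conjTranspose, conjTranspose_one] at this
    rw [← Matrix.mul_assoc, this]
  · rw [Matrix.mul_assoc, hC.2.2]

/-! ### Presheaf-left inverses -/

variable {τ : Obj A m} {S : Fin m → Fin n → A.quasi}

/-- The extension of `act` to rows over the commutant. -/
noncomputable def Obj.actExt (τ : Obj A m) (S : Fin m → Fin n → A.quasi) (a : DoubleCone)
    (x : Fin n → H →L[ℂ] H) (p : Fin m) : H →L[ℂ] H :=
  ∑ q, ∑ j, τ.ext a (x j) p q * S q j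

lemma sandwich_eq (R : Matrix (Fin m × Fin n) Unit A.quasi)
    (B : Matrix (Fin n) (Fin n) (H →L[ℂ] H)) :
    sandwich τ R a B = ∑ p, ∑ i, star (R (p, i) () : H →L[ℂ] H) *
      τ.actExt (fun p i => R (p, i) ()) a (B i) p := by
  rw [sandwich, Matrix.mul_assoc, Matrix.mul_apply, Fintype.sum_prod_type]
  refine Finset.sum_congr rfl fun p _ => Finset.sum_congr rfl fun i _ => ?_
  rw [Matrix.mul_apply, Fintype.sum_prod_type]
  rfl

lemma Obj.actExt_mul (x : Fin n → H →L[ℂ] H) (C : Matrix (Fin n) (Fin n) (H →L[ℂ] H))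
    (hx : ∀ j, x j ∈ (A.alg a).commutant) (hC : ∀ i j, C i j ∈ (A.alg a).commutant) (p : Fin m) :
    τ.actExt S a (x ᵥ* C) p = ∑ l, ∑ q, τ.ext a (x l) p q * τ.actExt S a (C l) q := by
  have h1 : ∀ j q, τ.ext a ((x ᵥ* C) j) p q =
      ∑ l, ∑ q', τ.ext a (x l) p q' * τ.ext a (C l j) q' q := by
    intro j q
    rw [Matrix.vecMul, dotProduct, Obj.ext_sum]
    refine Finset.sum_congr rfl fun l _ => ?_
    rw [Obj.ext_mul (hx l) (hC l j), Matrix.mul_apply]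
  simp only [Obj.actExt, h1, Finset.sum_mul, Finset.mul_sum, mul_assoc]
  exact (sum_rotate₄ _).trans (sum_rotate₄ _)

lemma Obj.actExt_ext (h : IsPair ρ.bim τ.bim S) {o : DoubleCone} (hρ : ρ.LocalizedIn o)
    (ho : a.Perp o) (hX : X ∈ (A.alg a).commutant) (i : Fin n) (p : Fin m) :
    τ.actExt S a (ρ.ext a X i) p = S p i * X := by
  obtain ⟨k, σ, U, hσ, hU⟩ := ρ.isObj.transportable a
  obtain ⟨l, τ', V, hτ', hV⟩ := τ.isObj.transportable a
  have hρ' := (ρ.localizedIn_iff o).1 hρ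
  rw [← h.sum_extBy ρ.isObj τ.isObj hU hV ho hρ' hσ hτ' hX]
  refine Finset.sum_congr rfl fun q _ => Finset.sum_congr rfl fun j _ => ?_
  rw [ρ.ext_eq_extBy hU hσ hX, τ.ext_eq_extBy hV hτ' (extBy_mem hU hσ hρ' ho hX i j)]

/-- The factorization of `sand_conjTranspose_mul` over the commutants; it is the source of complete
positivity. -/
lemma sum_star_mul_actExt {B C : Matrix (Fin n) (Fin n) (H →L[ℂ] H)}
    (hB : ∀ i j, B i j ∈ (A.alg a).commutant) (hC : ∀ i j, C i j ∈ (A.alg a).commutant) :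
    ∑ p, ∑ i, star (S p i : H →L[ℂ] H) * τ.actExt S a ((Bᴴ * C) i) p =
      ∑ k, ∑ q, star (τ.actExt S a (B k) q) * τ.actExt S a (C k) q := by
  have h1 : ∀ i p, τ.actExt S a ((Bᴴ * C) i) p =
      ∑ k, ∑ q, τ.ext a (star (B k i)) p q * τ.actExt S a (C k) q := fun i p =>
    τ.actExt_mul (Bᴴ i) C (fun j => star_mem (hB j i)) hC p
  have h2 : ∀ k q, star (τ.actExt S a (B k) q) =
      ∑ p, ∑ i, star (S p i : H →L[ℂ] H) * τ.ext a (star (B k i)) p q := by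
    intro k q
    simp only [Obj.actExt, star_sum, star_mul, ← τ.ext_conjTranspose, Matrix.conjTranspose_apply]
  simp only [h1, h2, Finset.mul_sum, Finset.sum_mul, mul_assoc]
  exact (sum_rotate₄ _).trans (sum_rotate₄ _)

/-- The maps `B ↦ r⁻¹ R* τ(B) R`. -/
noncomputable def leftInverse (ρ : Obj A n) (τ : Obj A m) (R : Matrix (Fin m × Fin n) Unit A.quasi)
    (r : ℝ) (a : DoubleCone) : ρ.reduced a →ₗ[ℂ] (H →L[ℂ] H) where
  toFun B := (r : ℂ)⁻¹ • sandwich τ R a B.1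
  map_add' B C := by
    have : (Matrix.of fun p q : Fin m × Fin n => τ.ext a ((B + C).1 p.2 q.2) p.1 q.1) =
        (Matrix.of fun p q : Fin m × Fin n => τ.ext a (B.1 p.2 q.2) p.1 q.1) +
        (Matrix.of fun p q : Fin m × Fin n => τ.ext a (C.1 p.2 q.2) p.1 q.1) := by
      ext1 p q
      exact congrFun (congrFun (τ.ext_add a (B.1 p.2 q.2) (C.1 p.2 q.2)) p.1) q.1
    rw [sandwich, this, Matrix.mul_add, Matrix.add_mul, Matrix.add_apply, smul_add]
    rfl
  map_smul' c B := by
    have : (Matrix.of fun p q : Fin m × Fin n => τ.ext a ((c • B).1 p.2 q.2) p.1 q.1) =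
        c • (Matrix.of fun p q : Fin m × Fin n => τ.ext a (B.1 p.2 q.2) p.1 q.1) := by
      ext1 p q
      exact congrFun (congrFun (τ.ext_smul a c (B.1 p.2 q.2)) p.1) q.1
    rw [sandwich, this, Matrix.mul_smul, Matrix.smul_mul, Matrix.smul_apply, smul_comm]
    rfl

lemma sum_inner_nonneg {r : ℝ} (hr : 0 ≤ r) (T : I → J → K → H →L[ℂ] H) (ξ : I → H) :
    0 ≤ ∑ i, ∑ j, ⟪ξ i, ((r : ℂ)⁻¹ • ∑ l, ∑ q, star (T i l q) * T j l q) (ξ j)⟫_ℂ := by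
  have h2 : ∀ i j, ⟪ξ i, ((r : ℂ)⁻¹ • ∑ l, ∑ q, star (T i l q) * T j l q) (ξ j)⟫_ℂ =
      (r : ℂ)⁻¹ * ∑ l, ∑ q, ⟪T i l q (ξ i), T j l q (ξ j)⟫_ℂ := by
    intro i j
    rw [smul_apply, inner_smul_right]
    congr 1
    simp only [sum_apply, inner_sum]
    refine Finset.sum_congr rfl fun l _ => Finset.sum_congr rfl fun q _ => ?_
    change ⟪ξ i, ContinuousLinearMap.adjoint (T i l q) (T j l q (ξ j))⟫_ℂ = _
    rw [ContinuousLinearMap.adjoint_inner_right]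
  have h3 : ∑ i, ∑ j, (r : ℂ)⁻¹ * ∑ l, ∑ q, ⟪T i l q (ξ i), T j l q (ξ j)⟫_ℂ =
      (r : ℂ)⁻¹ * ∑ l, ∑ q, ⟪∑ i, T i l q (ξ i), ∑ j, T j l q (ξ j)⟫_ℂ := by
    simp only [sum_inner, inner_sum, ← Finset.mul_sum]
    congr 1
    refine ((sum_rotate₄ _).trans (sum_rotate₄ _)).trans ?_
    exact Finset.sum_congr rfl fun l _ => Finset.sum_congr rfl fun q _ => Finset.sum_comm
  have h4 : ∀ ζ : H, 0 ≤ ⟪ζ, ζ⟫_ℂ := by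
    intro ζ
    rw [inner_self_eq_norm_sq_to_K]
    have : (0 : ℂ) ≤ ((‖ζ‖ ^ 2 : ℝ) : ℂ) := Complex.zero_le_real.2 (sq_nonneg _)
    rwa [Complex.ofReal_pow] at this
  simp only [h2, h3]
  refine mul_nonneg ?_ (Finset.sum_nonneg fun l _ => Finset.sum_nonneg fun q _ => h4 _)
  rw [← Complex.ofReal_inv]
  exact Complex.zero_le_real.2 (inv_nonneg.2 hr)

/-- The entries of S lie in 𝔄(o), hence in 𝔄(a)', so the values stay in 𝔄(a)'. Normalization is S*S
= r, and the module property is τ_a(ρ_a(X)) S = S X. -/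
theorem isPresheafLeftInverse (h : IsPair ρ.bim τ.bim S) {r : ℝ} (hr : 0 < r)
    (hs : sand τ.bim S (ρ.bim 1) = (r : ℂ) • 1) {o : DoubleCone} (hρ : ρ.LocalizedIn o)
    (hτ : τ.LocalizedIn o) :
    IsPresheafLeftInverse ρ o (leftInverse ρ τ (Matrix.of fun q _ => S q.1 q.2) r) := by
  have hr0 : (r : ℂ) ≠ 0 := by exact_mod_cast hr.ne'
  have hρ' := (ρ.localizedIn_iff o).1 hρ
  have hτ' := (τ.localizedIn_iff o).1 hτ
  have hS : ∀ {a : DoubleCone}, a.Perp o → ∀ p i, (S p i : H →L[ℂ] H) ∈ (A.alg a).commutant :=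
    fun ha p i => LocalNet.mem_commutant_of_perp ha.symm (h.mem hρ' hτ' p i)
  have hφ : ∀ a (B : ρ.reduced a), leftInverse ρ τ (Matrix.of fun q _ => S q.1 q.2) r a B =
      (r : ℂ)⁻¹ • ∑ p, ∑ i, star (S p i : H →L[ℂ] H) * τ.actExt S a (B.1 i) p := by
    intro a B
    change (r : ℂ)⁻¹ • sandwich τ (Matrix.of fun q _ => S q.1 q.2) a B.1 = _
    rw [sandwich_eq]
    simp only [Matrix.of_apply]
  have h1 : ∀ {a : DoubleCone}, a.Perp o → toOp (ρ.bim 1) ∈ ρ.reduced a := by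
    refine fun ha => ⟨fun i j => LocalNet.mem_commutant_of_perp ha.symm (hρ'.one_mem i j), ?_, ?_⟩
    · rw [← toOp_mul, one_mul']
    · rw [← toOp_mul, one_mul']
  refine ⟨hρ, fun a ha B => ?_, fun a ha => ⟨h1 ha, ?_⟩, fun a ha k B ξ =>
    ⟨fun i j => ρ.reduced_conjTranspose_mul (B i).2 (B j).2, ?_⟩,
    fun a b ha hb hab B => ⟨ρ.reduced_mono hab B.2, ?_⟩, fun a ha B X hX => ⟨⟨fun i j => ?_, ?_, ?_⟩, ?_⟩⟩
  · rw [hφ]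
    refine (A.alg a).commutant.toStarSubalgebra.smul_mem (sum_mem fun p _ => sum_mem fun i _ => ?_) _
    refine mul_mem (star_mem (hS ha p i)) (sum_mem fun q _ => sum_mem fun j _ => ?_)
    exact mul_mem (τ.ext_mem hτ ha (B.2.1 i j) p q) (hS ha q j)
  · rw [hφ]
    have h2 : ∀ p i, τ.actExt S a (toOp (ρ.bim 1) i) p = act τ.bim S (ρ.bim 1 i) p := by
      intro p i
      simp only [act_apply, AddSubmonoidClass.coe_finsetSum, MulMemClass.coe_mul]
      refine Finset.sum_congr rfl fun q _ => Finset.sum_congr rfl fun j _ => ?_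
      have := τ.ext_of_perp ha.symm (hρ'.one_mem i j)
      exact congrArg (· * (S q j : H →L[ℂ] H)) (congrFun (congrFun this p) q)
    have h3 := congrArg (fun x : A.quasi => (x : H →L[ℂ] H)) hs
    rw [sand_apply] at h3
    simp only [AddSubmonoidClass.coe_finsetSum, MulMemClass.coe_mul] at h3
    simp only [h2]
    refine (congrArg _ h3).trans ?_
    change (r : ℂ)⁻¹ • (r : ℂ) • (1 : H →L[ℂ] H) = 1
    rw [smul_smul, inv_mul_cancel₀ hr0, one_smul]
  · simp only [hφ, sum_star_mul_actExt (B _).2.1 (B _).2.1]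
    exact sum_inner_nonneg hr.le (fun i l q => τ.actExt S a ((B i).1 l) q) ξ
  · rw [hφ, hφ]
    congr 1
    refine Finset.sum_congr rfl fun p _ => Finset.sum_congr rfl fun i _ => ?_
    congr 1
    refine Finset.sum_congr rfl fun q _ => Finset.sum_congr rfl fun j _ => ?_
    rw [Obj.ext_of_sub hab (B.2.1 i j)]
  · rw [Matrix.mul_apply]
    exact sum_mem fun k _ => mul_mem (B.2.1 i k) (ρ.ext_mem hρ ha hX k j)
  · rw [← Matrix.mul_assoc, B.2.2.1]
  · rw [Matrix.mul_assoc, Obj.mul_ext.2]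
  · rw [hφ, hφ, smul_mul_assoc, Finset.sum_mul]
    refine congrArg (fun x => (r : ℂ)⁻¹ • x) ?_
    refine Finset.sum_congr rfl fun p _ => ?_
    rw [Finset.sum_mul]
    refine Finset.sum_congr rfl fun i _ => ?_
    refine (congrArg (fun x => star (S p i : H →L[ℂ] H) * x) ?_).trans (mul_assoc _ _ _).symm
    refine (τ.actExt_mul (B.1 i) (ρ.ext a X) (B.2.1 i) (fun i j => ρ.ext_mem hρ ha hX i j) p).trans ?_
    simp only [Obj.actExt_ext h hρ ha hX]
    rw [Obj.actExt, Finset.sum_mul, Finset.sum_comm]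
    refine Finset.sum_congr rfl fun q _ => ?_
    rw [Finset.sum_mul]
    exact Finset.sum_congr rfl fun j _ => (mul_assoc _ _ _).symm

end

end LeftInverse

end Sectors

namespace Sectors

section Homogeneity

variable {H : Type*} [NormedAddCommGroup H] [InnerProductSpace ℂ H] [CompleteSpace H]
  {A : LocalNet H} {I J K L M P Q : Type} [Fintype I] [Fintype J] [Fintype K] [Fintype L]
  [Fintype M] [Fintype P] [Fintype Q]

namespace Bimodule

/-! ### Transport of left inverses -/

section MapPair

variable {σ : Bimodule A I} {τ : Bimodule A P} {τ' : Bimodule A L} {S : P → I → A.quasi}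
  {V : Matrix L P A.quasi}

/-- The operator `(V × 1) S`. -/
noncomputable def mapPair (V : Matrix L P A.quasi) (S : P → I → A.quasi) : L → I → A.quasi :=
  fun l i => ∑ p, V l p * S p i

lemma act_mapPair (hV : τ.IsArrow τ' V) (x : I → A.quasi) (l : L) :
    act τ' (mapPair V S) x l = ∑ p, V l p * act τ S x p := by
  calc act τ' (mapPair V S) x l
      = ∑ i, ∑ p, (∑ l', τ' (x i) l l' * V l' p) * S p i := by
        simp only [act_apply, mapPair, Finset.mul_sum, Finset.sum_mul, mul_assoc]
        exact (sum_rotate₃ _).symm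
    _ = _ := by
        simp only [← hV.entry, act_apply, Finset.mul_sum, Finset.sum_mul, mul_assoc]
        exact (sum_rotate₃ _).trans (Finset.sum_congr rfl fun q _ => Finset.sum_comm)

lemma IsPair.map (h : IsPair σ τ S) (hV : τ.IsArrow τ' V) : IsPair σ τ' (mapPair V S) := by
  intro X i l
  rw [act_mapPair hV, mapPair, Finset.sum_mul]
  exact Finset.sum_congr rfl fun p _ => by rw [h, mul_assoc]

lemma sum_one_mul_act (x : I → A.quasi) (p : P) :
    ∑ q, τ 1 p q * act τ S x q = act τ S x p := by
  rw [← act_mul_left]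
  simp only [one_mul]

lemma sand_mapPair (hV : τ.IsIsometry τ' V) (B : Matrix I I A.quasi) :
    sand τ' (mapPair V S) B = sand τ S B := by
  calc sand τ' (mapPair V S) B
      = ∑ p, ∑ i, star (S p i) * ∑ q, (∑ l, star (V l p) * V l q) * act τ S (B i) q := by
        simp only [sand_apply, act_mapPair hV.isArrow, mapPair, star_sum, star_mul,
          Finset.mul_sum, Finset.sum_mul, mul_assoc]
        exact (sum_rotate₄ _).trans (Finset.sum_congr rfl fun p _ => (sum_rotate₃ _).symm)
    _ = _ := by
        rw [sand_apply]
        refine Finset.sum_congr rfl fun p _ => Finset.sum_congr rfl fun i _ => ?_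
        rw [← sum_one_mul_act (τ := τ)]
        congr 1
        refine Finset.sum_congr rfl fun q _ => ?_
        rw [← hV.star_mul_self, Matrix.mul_apply]
        rfl

end MapPair

lemma IsFaithfulPair.exists_pos [Nontrivial H] {σ : Bimodule A I} {τ : Bimodule A P}
    {S : P → I → A.quasi} (h : IsFaithfulPair σ τ S) (h0 : σ 1 ≠ 0) :
    ∃ r : ℝ, 0 < r ∧ sand τ S (σ 1) = (r : ℂ) • 1 := by
  obtain ⟨r, hr, hr0, hs⟩ := h.1.exists_scalar
  refine ⟨r, lt_of_le_of_ne hr fun e => h0 ?_, hs⟩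
  ext1 i i'
  have h1 := h.2 (σ 1 i) (funext fun p => by
    rw [h.1, hr0 e.symm, zero_mul]
    rfl)
  have h2 : σ 1 i ᵥ* σ 1 = (σ 1 * σ 1) i := rfl
  rw [h2, one_mul'] at h1
  exact congrFun h1 i'

/-- The pair `(τ, S)` can be transported. -/
lemma IsPair.exists_transport {σ : Bimodule A I} {σ' : Bimodule A J} {τ : Bimodule A P}
    {S : P → I → A.quasi} (h : IsPair σ τ S) (hτ : τ.IsObj) {U : Matrix J I A.quasi}
    (hU : σ.IsUnitaryArrow σ' U) (o : DoubleCone) :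
    ∃ (k : ℕ) (τ' : Obj A k) (S' : Fin k → J → A.quasi), τ'.LocalizedIn o ∧
      IsPair σ' τ'.bim S' ∧ sand τ'.bim S' (σ' 1) = sand τ S (σ 1) := by
  obtain ⟨k, τ', W, hτ', hτ'o, hW⟩ := hτ.exists_transport o
  have hU' := hU.symm.isIsometry.isArrow
  refine ⟨k, hτ'.toObj, mapPair W (restrictPair τ S Uᴴ), (Obj.localizedIn_iff _ _).2 hτ'o,
    (h.restrict hU').map hW.isIsometry.isArrow, ?_⟩
  refine (sand_mapPair hW.isIsometry _).trans ?_
  rw [sand_restrictPair, hU'.mul_one, Matrix.conjTranspose_conjTranspose,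
    hU.isIsometry.star_mul_self]

end Bimodule

/-! ### Homogeneity and double faithfulness from a pair -/

open Bimodule

/-- A pair with S*S > 0 follows any unitary equivalence, and its partner can be moved to the cone at
hand without changing the scalar S*S. -/
theorem homogeneous_of_isPair {n : ℕ} {ρ : Obj A n} {τ : Bimodule A P} {S : P → Fin n → A.quasi}
    (h : IsPair ρ.bim τ S) (hτ : τ.IsObj) {r : ℝ} (hr : 0 < r)
    (hs : sand τ S (ρ.bim 1) = (r : ℂ) • 1) : ρ.Homogeneous := by
  rintro m σ ⟨U, hU⟩ a hσ
  obtain ⟨k, τ', S', hτ', h', hs'⟩ := h.exists_transport hτ hU a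
  exact ⟨_, isPresheafLeftInverse h' hr (hs'.trans hs) hσ hτ'⟩

/-- γ and τ are first moved to a cone o spacelike to a. There S'X = τ'_a(γ'_a(X)) S', so γ'_a(X) = 0
gives S'*S'X = rX = 0. -/
theorem doublyFaithful_of_isPair {n : ℕ} {γ : Obj A n} {τ : Bimodule A P}
    {S : P → Fin n → A.quasi} (h : IsPair γ.bim τ S) (hτ : τ.IsObj) {r : ℝ} (hr : 0 < r)
    (hs : sand τ S (γ.bim 1) = (r : ℂ) • 1) : γ.DoublyFaithful := by
  intro a X hX h0
  obtain ⟨o, ho⟩ := DoubleCone.exists_perp_to a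
  obtain ⟨m, γ', U, hγ', hU⟩ := γ.exists_transport o
  obtain ⟨k, τ', S', hτ', h', hs'⟩ := h.exists_transport hτ hU o
  obtain ⟨l, σ, V, hσ, hV⟩ := γ'.isObj.transportable a
  -- Transport by U conjugates the extension, so its kernel is unchanged.
  have h1 : γ'.ext a X = 0 := by
    have e1 := γ.ext_eq_extBy (hV.trans hU) hσ hX
    rw [h0] at e1
    have e2 : V = V * U * Uᴴ := by
      rw [Matrix.mul_assoc, hU.mul_star_self, hV.isIsometry.isArrow.mul_one]
    rw [γ'.ext_eq_extBy hV hσ hX, e2]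
    have e3 : extBy (V * U * Uᴴ) X = toOp U * extBy (V * U) X * toOp Uᴴ := by
      rw [extBy, extBy, toOp_mul (V * U) Uᴴ, Matrix.conjTranspose_mul, toOp_conjTranspose,
        Matrix.conjTranspose_conjTranspose]
      simp only [Matrix.mul_assoc]
    rw [e3, ← e1, Matrix.mul_zero, Matrix.zero_mul]
  have h2 : ∀ p i, (S' p i : H →L[ℂ] H) * X = 0 := by
    intro p i
    rw [← Obj.actExt_ext h' hγ' ho.symm hX, h1, Obj.actExt]
    refine Finset.sum_eq_zero fun q _ => Finset.sum_eq_zero fun j _ => ?_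
    have := map_zero (τ'.extₗ a)
    have h3 : τ'.ext a ((0 : Matrix (Fin m) (Fin m) (H →L[ℂ] H)) i j) p q = 0 :=
      congrFun (congrFun this p) q
    rw [h3, zero_mul]
  have h3 := congrArg (fun x : A.quasi => (x : H →L[ℂ] H) * X) (h'.sand_one.symm.trans
    (hs'.trans hs))
  simp only [AddSubmonoidClass.coe_finsetSum, MulMemClass.coe_mul, Finset.sum_mul, mul_assoc, h2,
    mul_zero, Finset.sum_const_zero] at h3
  have h4 : ((((r : ℂ) • (1 : A.quasi) : A.quasi)) : H →L[ℂ] H) * X = (r : ℂ) • X := by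
    change ((r : ℂ) • (1 : H →L[ℂ] H)) * X = _
    rw [smul_mul_assoc, one_mul]
  rw [h4] at h3
  exact (smul_eq_zero.1 h3.symm).resolve_left (by exact_mod_cast hr.ne')

/-! ### Solutions of the conjugate equations -/

/-- The translation into entries. The extra factors ρ(1) in the zigzag are removed by the
intertwining relation of R at X = 1. -/
lemma SolvesConjugateEquations.isConjugatePair {n m : ℕ} {ρ : Obj A n} {τ : Obj A m}
    {R : Matrix (Fin m × Fin n) Unit A.quasi} {R' : Matrix (Fin n × Fin m) Unit A.quasi}
    (h : SolvesConjugateEquations ρ τ R R') :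
    IsConjugatePair ρ.bim τ.bim (fun p i => R (p, i) ()) (fun i p => R' (i, p) ()) := by
  have key : ∀ {n m : ℕ} {ρ : Obj A n} {τ : Obj A m} {R : Matrix (Fin m × Fin n) Unit A.quasi},
      (unit A).IsArrow (τ.bim.tensor ρ.bim) R → IsPair ρ.bim τ.bim fun p i => R (p, i) () := by
    intro n m ρ τ R h X i p
    have := congrFun (congrFun (h.intertwine X) (p, i)) ()
    rw [Matrix.mul_apply, Matrix.mul_apply, Fintype.sum_prod_type] at this
    simp only [Finset.univ_unique, Finset.sum_singleton] at this
    exact this.symm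
  have hp := key h.isArrow_left
  refine ⟨hp, key h.isArrow_right, fun b i => ?_⟩
  rw [← h.zigzag_left, zigzag, Matrix.mul_apply]
  have e1 : ∀ k : Fin n × (Fin m × Fin n), Matrix.reindex (Equiv.punitProd (Fin n))
      (Equiv.prodAssoc (Fin n) (Fin m) (Fin n)) (tensorArrow (ρ.bim.tensor τ.bim) R'ᴴ (ρ.bim 1))
      b k = ∑ a, ∑ p, star (R' (a, p) ()) * ρ.bim (τ.bim (ρ.bim 1 b k.2.2) p k.2.1) a k.1 := by
    intro k
    rw [← Fintype.sum_prod_type' (f := fun a p => star (R' (a, p) ()) *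
      ρ.bim (τ.bim (ρ.bim 1 b k.2.2) p k.2.1) a k.1)]
    rfl
  have e2 : ∀ k : Fin n × (Fin m × Fin n), Matrix.reindex (Equiv.refl _)
      (Equiv.prodPUnit (Fin n)) (tensorArrow ρ.bim (ρ.bim 1) R) k i = ρ.bim (R k.2 ()) k.1 i := by
    intro k
    have : ρ.bim (R k.2 ()) k.1 i = ∑ l, ρ.bim 1 k.1 l * ρ.bim (R k.2 ()) l i := by
      rw [← mul_apply', one_mul]
    exact this.symm
  have e3 : ∀ p a, ρ.bim (R (p, b) ()) a i = ∑ q, ∑ j, ∑ c,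
      ρ.bim (τ.bim (ρ.bim 1 b j) p q) a c * ρ.bim (R (q, j) ()) c i := by
    intro p a
    have h1 := hp 1 b p
    rw [mul_one] at h1
    change _ = R (p, b) () at h1
    rw [← h1, act_apply, sum_apply']
    simp only [sum_apply', mul_apply']
  simp only [e1, e2, e3, Fintype.sum_prod_type, Finset.mul_sum, Finset.sum_mul, mul_assoc]
  refine Eq.symm ((sum_rotate₅ _).trans (Finset.sum_congr rfl fun p _ => ?_))
  refine (sum_rotate₄ _).trans (Finset.sum_congr rfl fun a _ => ?_)
  exact (sum_rotate₃ _).symm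

lemma Obj.IsDirectSumOf.mono {n : ℕ} {ρ : Obj A n} {p q : ∀ m : ℕ, Obj A m → Prop}
    (h : ρ.IsDirectSumOf p) (hpq : ∀ m σ, p m σ → q m σ) : ρ.IsDirectSumOf q := by
  obtain ⟨k, m, σ, W, h1, h2⟩ := h
  exact ⟨k, m, σ, W, fun i => hpq _ _ (h1 i), h2⟩

end Homogeneity

end Sectors


/-! ### The theorem -/

theorem theorem4p1 {H : Type*} [NormedAddCommGroup H] [InnerProductSpace ℂ H] [CompleteSpace H]
    [TopologicalSpace.SeparableSpace H] (hdim : ¬ FiniteDimensional ℂ H)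
    (A : Sectors.LocalNet H) {n : ℕ} (ρ : Sectors.Obj A n) (hρ : ρ.HasConjugate) :
    ρ.InFh ∧ ρ.FiniteStatistics ∧
    ρ.IsDirectSumOf (fun _ σ => σ.Irreducible ∧ σ.Homogeneous) ∧
    (ρ.Nonzero → ρ.Homogeneous ∧
      ∀ (o : Sectors.DoubleCone) (m : ℕ) (ρbar : Sectors.Obj A m)
        (R : Matrix (Fin m × Fin n) Unit A.quasi) (R' : Matrix (Fin n × Fin m) Unit A.quasi),
        ρ.LocalizedIn o → ρbar.LocalizedIn o →
        Sectors.SolvesConjugateEquations ρ ρbar R R' →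
        ∃ r : ℝ, 0 < r ∧ Rᴴ * R = (r : ℂ) • 1 ∧
          ∃ φ, Sectors.IsPresheafLeftInverse ρ o φ ∧ ∀ a : Sectors.DoubleCone, a.Perp o →
            ∀ B : ρ.reduced a, φ a B = (r : ℂ)⁻¹ • Sectors.sandwich ρbar R a B.1) := by
  open Sectors Sectors.Bimodule in
  have : Nontrivial H := by
    by_contra h
    rw [not_nontrivial_iff_subsingleton] at h
    exact hdim inferInstance
  obtain ⟨m, ρbar, R, R', hR⟩ := hρ
  have hc := hR.isConjugatePair
  have hd := isDirectSumOf_irreducible hc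
  have hF : ρ.InFh := by
    refine hd.mono ?_
    rintro k σ ⟨hirr, S, S', h⟩
    refine ⟨⟨hirr, exists_isStatisticsTriple hirr ρbar.isObj h⟩, fun d l γ V hV => ?_⟩
    obtain ⟨P', _, τ', S', hτ', h'⟩ := hV.exists_pair hirr ρbar.isObj h
    -- γ is nonzero because it is faithful: γ(1) = 0 would force 1 = 0.
    obtain ⟨r, hr, hs⟩ := h'.exists_pos fun h0 => one_ne_zero (hV.faithful 1 h0)
    exact doublyFaithful_of_isPair h'.1 hτ' hr hs
  refine ⟨hF, hF.mono fun _ _ h => h.1, hd.mono ?_, fun h0 => ⟨?_, ?_⟩⟩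
  · rintro k σ ⟨hirr, S, S', h⟩
    obtain ⟨r, -, hr, -, hs, -⟩ := h.exists_scalars hirr.1
    exact ⟨hirr, homogeneous_of_isPair h.isPair ρbar.isObj hr hs⟩
  · obtain ⟨r, -, hr, -, hs, -⟩ := hc.exists_scalars h0
    exact homogeneous_of_isPair hc.isPair ρbar.isObj hr hs
  · intro o m ρbar R R' hρ hρbar hR
    have hc := hR.isConjugatePair
    obtain ⟨r, -, hr, -, hs, -⟩ := hc.exists_scalars h0
    refine ⟨r, hr, ?_, leftInverse ρ ρbar R r, isPresheafLeftInverse hc.isPair hr hs hρ hρbar,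
      fun a _ B => rfl⟩
    ext1 i j
    rw [Matrix.mul_apply, Fintype.sum_prod_type]
    exact (hc.isPair.sand_one.symm.trans hs).trans
      (by rw [Matrix.smul_apply, Subsingleton.elim i j, Matrix.one_apply_eq])
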